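/- **Notation.** For an entire function $f$ put $f^*(z)=\overline{f(\bar z)}$. An entire function $E$ is of Hermite–Biehler class if $|E(\bar z)|<|E(z)|$ whenever $\operatorname{Im} z>0$. For such $E$, the de Branges space $\mathcal H(E)$ is the Hilbert space of all entire functions $f$ with $\|f\|_E^2=\int_{\mathbb R}|f(t)/E(t)|^2\,dt<\infty$ such that $f/E$ and $f^*/E$ are of bounded type (quotients of bounded analytic functions) and of nonpositive mean type $\limsup_{y\to+\infty} y^{-1}\log|\cdot(iy)|$ in the upper half-plane, with inner product $\langle f,g\rangle_E=\int_{\mathbb R} f(t)\overline{g(t)}\,|E(t)|^{-2}\,dt$. Its reproducing kernel is $$K_E(w,z)=\frac{\overline{E(w)}E(z)-E(\bar w)E^*(z)}{2\pi i(\bar w-z)},$$ extended by continuity to $z=\bar w$. A phase function of $E$ is a continuous strictly increasing $\varphi:\mathbb R\to\mathbb R$ such that $E(x)e^{i\varphi(x)}\in\mathbb R$ for all $x\in\mathbb R$. A Parseval frame for a Hilbert space $\mathcal H$ is a family $(f_n)$ in $\mathcal H$ with $\sum_n|\langle f,f_n\rangle|^2=\|f\|^2$ for all $f\in\mathcal H$.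 Parseval frames $(u_n)$ of $\mathcal H_1$ and $(v_n)$ of $\mathcal H_2$ are orthogonal if $\sum_n\langle f,u_n\rangle v_n=0$ for all $f\in\mathcal H_1$ and $\sum_n\langle g,v_n\rangle u_n=0$ for all $g\in\mathcal H_2$. **Theorem.** Let $E$ and $F$ be of Hermite–Biehler class, let $\varphi_{EF}$ be a phase function of $EF$, and let $\alpha\in[0,\pi)$. Let $(\lambda_n)_{n\in\mathbb Z}$ be real numbers with $\varphi_{EF}(\lambda_n)=n\pi+\alpha$ for all $n\in\mathbb Z$, such that $\{K_{EF}(\lambda_n,\cdot)\}_{n\in\mathbb Z}$ is complete in $\mathcal H(EF)$, that is, has dense linear span. Then for every $f\in\mathcal H(E)$, $$\sum_{n\in\mathbb Z} f(\lambda_n)F(\lambda_n)\,\frac{E(\lambda_n)K_F(\lambda_n,\cdot)}{K_{EF}(\lambda_n,\lambda_n)}=0,$$ and for every $g\in\mathcal H(F)$, $$\sum_{n\in\mathbb Z} g(\lambda_n)E^*(\lambda_n)\,\frac{\overline{F(\lambda_n)}K_E(\lambda_n,\cdot)}{K_{EF}(\lambda_n,\lambda_n)}=0,$$ where the series converge unconditionally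 in the norms of $\mathcal H(F)$ and $\mathcal H(E)$, respectively. Consequently, the families $$\left\{\frac{\overline{F(\lambda_n)}K_E(\lambda_n,\cdot)}{\sqrt{K_{EF}(\lambda_n,\lambda_n)}}\right\}_{n\in\mathbb Z}\quad\text{and}\quad\left\{\frac{E(\lambda_n)K_F(\lambda_n,\cdot)}{\sqrt{K_{EF}(\lambda_n,\lambda_n)}}\right\}_{n\in\mathbb Z},$$ which are Parseval frames for $\mathcal H(E)$ and $\mathcal H(F)$, respectively, are orthogonal. -/

import Mathlib

open scoped ComplexConjugate

noncomputable section

namespace DeBranges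

open Filter Topology MeasureTheory

/-- `E` is an entire function of Hermite–Biehler class. -/
def HermiteBiehler (E : ℂ → ℂ) : Prop :=
  Differentiable ℂ E ∧ ∀ z : ℂ, 0 < z.im → ‖E (conj z)‖ < ‖E z‖

/-- The function `f^*(z) = conj (f (conj z))`. -/
def sharp (f : ℂ → ℂ) : ℂ → ℂ := fun z => conj (f (conj z))

/-- The open upper half-plane. -/
def upperHalf : Set ℂ := {z | 0 < z.im}

/-- `f` is analytic and of bounded type in the upper half-plane: `f = p / q` there, with `p`, `q`
bounded and analytic and `q` not identically zero. The quotient is written as `f * q = p`, so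
that `q` may vanish at isolated points. -/
def BoundedType (f : ℂ → ℂ) : Prop :=
  DifferentiableOn ℂ f upperHalf ∧
  ∃ p q : ℂ → ℂ, DifferentiableOn ℂ p upperHalf ∧ DifferentiableOn ℂ q upperHalf ∧
    (∃ C : ℝ, ∀ z ∈ upperHalf, ‖p z‖ ≤ C) ∧ (∃ C : ℝ, ∀ z ∈ upperHalf, ‖q z‖ ≤ C) ∧
    (∃ z ∈ upperHalf, q z ≠ 0) ∧ ∀ z ∈ upperHalf, f z * q z = p z

/-- The mean type of `f` in the upper half-plane, `limsup_{y → +∞} log |f(iy)| / y`, an extended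
real number (with `log 0 = -∞`). -/
def meanType (f : ℂ → ℂ) : EReal :=
  limsup (fun y : ℝ => ENNReal.log ‖f (y * Complex.I)‖ₑ / (y : EReal)) atTop

/-- The square of the norm of the de Branges space of `E`, as an extended nonnegative number. -/
def normSq (E f : ℂ → ℂ) : ENNReal := ∫⁻ t : ℝ, ‖f t / E t‖ₑ ^ 2

/-- The inner product of the de Branges space of `E`, linear in the first variable. -/
def inner (E f g : ℂ → ℂ) : ℂ := ∫ t : ℝ, f t * conj (g t) / ((‖E t‖ ^ 2 : ℝ) : ℂ)

/-- The set of functions of the de Branges space `H(E)`. -/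
def space (E : ℂ → ℂ) : Set (ℂ → ℂ) :=
  {f | Differentiable ℂ f ∧ normSq E f < ⊤ ∧
    BoundedType (fun z => f z / E z) ∧ meanType (fun z => f z / E z) ≤ 0 ∧
    BoundedType (fun z => sharp f z / E z) ∧ meanType (fun z => sharp f z / E z) ≤ 0}

/-- The numerator of the reproducing kernel. -/
def kernelNum (E : ℂ → ℂ) (w z : ℂ) : ℂ :=
  conj (E w) * E z - E (conj w) * sharp E z

/-- The reproducing kernel
`K_E(w, z) = (conj (E w) * E z - E (conj w) * E^* z) / (2πi (conj w - z))`. The numerator vanishes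
at `z = conj w`, where the quotient has a removable singularity; its value there is the limit,
minus the derivative of the numerator over `2πi`. -/
def kernel (E : ℂ → ℂ) (w z : ℂ) : ℂ :=
  if z = conj w then -deriv (kernelNum E w) (conj w) / (2 * Real.pi * Complex.I)
  else kernelNum E w z / (2 * Real.pi * Complex.I * (conj w - z))

/-- `φ` is a phase function of `E`: continuous, strictly increasing, and `E(x) e^{iφ(x)}` is real
for every real `x`. (When `E` has no real zeros, this says that `E(x) = |E(x)| e^{-iφ(x)}` for
all `x`, for `φ` or for `φ + π`.) -/
def IsPhaseFunction (E : ℂ → ℂ) (φ : ℝ → ℝ) : Prop :=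
  Continuous φ ∧ StrictMono φ ∧ ∀ x : ℝ, (E x * Complex.exp (Complex.I * φ x)).im = 0

/-- The linear span of the functions `u i` is dense in `H(E)`. -/
def IsCompleteSystem {ι : Type*} (E : ℂ → ℂ) (u : ι → ℂ → ℂ) : Prop :=
  ∀ h ∈ space E, ∀ ε > 0, ∃ g ∈ Submodule.span ℂ (Set.range u), normSq E (h - g) < ε

/-- The series `∑ i, u i` of elements of `H(E)` converges unconditionally, in the norm of `H(E)`,
to the element `s` of `H(E)`. -/
def HasSumIn {ι : Type*} (E : ℂ → ℂ) (u : ι → ℂ → ℂ) (s : ℂ → ℂ) : Prop :=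
  (∀ i, u i ∈ space E) ∧ s ∈ space E ∧
    Tendsto (fun T : Finset ι => normSq E (∑ i ∈ T, u i - s)) atTop (𝓝 0)

/-- `u` is a Parseval frame for `H(E)`. -/
def IsParsevalFrame {ι : Type*} (E : ℂ → ℂ) (u : ι → ℂ → ℂ) : Prop :=
  (∀ i, u i ∈ space E) ∧ ∀ f ∈ space E, ∑' i, ‖inner E f (u i)‖ₑ ^ 2 = normSq E f

/-- The composition of the synthesis operator of `v` (a system in `H(F)`) with the analysis
operator of `u` (a system in `H(E)`) is zero. -/
def SynthesisAnalysisZero {ι : Type*} (E F : ℂ → ℂ) (u v : ι → ℂ → ℂ) : Prop :=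
  ∀ f ∈ space E, HasSumIn F (fun i => inner E f (u i) • v i) 0

/-- Systems `u` in `H(E)` and `v` in `H(F)` are orthogonal. -/
def IsOrthogonalPair {ι : Type*} (E F : ℂ → ℂ) (u v : ι → ℂ → ℂ) : Prop :=
  SynthesisAnalysisZero E F u v ∧ SynthesisAnalysisZero F E v u

/-- The system `conj (F(λ_n)) K_E(λ_n, ·) / √K_{EF}(λ_n, λ_n)`. -/
def frameE (E F : ℂ → ℂ) (lam : ℤ → ℝ) (n : ℤ) : ℂ → ℂ := fun z =>
  conj (F (lam n)) * kernel E (lam n) z / (√(kernel (E * F) (lam n) (lam n)).re : ℝ)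

/-- The system `E(λ_n) K_F(λ_n, ·) / √K_{EF}(λ_n, λ_n)`. -/
def frameF (E F : ℂ → ℂ) (lam : ℤ → ℝ) (n : ℤ) : ℂ → ℂ := fun z =>
  E (lam n) * kernel F (lam n) z / (√(kernel (E * F) (lam n) (lam n)).re : ℝ)

end DeBranges

end

/-! Multiplication by `F` embeds `H(E)` isometrically into `H(EF)`, and multiplication by `E^*`
embeds `H(F)` isometrically into the same space. The two images are orthogonal: on the real line the
integrand of `⟨g E^*, f F⟩` reduces to `f^* g / (EF)`, the product of `f^*/E` and `g/F`. It is of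
bounded type and of nonpositive mean type in the upper half-plane, and integrable on the line as a
product of two square integrable functions, so its integral vanishes (`integral_sharp_mul_div`).

At the points `λ_n` the phase condition makes the kernels of `H(EF)` mutually orthogonal
(`kernel_eq_zero_of_isPhaseFunction`), so after normalization and completeness they expand every
element of `H(EF)`. By the reproducing property (`inner_kernel`), the adjoint of each embedding
sends the normalized kernels to the corresponding frame. Parseval's identity in `H(EF)` therefore
gives the Parseval frames. Expanding `f F` in the kernels and projecting termwise onto the image of
`H(F)` gives the vanishing series, because the projection of `f F` is zero
(`IsIsometricMultiplier.synthesisAnalysisZero`).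

The analytic core is Cauchy's theorem `integral_eq_zero_of_boundedType`, proved in the disc. Bounded
type bounds the circle averages of `log⁺ ‖k‖`, so `log⁺ ‖k‖` is at most the Poisson integral of its
boundary values plus a point mass at `1`, the image of infinity. Nonpositive mean type removes the
point mass by Phragmén–Lindelöf. Jensen's inequality then bounds `‖k‖` by the Poisson integral of
`max 1 ‖k‖`, which is enough to let the radius tend to `1` in Cauchy's theorem. The same theorem
also yields the reproducing property. -/

/-! ### Poisson–Jensen inequalities in a disc. -/

namespace HardyDisc

open Filter Topology MeasureTheory Metric Set Real InnerProductSpace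

/-- The Poisson average of `log ‖· - u‖` over a circle dominates its value inside the circle. -/
theorem log_norm_sub_le_circleAverage {R : ℝ} {w u : ℂ} (hw : w ∈ ball (0 : ℂ) R)
    (hu : u ∈ closedBall (0 : ℂ) R) (hne : w ≠ u) :
    log ‖w - u‖ ≤ circleAverage (poissonKernel 0 w * fun z ↦ log ‖z - u‖) 0 R := by
  have hR : 0 < R := pos_of_mem_ball hw
  rw [poissonKernel_eq_re_herglotzRieszKernel]
  rcases eq_or_lt_of_le (mem_closedBall_zero_iff.1 hu) with h | h
  · rw [circleAverage_re_herglotzRieszKernel_mul_log (by simpa using h) hw]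
  · have hw' : ‖w‖ < R := by simpa using hw
    have hnz : ∀ z ∈ closedBall (0 : ℂ) R, (R : ℂ) ^ 2 - conj u * z ≠ 0 := by
      intro z hz h0
      have hz' : ‖z‖ ≤ R := by simpa using hz
      have : ‖(R : ℂ) ^ 2‖ = ‖conj u * z‖ := by rw [sub_eq_zero.1 h0]
      rw [norm_mul, norm_pow, Complex.norm_real, RCLike.norm_conj, norm_of_nonneg hR.le] at this
      nlinarith [norm_nonneg u, norm_nonneg z]
    -- For `‖u‖ < R`, the reflected factor `(R² - conj u * z) / R` has the same modulus as `z - u`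
    -- on the circle and no zero in the closed disc. Its log-modulus is harmonic there, so the
    -- Poisson integral returns its value at `w`, which dominates `log ‖w - u‖`.
    have hcirc : circleAverage (Complex.re ∘ herglotzRieszKernel 0 w * fun z ↦ log ‖z - u‖) 0 R
        = circleAverage (Complex.re ∘ herglotzRieszKernel 0 w •
            fun z ↦ log ‖((R : ℂ) ^ 2 - conj u * z) / R‖) 0 R := by
      apply circleAverage_congr_sphere
      intro z hz
      rw [abs_of_pos hR] at hz
      have h1 := Complex.norm_canonicalFactor_eval_circle_eq_one (w := u) (by simpa using h) hz
      have hzu : z - u ≠ 0 := by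
        intro h0
        rw [sub_eq_zero] at h0
        simp [h0] at hz; linarith
      rw [Complex.canonicalFactor_apply, norm_div, norm_mul] at h1
      have h2 : ‖z - u‖ = ‖((R : ℂ) ^ 2 - conj u * z) / R‖ := by
        rw [div_eq_one_iff_eq (by simp [hR.ne', hzu])] at h1
        rw [norm_div, h1, mul_div_cancel_left₀ _ (by simp [hR.ne'])]
      simp [h2]
    rw [hcirc, HarmonicOnNhd.circleAverage_re_herglotzRieszKernel_smul _ hw]
    · apply log_le_log (norm_pos_iff.2 (sub_ne_zero.2 hne))
      rw [norm_div, Complex.norm_real, norm_of_nonneg hR.le, le_div_iff₀ hR]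
      rw [← sq_le_sq₀ (by positivity) (norm_nonneg _)]
      rw [mul_pow, ← Complex.normSq_eq_norm_sq, ← Complex.normSq_eq_norm_sq]
      have e : Complex.normSq ((R : ℂ) ^ 2 - conj u * w) - Complex.normSq (w - u) * R ^ 2
          = (R ^ 2 - Complex.normSq u) * (R ^ 2 - Complex.normSq w) := by
        simp [Complex.normSq_apply, pow_two]; ring
      have : 0 ≤ (R ^ 2 - Complex.normSq u) * (R ^ 2 - Complex.normSq w) := by
        rw [Complex.normSq_eq_norm_sq, Complex.normSq_eq_norm_sq]
        apply mul_nonneg <;> nlinarith [norm_nonneg u, norm_nonneg w]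
      linarith
    · intro z hz
      apply AnalyticAt.harmonicAt_log_norm
      · fun_prop (disch := simp [hR.ne'])
      · simpa [hR.ne'] using hnz z hz

theorem continuousOn_poissonKernel_sphere {R : ℝ} {w : ℂ} (hw : w ∈ ball (0 : ℂ) R) :
    ContinuousOn (poissonKernel 0 w) (sphere 0 |R|) := by
  rw [poissonKernel_eq_re_herglotzRieszKernel]
  exact Complex.continuous_re.comp_continuousOn (continuousOn_herglotzRieszKernel_sphere hw)

/-- Multiplying by the Poisson kernel keeps circle integrability. -/
theorem circleIntegrable_poissonKernel_mul {R : ℝ} {w : ℂ} (hw : w ∈ ball (0 : ℂ) R) {u : ℂ → ℝ}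
    (hu : CircleIntegrable u 0 R) : CircleIntegrable (poissonKernel 0 w * u) 0 R := by
  apply IntervalIntegrable.continuousOn_mul hu
  apply Continuous.continuousOn
  exact (continuousOn_poissonKernel_sphere hw).comp_continuous (continuous_circleMap 0 R)
    (circleMap_mem_sphere' 0 R)

theorem poissonKernel_nonneg {R : ℝ} {w z : ℂ} (hw : w ∈ ball (0 : ℂ) R) (hz : z ∈ sphere (0 : ℂ) R) :
    0 ≤ poissonKernel 0 w z := by
  rw [poissonKernel_def]
  have h1 : ‖w‖ < R := by simpa using hw
  have h2 : ‖z‖ = R := by simpa using hz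
  simp only [sub_zero]
  apply div_nonneg _ (by positivity)
  rw [h2]; nlinarith [norm_nonneg w]

theorem accPt_closedBall {R : ℝ} {w : ℂ} (hw : w ∈ ball (0 : ℂ) R) :
    AccPt w (𝓟 (closedBall (0 : ℂ) R)) := by
  apply accPt_iff_frequently_nhdsNE.mpr
  apply Eventually.frequently
  exact eventually_nhdsWithin_of_eventually_nhds
    (Filter.mem_of_superset (isOpen_ball.mem_nhds hw) ball_subset_closedBall)

/-- The **Poisson–Jensen inequality**. -/
theorem log_norm_le_circleAverage {R : ℝ} {w : ℂ} {f : ℂ → ℂ} (hw : w ∈ ball (0 : ℂ) R)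
    (hf : AnalyticOnNhd ℂ f (closedBall 0 R)) (hfw : f w ≠ 0) :
    log ‖f w‖ ≤ circleAverage (poissonKernel 0 w * fun z ↦ log ‖f z‖) 0 R := by
  have hR : 0 < R := pos_of_mem_ball hw
  have hwc := ball_subset_closedBall hw
  have hfm := hf.meromorphicOn
  have hfin := (MeromorphicOn.divisor f (closedBall (0 : ℂ) R)).finiteSupport
    (isCompact_closedBall 0 R)
  have htop : ∀ u : closedBall (0 : ℂ) R, meromorphicOrderAt f u ≠ ⊤ := by
    rw [← hfm.exists_meromorphicOrderAt_ne_top_iff_forall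
      ⟨⟨w, hwc⟩, (convex_closedBall 0 R).isPreconnected⟩]
    refine ⟨⟨w, hwc⟩, ?_⟩
    rw [(hf w hwc).meromorphicNFAt.meromorphicOrderAt_eq_zero_iff.2 hfw]
    simp
  set D := MeromorphicOn.divisor f (closedBall (0 : ℂ) R) with hD
  -- Split off the finitely many zeros, leaving a zero-free `g`. The term `log ‖g‖` is harmonic and
  -- contributes an equality; each factor `z - u` contributes an inequality with the nonnegative
  -- weight `D u`.
  obtain ⟨g, h1, h2, h3⟩ := hfm.extract_zeros_poles htop hfin
  have hlog := MeromorphicOn.extract_zeros_poles_log h2 h3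
  have hw_eq := MeromorphicOn.log_norm_meromorphicTrailingCoeffAt_extract_zeros_poles hfin hwc
    (accPt_closedBall hw) (hfm w hwc) (h1 w hwc) (h2 ⟨w, hwc⟩) h3
  rw [(hf w hwc).meromorphicTrailingCoeffAt_of_ne_zero hfw] at hw_eq
  have hsub : sphere (0 : ℂ) |R| ⊆ closedBall 0 R := by
    rw [abs_of_pos hR]; exact sphere_subset_closedBall
  have hI : ∀ u, CircleIntegrable (fun z : ℂ ↦ log ‖z - u‖) 0 R := fun u ↦
    MeromorphicOn.circleIntegrable_log_norm (f := fun z ↦ z - u) (by intro z _; fun_prop)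
  have hsum : (∑ᶠ u, fun x ↦ (D u : ℝ) * log ‖x - u‖)
      = ∑ u ∈ hfin.toFinset, fun x ↦ (D u : ℝ) * log ‖x - u‖ := by
    rw [finsum_eq_sum_of_support_subset]
    intro u
    contrapose
    aesop
  have hsum' : ∑ᶠ u, (D u : ℝ) * log ‖w - u‖ = ∑ u ∈ hfin.toFinset, (D u : ℝ) * log ‖w - u‖ := by
    rw [finsum_eq_sum_of_support_subset]
    intro u
    aesop
  have havg : circleAverage (poissonKernel 0 w * fun z ↦ log ‖f z‖) 0 R =
      ∑ u ∈ hfin.toFinset,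
        (D u : ℝ) * circleAverage (poissonKernel 0 w * fun z ↦ log ‖z - u‖) 0 R + log ‖g w‖ := by
    calc circleAverage (poissonKernel 0 w * fun z ↦ log ‖f z‖) 0 R
      _ = circleAverage ((∑ u ∈ hfin.toFinset,
            fun z ↦ (D u : ℝ) • (poissonKernel 0 w * fun z ↦ log ‖z - u‖) z) +
            poissonKernel 0 w * fun z ↦ log ‖g z‖) 0 R := by
        apply circleAverage_congr_codiscreteWithin _ hR.ne'
        filter_upwards [codiscreteWithin_mono hsub hlog] with z hz
        simp only [Pi.mul_apply, hz, Pi.add_apply, Finset.sum_apply, smul_eq_mul, mul_add]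
        rw [← hD, hsum, Finset.sum_apply, Finset.mul_sum]
        congr 1
        exact Finset.sum_congr rfl fun _ _ ↦ by ring
      _ = _ := by
        rw [circleAverage_add, circleAverage_sum]
        · congr 1
          · exact Finset.sum_congr rfl fun u _ ↦ circleAverage_fun_smul
          · rw [poissonKernel_eq_re_herglotzRieszKernel]
            exact HarmonicOnNhd.circleAverage_re_herglotzRieszKernel_smul
              (fun x hx ↦ (h1 x hx).harmonicAt_log_norm (h2 ⟨x, hx⟩)) hw
        · intro u _
          exact IntervalIntegrable.const_mul (circleIntegrable_poissonKernel_mul hw (hI u)) _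
        · apply CircleIntegrable.sum
          intro u _
          exact IntervalIntegrable.const_mul (circleIntegrable_poissonKernel_mul hw (hI u)) _
        · exact circleIntegrable_poissonKernel_mul hw
            (h1.mono hsub).meromorphicOn.circleIntegrable_log_norm
  rw [havg, hw_eq, hsum']
  gcongr with u hu
  · exact_mod_cast MeromorphicOn.AnalyticOnNhd.divisor_nonneg hf u
  · have hu' : D u ≠ 0 := by simpa using hu
    have huc : u ∈ closedBall (0 : ℂ) R := D.supportWithinDomain hu'
    apply log_norm_sub_le_circleAverage hw huc
    rintro rfl
    apply hu'
    rw [hD, MeromorphicOn.divisor_apply hfm hwc,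
      (hf w hwc).meromorphicNFAt.meromorphicOrderAt_eq_zero_iff.2 hfw]
    rfl

/-- The Poisson inequality for the subharmonic function `log⁺ ‖f‖`. -/
theorem posLog_norm_le_circleAverage {R : ℝ} {w : ℂ} {f : ℂ → ℂ} (hw : w ∈ ball (0 : ℂ) R)
    (hf : AnalyticOnNhd ℂ f (closedBall 0 R)) :
    log⁺ ‖f w‖ ≤ circleAverage (poissonKernel 0 w * fun z ↦ log⁺ ‖f z‖) 0 R := by
  have hR : 0 < R := pos_of_mem_ball hw
  have hsub : sphere (0 : ℂ) |R| ⊆ closedBall 0 R := by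
    rw [abs_of_pos hR]; exact sphere_subset_closedBall
  have hm := (hf.mono hsub).meromorphicOn
  rcases le_or_gt (log ‖f w‖) 0 with h | h
  · rw [show log⁺ ‖f w‖ = 0 from max_eq_left h]
    apply circleAverage_nonneg_of_nonneg
    intro z hz
    rw [abs_of_pos hR] at hz
    exact mul_nonneg (poissonKernel_nonneg hw hz) posLog_nonneg
  · rw [show log⁺ ‖f w‖ = log ‖f w‖ from max_eq_right h.le]
    have hne : f w ≠ 0 := by rintro h0; simp [h0] at h
    apply (log_norm_le_circleAverage hw hf hne).trans
    apply circleAverage_mono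
    · exact circleIntegrable_poissonKernel_mul hw hm.circleIntegrable_log_norm
    · exact circleIntegrable_poissonKernel_mul hw hm.circleIntegrable_posLog_norm
    · intro z hz
      rw [abs_of_pos hR] at hz
      exact mul_le_mul_of_nonneg_left (le_max_right _ _) (poissonKernel_nonneg hw hz)

end HardyDisc

/-! ### Circle averages for functions of bounded type, and passage to the unit circle. -/

namespace HardyDisc

open Filter Topology MeasureTheory Metric Set Real InnerProductSpace

theorem sub_div_add_le_poissonKernel {R : ℝ} {w z : ℂ} (hw : w ∈ ball (0 : ℂ) R)
    (hz : z ∈ sphere (0 : ℂ) R) : (R - ‖w‖) / (R + ‖w‖) ≤ poissonKernel 0 w z := by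
  have := le_re_herglotzRieszKernel hz hw
  rw [poissonKernel_eq_re_herglotzRieszKernel]
  simpa [herglotzRieszKernel_def] using this

/-- If `k` is a quotient of bounded analytic functions in the disc then the averages of
`log⁺ ‖k‖` over concentric circles are bounded. -/
theorem exists_circleAverage_posLog_le {k p q : ℂ → ℂ} (hk : DifferentiableOn ℂ k (ball 0 1))
    (hq : DifferentiableOn ℂ q (ball 0 1)) (hp1 : ∀ z ∈ ball (0 : ℂ) 1, ‖p z‖ ≤ 1)
    (hq1 : ∀ z ∈ ball (0 : ℂ) 1, ‖q z‖ ≤ 1) (hkq : ∀ z ∈ ball (0 : ℂ) 1, k z * q z = p z)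
    {w : ℂ} (hw : w ∈ ball (0 : ℂ) 1) (hqw : q w ≠ 0) :
    ∃ M, ∀ᶠ r in 𝓝[<] (1 : ℝ), circleAverage (fun z ↦ log⁺ ‖k z‖) 0 r ≤ M := by
  have hw1 : ‖w‖ < 1 := by simpa using hw
  -- Off the zeros of `q`, `log⁺ ‖k‖ ≤ -log ‖q‖`. Poisson–Jensen at `w` bounds the average of `-log
  -- ‖q‖` by `-log ‖q w‖ / κ`, where `κ = (r - ‖w‖) / (r + ‖w‖)` is the minimum of the Poisson
  -- kernel. For `(1 + ‖w‖) / 2 < r < 1` one has `κ ≥ (1 - ‖w‖) / 4`.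
  refine ⟨-log ‖q w‖ / ((1 - ‖w‖) / 4), ?_⟩
  filter_upwards [Ioo_mem_nhdsLT (show (1 + ‖w‖) / 2 < 1 by linarith)] with r ⟨hr1, hr2⟩
  have hwr : ‖w‖ < r := by linarith
  have hr0 : 0 < r := (norm_nonneg w).trans_lt hwr
  have hwr' : w ∈ ball (0 : ℂ) r := by simpa using hwr
  have hcb : closedBall (0 : ℂ) r ⊆ ball 0 1 := closedBall_subset_ball hr2
  have hs : sphere (0 : ℂ) |r| ⊆ ball 0 1 := by
    rw [abs_of_pos hr0]; exact sphere_subset_closedBall.trans hcb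
  have hqa : AnalyticOnNhd ℂ q (ball 0 1) := hq.analyticOnNhd isOpen_ball
  have hka : AnalyticOnNhd ℂ k (ball 0 1) := hk.analyticOnNhd isOpen_ball
  have hne : {z | q z ≠ 0} ∈ codiscreteWithin (sphere (0 : ℂ) |r|) := by
    apply codiscreteWithin_mono hs
    exact hqa.preimage_zero_mem_codiscreteWithin hqw hw
      ⟨⟨w, hw⟩, (convex_ball (0 : ℂ) 1).isPreconnected⟩
  have hkI : CircleIntegrable (fun z ↦ log⁺ ‖k z‖) 0 r :=
    (hka.mono hs).meromorphicOn.circleIntegrable_posLog_norm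
  have hqI : CircleIntegrable (fun z ↦ log ‖q z‖) 0 r :=
    (hqa.mono hs).meromorphicOn.circleIntegrable_log_norm
  have hqS : ∀ a : ℝ, CircleIntegrable (fun z ↦ a • log ‖q z‖) 0 r := fun a ↦
    IntervalIntegrable.const_mul hqI a
  have hle : circleAverage (fun z ↦ log⁺ ‖k z‖) 0 r ≤ circleAverage (fun z ↦ (-1 : ℝ) • log ‖q z‖) 0 r := by
    classical
    -- At zeros of `q` the convention `log 0 = 0` would spoil the pointwise bound, so the integrand
    -- is changed to `0` on this discrete set, which does not affect the average.
    have hcongr : (fun z ↦ log⁺ ‖k z‖) =ᶠ[codiscreteWithin (sphere (0 : ℂ) |r|)]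
        fun z ↦ if q z = 0 then 0 else log⁺ ‖k z‖ := by
      filter_upwards [hne] with z hz
      rw [if_neg hz]
    rw [circleAverage_congr_codiscreteWithin hcongr hr0.ne']
    apply circleAverage_mono (hkI.congr_codiscreteWithin hcongr) (hqS _)
    intro z hz
    split_ifs with h
    · simp [h]
    · have hz' := hs hz
      have h1 : 0 < ‖q z‖ := norm_pos_iff.2 h
      have h2 : log ‖q z‖ ≤ 0 := log_nonpos (norm_nonneg _) (hq1 z hz')
      apply max_le (by simpa using h2)
      by_cases h3 : k z = 0
      · simpa [h3] using h2
      have h4 : log ‖k z‖ + log ‖q z‖ ≤ 0 := by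
        rw [← log_mul (norm_ne_zero_iff.2 h3) h1.ne', ← norm_mul, hkq z hz']
        exact log_nonpos (norm_nonneg _) (hp1 z hz')
      simp only [smul_eq_mul]
      linarith
  have hJ := log_norm_le_circleAverage hwr' (hqa.mono hcb) hqw
  set κ := (r - ‖w‖) / (r + ‖w‖) with hκ
  have hJ2 : circleAverage (poissonKernel 0 w * fun z ↦ log ‖q z‖) 0 r ≤
      circleAverage (fun z ↦ κ • log ‖q z‖) 0 r := by
    apply circleAverage_mono (circleIntegrable_poissonKernel_mul hwr' hqI) (hqS _)
    intro z hz
    have h2 : log ‖q z‖ ≤ 0 := log_nonpos (norm_nonneg _) (hq1 z (hs hz))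
    rw [abs_of_pos hr0] at hz
    exact mul_le_mul_of_nonpos_right (sub_div_add_le_poissonKernel hwr' hz) h2
  rw [circleAverage_fun_smul] at hJ2 hle
  have hκ0 : (1 - ‖w‖) / 4 ≤ κ := by
    rw [hκ, div_le_div_iff₀ (by norm_num) (by positivity)]
    nlinarith [norm_nonneg w]
  have hA0 : 0 ≤ circleAverage (fun z ↦ log⁺ ‖k z‖) 0 r :=
    circleAverage_nonneg_of_nonneg fun z _ ↦ posLog_nonneg
  rw [le_div_iff₀ (by linarith)]
  simp only [smul_eq_mul] at hJ2 hle
  nlinarith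

theorem norm_circleMap_zero_of_pos {r : ℝ} (hr : 0 ≤ r) (θ : ℝ) : ‖circleMap 0 r θ‖ = r := by
  rw [norm_circleMap_zero, abs_of_nonneg hr]

theorem circleMap_one_ne_one {θ : ℝ} (hθ : θ ∈ Ioo 0 (2 * π)) : circleMap 0 1 θ ≠ 1 := by
  intro h
  rw [circleMap_zero, Complex.ofReal_one, one_mul, Complex.exp_eq_one_iff] at h
  obtain ⟨n, hn⟩ := h
  have h1 : θ = n * (2 * π) := by
    have := congrArg Complex.im hn
    simpa using this
  have hpi := pi_pos
  rw [h1] at hθ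
  have a1 : (0 : ℝ) < n := by
    by_contra h; push Not at h; nlinarith [hθ.1]
  have a2 : (n : ℝ) < 1 := by
    by_contra h; push Not at h; nlinarith [hθ.2]
  have : 0 < n := by exact_mod_cast a1
  have : n < 1 := by exact_mod_cast a2
  omega

theorem tendsto_circleMap_radius (θ : ℝ) :
    Tendsto (fun r : ℝ ↦ circleMap 0 r θ) (𝓝[<] 1) (𝓝 (circleMap 0 1 θ)) := by
  have : Continuous fun r : ℝ ↦ circleMap 0 r θ := by unfold circleMap; fun_prop
  exact this.continuousAt.tendsto.mono_left nhdsWithin_le_nhds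

/-- Bounded convergence of averages over circles whose radii tend to `1`. -/
theorem tendsto_circleAverage {E : Type*} [NormedAddCommGroup E] [NormedSpace ℝ E] {F : ℂ → E} {B : ℝ}
    {ρ : ℝ} (hF : ContinuousOn F (ball 0 1 \ closedBall 0 ρ)) (hρ0 : 0 ≤ ρ) (hρ : ρ < 1)
    (hB : ∀ z ∈ ball (0 : ℂ) 1, ρ < ‖z‖ → ‖F z‖ ≤ B)
    (hlim : ∀ z ∈ sphere (0 : ℂ) 1, z ≠ 1 → ContinuousWithinAt F (ball 0 1) z) :
    Tendsto (circleAverage F 0) (𝓝[<] 1) (𝓝 (circleAverage F 0 1)) := by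
  apply Tendsto.const_smul
  apply intervalIntegral.tendsto_integral_filter_of_dominated_convergence (fun _ ↦ B)
  · filter_upwards [Ioo_mem_nhdsLT hρ] with r ⟨hr1, hr2⟩
    have hr0 : 0 ≤ r := hρ0.trans hr1.le
    apply Continuous.aestronglyMeasurable
    apply hF.comp_continuous (continuous_circleMap 0 r)
    intro θ
    rw [Set.mem_sdiff, mem_ball_zero_iff, mem_closedBall_zero_iff, norm_circleMap_zero_of_pos hr0]
    exact ⟨hr2, not_le.2 hr1⟩
  · filter_upwards [Ioo_mem_nhdsLT hρ] with r ⟨hr1, hr2⟩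
    have hr0 : 0 ≤ r := hρ0.trans hr1.le
    filter_upwards with θ _
    apply hB
    · rwa [mem_ball_zero_iff, norm_circleMap_zero_of_pos hr0]
    · rwa [norm_circleMap_zero_of_pos hr0]
  · simp
  · have h2 : ∀ᵐ θ : ℝ, θ ≠ 2 * π := by simp [ae_iff]
    filter_upwards [h2] with θ hθ2 hθ
    rw [uIoc_of_le two_pi_pos.le] at hθ
    have hθ' : θ ∈ Ioo 0 (2 * π) := ⟨hθ.1, lt_of_le_of_ne hθ.2 hθ2⟩
    have := hlim (circleMap 0 1 θ) (circleMap_mem_sphere 0 zero_le_one θ) (circleMap_one_ne_one hθ')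
    apply this.tendsto.comp
    apply tendsto_nhdsWithin_of_tendsto_nhds_of_eventually_within _ (tendsto_circleMap_radius θ)
    filter_upwards [Ioo_mem_nhdsLT hρ] with r ⟨hr1, hr2⟩
    rwa [mem_ball_zero_iff, norm_circleMap_zero_of_pos (hρ0.trans hr1.le)]

theorem continuousAt_poissonKernel {w z : ℂ} (h : z ≠ w) : ContinuousAt (poissonKernel 0 w) z := by
  have : poissonKernel 0 w = fun z ↦ (‖z - 0‖ ^ 2 - ‖w - 0‖ ^ 2) / ‖z - 0 - (w - 0)‖ ^ 2 := by
    ext z; rw [poissonKernel_def]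
  rw [this]
  have : ‖z - 0 - (w - 0)‖ ^ 2 ≠ 0 := by simpa [sub_eq_zero] using h
  fun_prop (disch := assumption)

/-- A nonnegative function which satisfies the Poisson inequality inside the disc, is continuous on
the closed disc except at `1`, and has bounded circle averages is dominated by the Poisson integral
of its boundary values and a multiple of the Poisson kernel at `1`. -/
theorem le_circleAverage_add_of_bounded_averages {u : ℂ → ℝ} {M : ℝ} {w : ℂ}
    (hu : ContinuousOn u (closedBall 0 1 \ {1})) (hu0 : ∀ z, 0 ≤ u z)
    (hI : CircleIntegrable u 0 1) (hw : w ∈ ball (0 : ℂ) 1)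
    (hP : ∀ r, ‖w‖ < r → r < 1 → u w ≤ circleAverage (poissonKernel 0 w * u) 0 r)
    (hM : ∀ᶠ r in 𝓝[<] (1 : ℝ), circleAverage u 0 r ≤ M) :
    u w ≤ circleAverage (poissonKernel 0 w * u) 0 1 + M * poissonKernel 0 w 1 := by
  have hw1 : ‖w‖ < 1 := by simpa using hw
  have h1s : (1 : ℂ) ∈ sphere (0 : ℂ) 1 := by simp
  have hM0 : 0 ≤ M := by
    obtain ⟨r, hr⟩ := hM.exists
    exact (circleAverage_nonneg_of_nonneg fun z _ ↦ hu0 z).trans hr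
  suffices H : ∀ η > 0, u w ≤ circleAverage (poissonKernel 0 w * u) 0 1
      + M * (poissonKernel 0 w 1 + η) by
    have : Tendsto (fun η : ℝ ↦ circleAverage (poissonKernel 0 w * u) 0 1
        + M * (poissonKernel 0 w 1 + η)) (𝓝[>] 0)
        (𝓝 (circleAverage (poissonKernel 0 w * u) 0 1 + M * (poissonKernel 0 w 1 + 0))) := by
      apply Tendsto.mono_left _ nhdsWithin_le_nhds
      apply Continuous.tendsto
      fun_prop
    rw [add_zero] at this
    exact ge_of_tendsto this (eventually_mem_nhdsWithin.mono H)
  intro η hη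
  -- Use `P_w ≤ c + (P_w - c)⁺`. The constant part costs at most `c * M`. The positive part vanishes
  -- near `1`, the only point where `u` may be unbounded, so bounded convergence handles `F`.
  set c := poissonKernel 0 w 1 + η with hc
  set F : ℂ → ℝ := fun z ↦ max (poissonKernel 0 w z - c) 0 * u z with hF
  obtain ⟨ρ, hρw, hρ1⟩ := exists_between hw1
  have hρ0 : 0 ≤ ρ := (norm_nonneg w).trans hρw.le
  -- `F` is bounded near the unit circle
  have hPc : ∀ z : ℂ, ρ ≤ ‖z‖ → ContinuousAt (poissonKernel 0 w) z := by
    intro z hz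
    apply continuousAt_poissonKernel
    rintro rfl
    linarith
  obtain ⟨B, hB⟩ : ∃ B, ∀ z ∈ closedBall (0 : ℂ) 1, ρ ≤ ‖z‖ → ‖F z‖ ≤ B := by
    set S := {z : ℂ | z ∈ closedBall (0 : ℂ) 1 \ ball 0 ρ ∧ c ≤ poissonKernel 0 w z} with hS
    have hcomp : IsCompact (closedBall (0 : ℂ) 1 \ ball 0 ρ) :=
      (isCompact_closedBall (0 : ℂ) 1).diff isOpen_ball
    have hcon : ContinuousOn (poissonKernel 0 w) (closedBall (0 : ℂ) 1 \ ball 0 ρ) := by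
      intro z hz
      exact (hPc z (by simpa using hz.2)).continuousWithinAt
    have hSc : IsCompact S := by
      apply hcomp.of_isClosed_subset _ (fun z hz ↦ hz.1)
      exact hcon.preimage_isClosed_of_isClosed hcomp.isClosed isClosed_Ici
    have hSF : ContinuousOn F S := by
      apply ContinuousOn.mul
      · exact ContinuousOn.sup ((hcon.mono (fun z (hz : z ∈ S) ↦ hz.1)).sub continuousOn_const) continuousOn_const
      · apply hu.mono
        intro z hz
        refine ⟨hz.1.1, ?_⟩
        rintro rfl
        have := hz.2
        linarith
    obtain ⟨B, hB⟩ := hSc.exists_bound_of_continuousOn hSF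
    refine ⟨max B 0, fun z hz hzρ ↦ ?_⟩
    by_cases h : c ≤ poissonKernel 0 w z
    · exact (hB z ⟨⟨hz, by simpa using hzρ⟩, h⟩).trans (le_max_left _ _)
    · simp only [hF]
      rw [max_eq_right (by linarith)]
      simp
  have hFc : ∀ z ∈ closedBall (0 : ℂ) 1, z ≠ 1 → ρ ≤ ‖z‖ →
      ContinuousWithinAt F (closedBall 0 1 \ {1}) z := by
    intro z hz hz1 hzρ
    apply ContinuousWithinAt.mul _ (hu z ⟨hz, hz1⟩)
    exact (((hPc z hzρ).sub continuousAt_const).sup continuousAt_const).continuousWithinAt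
  have hbsub : ball (0 : ℂ) 1 ⊆ closedBall 0 1 \ {1} := by
    intro z hz
    refine ⟨ball_subset_closedBall hz, ?_⟩
    rintro rfl
    simp at hz
  have hFlim : Tendsto (circleAverage F 0) (𝓝[<] 1) (𝓝 (circleAverage F 0 1)) := by
    refine tendsto_circleAverage (ρ := ρ) (B := B) ?_ hρ0 hρ1 ?_ ?_
    · intro z hz
      apply (hFc z (ball_subset_closedBall hz.1) (hbsub hz.1).2 _).mono
        (fun x hx ↦ hbsub hx.1)
      have := hz.2
      rw [mem_closedBall_zero_iff] at this
      linarith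
    · intro z hz hzρ
      exact hB z (ball_subset_closedBall hz) hzρ.le
    · intro z hz hz1
      apply (hFc z (sphere_subset_closedBall hz) hz1 _).mono hbsub
      rw [mem_sphere_zero_iff_norm.1 hz]
      exact hρ1.le
  have h1 : ∀ᶠ r in 𝓝[<] (1 : ℝ), u w ≤ c * M + circleAverage F 0 r := by
    filter_upwards [hM, Ioo_mem_nhdsLT hρ1] with r hrM ⟨hr1, hr2⟩
    have hr0 : 0 ≤ r := hρ0.trans hr1.le
    have hwr : w ∈ ball (0 : ℂ) r := by
      rw [mem_ball_zero_iff]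
      linarith
    have hsr : sphere (0 : ℂ) |r| ⊆ ball 0 1 := by
      rw [abs_of_nonneg hr0]
      exact sphere_subset_closedBall.trans (closedBall_subset_ball hr2)
    have huI : CircleIntegrable u 0 r :=
      ContinuousOn.circleIntegrable' (hu.mono (hsr.trans hbsub))
    have hFI : CircleIntegrable F 0 r := by
      apply ContinuousOn.circleIntegrable'
      intro z hz
      apply (hFc z (ball_subset_closedBall (hsr hz)) (hbsub (hsr hz)).2 _).mono (hsr.trans hbsub)
      rw [mem_sphere_zero_iff_norm, abs_of_nonneg hr0] at hz
      rw [hz]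
      exact hr1.le
    have huS : CircleIntegrable (fun z ↦ c • u z) 0 r := IntervalIntegrable.const_mul huI c
    calc u w ≤ circleAverage (poissonKernel 0 w * u) 0 r := hP r (by linarith) hr2
      _ ≤ circleAverage (fun z ↦ c • u z + F z) 0 r := by
        apply circleAverage_mono (circleIntegrable_poissonKernel_mul hwr huI) (huS.add hFI)
        intro z _
        have hle : poissonKernel 0 w z ≤ c + max (poissonKernel 0 w z - c) 0 := by
          linarith [le_max_left (poissonKernel 0 w z - c) 0]
        simpa [hF, add_mul] using mul_le_mul_of_nonneg_right hle (hu0 z)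
      _ = c * circleAverage u 0 r + circleAverage F 0 r := by
        rw [circleAverage_fun_add huS hFI, circleAverage_fun_smul, smul_eq_mul]
      _ ≤ c * M + circleAverage F 0 r := by
        have : 0 ≤ c := by
          have := poissonKernel_nonneg hw h1s
          linarith
        gcongr
  have h2 : circleAverage F 0 1 ≤ circleAverage (poissonKernel 0 w * u) 0 1 := by
    have hPI := circleIntegrable_poissonKernel_mul hw hI
    apply circleAverage_mono _ hPI
    · intro z hz
      rw [abs_one] at hz
      apply mul_le_mul_of_nonneg_right _ (hu0 z)
      have := poissonKernel_nonneg hw hz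
      have := poissonKernel_nonneg hw h1s
      exact max_le (by linarith) (by linarith)
    · apply IntervalIntegrable.continuousOn_mul hI
      apply Continuous.continuousOn
      apply Continuous.max _ continuous_const
      apply Continuous.sub _ continuous_const
      exact (continuousOn_poissonKernel_sphere hw).comp_continuous (continuous_circleMap 0 1)
        (circleMap_mem_sphere' 0 1)
  have h3 := le_of_tendsto_of_tendsto tendsto_const_nhds (tendsto_const_nhds.add hFlim) h1
  linarith

end HardyDisc

/-! ### Phragmén–Lindelöf, the Cayley transform and the Poisson majorant of a function of bounded
type. -/

namespace HardyDisc

open Filter Topology MeasureTheory Metric Set Real InnerProductSpace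

/-- **Phragmén–Lindelöf** for a function of exponential type in the upper half-plane, bounded
by `1` near the real axis and of nonpositive mean type. -/
theorem norm_le_one_of_exp_bound {β : ℂ → ℂ} {M : ℝ} (hM : 0 ≤ M)
    (hβ : DifferentiableOn ℂ β {z | 0 < z.im})
    (hb : ∀ z : ℂ, 0 < z.im → ‖β z‖ ≤ rexp (M * z.im))
    (hg : ∀ ε > 0, ∀ᶠ y : ℝ in atTop, ‖β (y * Complex.I)‖ ≤ rexp (ε * y))
    {z : ℂ} (hz : 0 < z.im) : ‖β z‖ ≤ 1 := by
  -- The half-plane is rotated to the right one and shifted by `δ`, which gives analyticity up to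
  -- the boundary and the bound `exp (M δ)` there. The factor `exp (-ε ζ)` makes the function
  -- bounded on the positive ray. Afterwards `ε → 0`, then `δ → 0`.
  have key : ∀ δ : ℝ, 0 < δ → ∀ ε : ℝ, 0 < ε → ∀ ζ : ℂ, 0 ≤ ζ.re →
      ‖β (Complex.I * (ζ + δ)) * Complex.exp (-ε * ζ)‖ ≤ rexp (M * δ) := by
    intro δ hδ ε hε ζ hζ
    have him : ∀ ζ : ℂ, (Complex.I * (ζ + δ)).im = ζ.re + δ := by intro ζ; simp
    have hre : ∀ ζ : ℂ, ‖Complex.exp (-ε * ζ)‖ = rexp (-ε * ζ.re) := by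
      intro ζ; rw [Complex.norm_exp]; simp
    apply PhragmenLindelof.right_half_plane_of_bounded_on_real
      (f := fun ζ ↦ β (Complex.I * (ζ + δ)) * Complex.exp (-ε * ζ))
    · apply DifferentiableOn.diffContOnCl
      have hcl : closure {z : ℂ | 0 < z.re} = {z | 0 ≤ z.re} := Complex.closure_setOfPred_lt_re 0
      rw [hcl]
      apply DifferentiableOn.mul
      · apply hβ.comp (by fun_prop)
        intro ζ hζ
        have : 0 ≤ ζ.re := hζ
        simp only [mem_ofPred_eq, him]
        linarith
      · fun_prop
    · refine ⟨1, by norm_num, M, ?_⟩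
      apply Asymptotics.IsBigO.of_bound (rexp (M * δ))
      filter_upwards [mem_inf_of_right (mem_principal_self _)] with ζ hζ
      have hζ' : 0 < ζ.re := hζ
      rw [norm_mul, hre, rpow_one, norm_of_nonneg (exp_pos _).le]
      have h1 := hb (Complex.I * (ζ + δ)) (by rw [him]; linarith)
      rw [him] at h1
      calc _ ≤ rexp (M * (ζ.re + δ)) * 1 := by
            gcongr
            rw [exp_le_one_iff]
            nlinarith
        _ = rexp (M * δ) * rexp (M * ζ.re) := by rw [mul_one, ← exp_add]; ring_nf
        _ ≤ _ := by
            gcongr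
            exact (le_abs_self _).trans (Complex.abs_re_le_norm ζ)
    · refine ⟨rexp (ε * δ), ?_⟩
      rw [eventually_map]
      have ht : Tendsto (fun x : ℝ ↦ x + δ) atTop atTop := tendsto_atTop_add_const_right _ _ tendsto_id
      filter_upwards [ht.eventually (hg ε hε)] with x hx
      rw [norm_mul, hre]
      have : (Complex.I * (x + δ) : ℂ) = ((x + δ : ℝ) : ℂ) * Complex.I := by push_cast; ring
      rw [this]
      calc _ ≤ rexp (ε * (x + δ)) * rexp (-ε * x) := by
            rw [Complex.ofReal_re]
            exact mul_le_mul_of_nonneg_right hx (exp_pos _).le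
        _ = rexp (ε * δ) := by rw [← exp_add]; ring_nf
    · intro x
      rw [norm_mul, hre]
      have h1 := hb (Complex.I * (x * Complex.I + δ)) (by rw [him]; simpa using hδ)
      rw [him] at h1
      simpa using h1
    · exact hζ
  have key2 : ∀ δ : ℝ, 0 < δ → ∀ ζ : ℂ, 0 ≤ ζ.re → ‖β (Complex.I * (ζ + δ))‖ ≤ rexp (M * δ) := by
    intro δ hδ ζ hζ
    have ht : Tendsto (fun ε : ℝ ↦ ‖β (Complex.I * (ζ + δ)) * Complex.exp (-ε * ζ)‖) (𝓝[>] 0)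
        (𝓝 ‖β (Complex.I * (ζ + δ)) * Complex.exp (-(0 : ℝ) * ζ)‖) := by
      apply Tendsto.mono_left _ nhdsWithin_le_nhds
      apply Continuous.tendsto
      fun_prop
    have := le_of_tendsto ht (eventually_mem_nhdsWithin.mono fun ε hε ↦ key δ hδ ε hε ζ hζ)
    simpa using this
  have ht : Tendsto (fun δ : ℝ ↦ rexp (M * δ)) (𝓝[>] 0) (𝓝 (rexp (M * 0))) := by
    apply Tendsto.mono_left _ nhdsWithin_le_nhds
    apply Continuous.tendsto
    fun_prop
  rw [mul_zero, exp_zero] at ht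
  apply ge_of_tendsto ht
  filter_upwards [Ioo_mem_nhdsGT hz] with δ ⟨hδ0, hδ⟩
  have := key2 δ hδ0 (-Complex.I * z - δ) (by simp; linarith)
  have e : Complex.I * (-Complex.I * z - δ + δ) = z := by
    linear_combination (-z) * Complex.I_mul_I
  rwa [e] at this

/-- The Cayley transform of the upper half-plane onto the unit disc. -/
noncomputable def cayley (z : ℂ) : ℂ := (z - Complex.I) / (z + Complex.I)

theorem add_I_ne_zero {z : ℂ} (hz : 0 ≤ z.im) : z + Complex.I ≠ 0 := by
  intro h
  have := congrArg Complex.im h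
  simp at this
  linarith

theorem normSq_cayley {z : ℂ} (hz : 0 ≤ z.im) :
    1 - ‖cayley z‖ ^ 2 = 4 * z.im / ‖z + Complex.I‖ ^ 2 := by
  have h : Complex.normSq (z + Complex.I) ≠ 0 := by simpa using add_I_ne_zero hz
  rw [cayley, norm_div, div_pow, ← Complex.normSq_eq_norm_sq, ← Complex.normSq_eq_norm_sq]
  field_simp
  simp [Complex.normSq_apply]
  ring

theorem one_sub_cayley {z : ℂ} (hz : 0 ≤ z.im) :
    1 - cayley z = 2 * Complex.I / (z + Complex.I) := by
  have := add_I_ne_zero hz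
  rw [cayley]
  field_simp
  ring

theorem cayley_mem_ball {z : ℂ} (hz : 0 < z.im) : cayley z ∈ ball (0 : ℂ) 1 := by
  have h := normSq_cayley hz.le
  have h2 : 0 < ‖z + Complex.I‖ := norm_pos_iff.2 (add_I_ne_zero hz.le)
  have : 0 < 4 * z.im / ‖z + Complex.I‖ ^ 2 := by positivity
  rw [mem_ball_zero_iff]
  nlinarith [norm_nonneg (cayley z)]

/-- A point mass at `1` on the circle corresponds to a multiple of `Im z` in the half-plane. Hence
the term `M * poissonKernel 0 w 1` of the disc estimate becomes exponential growth, which the mean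
type excludes. -/
theorem poissonKernel_cayley_one {z : ℂ} (hz : 0 < z.im) : poissonKernel 0 (cayley z) 1 = z.im := by
  have h2 : ‖z + Complex.I‖ ≠ 0 := norm_ne_zero_iff.2 (add_I_ne_zero hz.le)
  rw [poissonKernel_def]
  simp only [sub_zero, norm_one, one_pow]
  rw [normSq_cayley hz.le, one_sub_cayley hz.le, norm_div]
  simp
  field_simp
  ring

/-- The inverse Cayley transform. -/
noncomputable def cayleyInv (w : ℂ) : ℂ := Complex.I * (1 + w) / (1 - w)

theorem one_sub_ne_zero {w : ℂ} (hw : w ∈ ball (0 : ℂ) 1) : 1 - w ≠ 0 := by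
  intro h
  rw [sub_eq_zero] at h
  simp [← h] at hw

theorem im_cayleyInv (w : ℂ) : (cayleyInv w).im = (1 - ‖w‖ ^ 2) / ‖1 - w‖ ^ 2 := by
  rw [cayleyInv, mul_div_assoc, Complex.I_mul_im, Complex.div_re, ← Complex.normSq_eq_norm_sq,
    ← Complex.normSq_eq_norm_sq, ← add_div]
  congr 1
  simp [Complex.normSq_apply]
  ring

theorem im_cayleyInv_pos {w : ℂ} (hw : w ∈ ball (0 : ℂ) 1) : 0 < (cayleyInv w).im := by
  rw [im_cayleyInv]
  have h1 : ‖w‖ < 1 := by simpa using hw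
  have h2 : 0 < ‖1 - w‖ := norm_pos_iff.2 (one_sub_ne_zero hw)
  apply div_pos _ (by positivity)
  nlinarith [norm_nonneg w]

theorem cayley_cayleyInv {w : ℂ} (hw : w ∈ ball (0 : ℂ) 1) : cayley (cayleyInv w) = w := by
  have h1 := one_sub_ne_zero hw
  have h2 := add_I_ne_zero (im_cayleyInv_pos hw).le
  rw [cayley, div_eq_iff h2, cayleyInv]
  field_simp
  ring

theorem circleIntegrable_comp_norm {k : ℂ → ℂ} (hk : CircleIntegrable k 0 1) {φ : ℝ → ℝ}
    (hφ : Continuous φ) (hb : ∀ x, 0 ≤ x → |φ x| ≤ 1 + x) :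
    CircleIntegrable (fun z ↦ φ ‖k z‖) 0 1 := by
  have h1 : IntervalIntegrable (fun θ ↦ 1 + ‖k (circleMap 0 1 θ)‖) volume 0 (2 * π) :=
    IntervalIntegrable.add (by simp) (IntervalIntegrable.norm hk)
  refine IntervalIntegrable.mono_fun h1 ?_ ?_
  · exact hφ.comp_aestronglyMeasurable (intervalIntegrable_iff.1 hk).aestronglyMeasurable.norm
  · filter_upwards with θ
    refine (hb _ (norm_nonneg _)).trans (le_abs_self _)

theorem circleIntegrable_posLog {k : ℂ → ℂ} (hk : CircleIntegrable k 0 1) :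
    CircleIntegrable (fun z ↦ log⁺ ‖k z‖) 0 1 := by
  apply circleIntegrable_comp_norm hk continuous_posLog
  intro x hx
  rw [abs_of_nonneg posLog_nonneg]
  exact max_le (by linarith) ((log_le_self hx).trans (by linarith))

/-- A function in the disc of bounded type and of nonpositive mean type, with integrable boundary
values, is dominated by the Poisson integral of `max 1 ‖k‖`. -/
theorem norm_le_circleAverage {k : ℂ → ℂ} {M : ℝ}
    (hk : ContinuousOn k (closedBall 0 1 \ {1})) (hkd : DifferentiableOn ℂ k (ball 0 1))
    (hI : CircleIntegrable k 0 1)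
    (hM : ∀ᶠ r in 𝓝[<] (1 : ℝ), circleAverage (fun z ↦ log⁺ ‖k z‖) 0 r ≤ M)
    (hg : ∀ ε > 0, ∀ᶠ y : ℝ in atTop, ‖k (cayley (y * Complex.I))‖ ≤ rexp (ε * y))
    {w : ℂ} (hw : w ∈ ball (0 : ℂ) 1) :
    ‖k w‖ ≤ circleAverage (poissonKernel 0 w * fun z ↦ max 1 ‖k z‖) 0 1 := by
  set u : ℂ → ℝ := fun z ↦ log⁺ ‖k z‖ with hu
  have hu0 : ∀ z, 0 ≤ u z := fun z ↦ posLog_nonneg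
  have huI : CircleIntegrable u 0 1 := circleIntegrable_posLog hI
  have hM0 : 0 ≤ M := by
    obtain ⟨r, hr⟩ := hM.exists
    exact (circleAverage_nonneg_of_nonneg fun z _ ↦ hu0 z).trans hr
  have hka := hkd.analyticOnNhd isOpen_ball
  have hle : ∀ w ∈ ball (0 : ℂ) 1,
      u w ≤ circleAverage (poissonKernel 0 w * u) 0 1 + M * poissonKernel 0 w 1 := by
    intro w hw
    apply le_circleAverage_add_of_bounded_averages _ hu0 huI hw _ hM
    · exact continuous_posLog.comp_continuousOn hk.norm
    · intro r hr1 hr2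
      exact posLog_norm_le_circleAverage (by simpa using hr1)
        (hka.mono (closedBall_subset_ball hr2))
  -- the outer function with boundary modulus `max 1 ‖k‖`
  set L : ℂ → ℂ := fun w ↦
    circleAverage (fun ζ ↦ herglotzRieszKernel 0 w ζ • ((u ζ : ℝ) : ℂ)) 0 1 with hL
  have hLd : DifferentiableOn ℂ L (ball 0 1) := by
    apply differentiableOn_circleAverage_herglotzRieszKernel_smul
    exact ⟨huI.1.ofReal, huI.2.ofReal⟩
  have hLre : ∀ w ∈ ball (0 : ℂ) 1, (L w).re = circleAverage (poissonKernel 0 w * u) 0 1 := by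
    intro w hw
    rw [poissonKernel_eq_re_herglotzRieszKernel]
    exact re_circleAverage_herglotzRieszKernel_smul huI hw
  have hcd : DifferentiableOn ℂ cayley {z | 0 < z.im} := by
    intro z hz
    have : z + Complex.I ≠ 0 := add_I_ne_zero (le_of_lt hz)
    unfold cayley
    fun_prop (disch := assumption)
  have hcm : MapsTo cayley {z | 0 < z.im} (ball 0 1) := fun z hz ↦ cayley_mem_ball hz
  have hcircle0 : ∀ w ∈ ball (0 : ℂ) 1, 0 ≤ circleAverage (poissonKernel 0 w * u) 0 1 := by
    intro w hw
    apply circleAverage_nonneg_of_nonneg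
    intro z hz
    rw [abs_one] at hz
    exact mul_nonneg (poissonKernel_nonneg hw hz) (hu0 z)
  have hknorm : ∀ w, ‖k w‖ ≤ rexp (u w) := by
    intro w
    by_cases h : k w = 0
    · simp [h, (exp_pos _).le]
    · rw [← log_le_iff_le_exp (norm_pos_iff.2 h)]
      exact le_max_right _ _
  -- Dividing `k` by the outer function `exp L` leaves modulus at most `exp (M * Im z)`, so
  -- Phragmén–Lindelöf yields `‖k w‖ ≤ exp m` with `m` the Poisson integral of `u` at `w`.
  have hb := norm_le_one_of_exp_bound (β := fun z ↦ k (cayley z) * Complex.exp (-L (cayley z)))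
    hM0 ?_ ?_ ?_ (im_cayleyInv_pos hw)
  · rw [cayley_cayleyInv hw, norm_mul, Complex.norm_exp, Complex.neg_re, hLre w hw, exp_neg,
      ← div_eq_mul_inv, div_le_one (exp_pos _)] at hb
    refine hb.trans ?_
    -- Jensen's inequality for the exponential
    set m := circleAverage (poissonKernel 0 w * u) 0 1 with hm
    have hone : circleAverage (poissonKernel 0 w * fun _ ↦ (1 : ℝ)) 0 1 = 1 := by
      rw [poissonKernel_eq_re_herglotzRieszKernel]
      exact HarmonicOnNhd.circleAverage_re_herglotzRieszKernel_smul (f := fun _ ↦ (1 : ℝ))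
        (fun x _ ↦ harmonicAt_const 1) hw
    have hP1 : CircleIntegrable (poissonKernel 0 w * fun _ ↦ (1 : ℝ)) 0 1 :=
      circleIntegrable_poissonKernel_mul hw (circleIntegrable_const 1 0 1)
    have hPu := circleIntegrable_poissonKernel_mul hw huI
    have hmax : CircleIntegrable (fun z ↦ max 1 ‖k z‖) 0 1 :=
      circleIntegrable_comp_norm hI (φ := fun x ↦ max 1 x) (by fun_prop) fun x hx ↦ by
        rw [abs_of_nonneg (by positivity)]
        exact max_le (by linarith) (by linarith)
    have hS1 : CircleIntegrable
        (fun z ↦ (rexp m * (1 - m)) • (poissonKernel 0 w * fun _ ↦ (1 : ℝ) : ℂ → ℝ) z) 0 1 := IntervalIntegrable.const_mul hP1 _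
    have hS2 : CircleIntegrable (fun z ↦ rexp m • (poissonKernel 0 w * u) z) 0 1 :=
      IntervalIntegrable.const_mul hPu _
    -- The tangent line of `exp` at `m`, evaluated at `u` and averaged against the Poisson kernel of
    -- total mass one, gives back `exp m`.
    calc rexp m = circleAverage (fun z ↦
          (rexp m * (1 - m)) • (poissonKernel 0 w * fun _ ↦ (1 : ℝ) : ℂ → ℝ) z
            + rexp m • (poissonKernel 0 w * u) z) 0 1 := by
          rw [circleAverage_fun_add hS1 hS2, circleAverage_fun_smul, circleAverage_fun_smul, hone,
            ← hm]
          simp only [smul_eq_mul]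
          ring
      _ ≤ _ := by
          apply circleAverage_mono (hS1.add hS2) (circleIntegrable_poissonKernel_mul hw hmax)
          intro z hz
          rw [abs_one] at hz
          have hPz := poissonKernel_nonneg hw hz
          have h1 : rexp m * (1 - m) + rexp m * u z ≤ max 1 ‖k z‖ := by
            have h2 : rexp (u z) ≤ max 1 ‖k z‖ := by
              rcases le_total (log ‖k z‖) 0 with h | h
              · rw [show u z = 0 from max_eq_left h, exp_zero]
                exact le_max_left _ _
              · rw [show u z = log ‖k z‖ from max_eq_right h]
                by_cases h0 : k z = 0
                · simp [h0]
                · rw [exp_log (norm_pos_iff.2 h0)]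
                  exact le_max_right _ _
            have h3 : rexp m * (u z - m + 1) ≤ rexp m * rexp (u z - m) := by
              gcongr
              exact add_one_le_exp _
            rw [← exp_add, show m + (u z - m) = u z by ring] at h3
            linarith
          have := mul_le_mul_of_nonneg_left h1 hPz
          simp only [Pi.mul_apply, Pi.add_apply, smul_eq_mul]
          linarith
  · exact (hkd.comp hcd hcm).mul (hLd.comp hcd hcm).neg.cexp
  · intro z hz
    have hc := cayley_mem_ball hz
    rw [norm_mul, Complex.norm_exp, Complex.neg_re, hLre _ hc, exp_neg, ← div_eq_mul_inv,
      div_le_iff₀ (exp_pos _), ← exp_add]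
    apply (hknorm _).trans
    gcongr
    have := hle _ hc
    rw [poissonKernel_cayley_one hz] at this
    linarith
  · intro ε hε
    filter_upwards [hg ε hε, eventually_gt_atTop 0] with y hy hy0
    have hc := cayley_mem_ball (z := y * Complex.I) (by simpa using hy0)
    rw [norm_mul, Complex.norm_exp, Complex.neg_re, hLre _ hc]
    apply (mul_le_of_le_one_right (norm_nonneg _) _).trans hy
    rw [exp_le_one_iff]
    linarith [hcircle0 _ hc]

end HardyDisc

/-! ### Cauchy's theorem on the unit circle. -/

namespace HardyDisc

open Filter Topology MeasureTheory Metric Set Real InnerProductSpace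

theorem norm_circleAverage_le (F : ℂ → ℂ) (c : ℂ) (R : ℝ) :
    ‖circleAverage F c R‖ ≤ circleAverage (fun z ↦ ‖F z‖) c R := by
  rw [circleAverage_def, circleAverage_def, norm_smul, smul_eq_mul,
    norm_of_nonneg (by positivity)]
  gcongr
  exact intervalIntegral.norm_integral_le_integral_norm two_pi_pos.le

/-- The mean value property of a Poisson integral. -/
theorem circleAverage_circleAverage_poissonKernel {u : ℂ → ℝ} (hu : CircleIntegrable u 0 1)
    {r : ℝ} (hr0 : 0 ≤ r) (hr1 : r < 1) :
    circleAverage (fun w ↦ circleAverage (poissonKernel 0 w * u) 0 1) 0 r = circleAverage u 0 1 ∧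
    CircleIntegrable (fun w ↦ circleAverage (poissonKernel 0 w * u) 0 1) 0 r := by
  set L : ℂ → ℂ := fun w ↦
    circleAverage (fun ζ ↦ herglotzRieszKernel 0 w ζ • ((u ζ : ℝ) : ℂ)) 0 1 with hL
  have hLd : DifferentiableOn ℂ L (ball 0 1) := by
    apply differentiableOn_circleAverage_herglotzRieszKernel_smul
    exact ⟨hu.1.ofReal, hu.2.ofReal⟩
  have hLre : ∀ w ∈ ball (0 : ℂ) 1, (L w).re = circleAverage (poissonKernel 0 w * u) 0 1 := by
    intro w hw
    rw [poissonKernel_eq_re_herglotzRieszKernel]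
    exact re_circleAverage_herglotzRieszKernel_smul hu hw
  have hcb : closedBall (0 : ℂ) r ⊆ ball 0 1 := closedBall_subset_ball hr1
  have hs : sphere (0 : ℂ) |r| ⊆ ball 0 1 := by
    rw [abs_of_nonneg hr0]; exact sphere_subset_closedBall.trans hcb
  have hLI : CircleIntegrable L 0 r := ContinuousOn.circleIntegrable' (hLd.continuousOn.mono hs)
  have heq : EqOn (Complex.reCLM ∘ L) (fun w ↦ circleAverage (poissonKernel 0 w * u) 0 1)
      (sphere 0 |r|) := fun w hw ↦ hLre w (hs hw)
  constructor
  · rw [← circleAverage_congr_sphere heq, ContinuousLinearMap.circleAverage_comp_comm _ hLI,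
      DiffContOnCl.circleAverage]
    · rw [Complex.reCLM_apply, hLre 0 (by simp)]
      apply circleAverage_congr_sphere
      intro z hz
      rw [abs_one, mem_sphere_zero_iff_norm] at hz
      simp [poissonKernel_def, hz]
    · rw [abs_of_nonneg hr0]
      apply DifferentiableOn.diffContOnCl
      exact hLd.mono (closure_ball_subset_closedBall.trans hcb)
  · have : CircleIntegrable (Complex.reCLM ∘ L) 0 r :=
      ContinuousOn.circleIntegrable' (Complex.reCLM.continuous.comp_continuousOn
        (hLd.continuousOn.mono hs))
    refine IntervalIntegrable.congr (fun θ _ ↦ ?_) this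
    exact heq (circleMap_mem_sphere' 0 r θ)

/-- Radial truncation of a complex number to modulus at most `N`. -/
noncomputable def truncate (N : ℝ) (x : ℂ) : ℂ := (N / max N ‖x‖) • x

theorem continuous_truncate {N : ℝ} (hN : 0 < N) : Continuous (truncate N) := by
  unfold truncate
  have : ∀ x : ℂ, max N ‖x‖ ≠ 0 := fun x ↦ (hN.trans_le (le_max_left _ _)).ne'
  fun_prop (disch := assumption)

theorem norm_truncate_le {N : ℝ} (hN : 0 < N) (x : ℂ) : ‖truncate N x‖ ≤ N := by
  have h := hN.trans_le (le_max_left N ‖x‖)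
  rw [truncate, norm_smul, norm_of_nonneg (by positivity), div_mul_eq_mul_div, div_le_iff₀ h]
  gcongr
  exact le_max_right _ _

theorem norm_sub_truncate {N : ℝ} (hN : 0 < N) (x : ℂ) :
    ‖x - truncate N x‖ = max (‖x‖ - N) 0 := by
  have h := hN.trans_le (le_max_left N ‖x‖)
  have h1 : x - truncate N x = (1 - N / max N ‖x‖) • x := by
    rw [truncate, sub_smul, one_smul]
  have h2 : 0 ≤ 1 - N / max N ‖x‖ := by
    rw [sub_nonneg, div_le_one h]
    exact le_max_left _ _
  rw [h1, norm_smul, norm_of_nonneg h2]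
  rcases le_total N ‖x‖ with h3 | h3
  · rw [max_eq_right h3] at h ⊢
    rw [max_eq_left (by linarith)]
    field_simp
  · rw [max_eq_left h3, max_eq_right (by linarith), div_self hN.ne']
    simp

/-- **Cauchy's theorem** on the unit circle for a function which is dominated by the Poisson
integral of an integrable function. -/
theorem circleAverage_mul_eq_zero_of_le {k : ℂ → ℂ}
    (hk : ContinuousOn k (closedBall 0 1 \ {1})) (hkd : DifferentiableOn ℂ k (ball 0 1))
    (hI : CircleIntegrable k 0 1)
    (hP : ∀ w ∈ ball (0 : ℂ) 1,
      ‖k w‖ ≤ circleAverage (poissonKernel 0 w * fun z ↦ max 1 ‖k z‖) 0 1) :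
    circleAverage (fun z ↦ z * k z) 0 1 = 0 := by
  set a : ℝ → ℝ := fun N ↦ circleAverage (fun z ↦ max (max 1 ‖k z‖ - N) 0) 0 1 with ha
  have hbsub : ball (0 : ℂ) 1 ⊆ closedBall 0 1 \ {1} := by
    intro z hz
    refine ⟨ball_subset_closedBall hz, ?_⟩
    rintro rfl
    simp at hz
  have hvI : CircleIntegrable (fun z ↦ max 1 ‖k z‖) 0 1 :=
    circleIntegrable_comp_norm hI (φ := fun x ↦ max 1 x) (by fun_prop) fun x hx ↦ by
      rw [abs_of_nonneg (by positivity)]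
      exact max_le (by linarith) (by linarith)
  have hvN : ∀ N, 0 < N → CircleIntegrable (fun z ↦ max (max 1 ‖k z‖ - N) 0) 0 1 := fun N hN ↦
    circleIntegrable_comp_norm hI (φ := fun x ↦ max (max 1 x - N) 0) (by fun_prop) fun x hx ↦ by
      rw [abs_of_nonneg (by positivity)]
      refine max_le ?_ (by linarith)
      linarith [max_le (show 1 ≤ 1 + x by linarith) (show x ≤ 1 + x by linarith)]
  have hzk : CircleIntegrable (fun z ↦ z * k z) 0 1 :=
    IntervalIntegrable.continuousOn_mul hI (continuous_circleMap 0 1).continuousOn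
  have htI : ∀ N, 0 < N → CircleIntegrable (fun z ↦ z * truncate N (k z)) 0 1 := by
    intro N hN
    refine IntervalIntegrable.continuousOn_mul ?_ (continuous_circleMap 0 1).continuousOn
    refine IntervalIntegrable.mono_fun hI ?_ ?_
    · exact (continuous_truncate hN).comp_aestronglyMeasurable
        (intervalIntegrable_iff.1 hI).aestronglyMeasurable
    · filter_upwards with θ
      have h := hN.trans_le (le_max_left N ‖k (circleMap 0 1 θ)‖)
      rw [truncate, norm_smul, norm_of_nonneg (by positivity)]
      apply mul_le_of_le_one_left (norm_nonneg _)
      rw [div_le_one h]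
      exact le_max_left _ _
  -- Truncating `k` at height `N` costs `(‖k‖ - N)⁺`. Inside the disc this is at most the Poisson
  -- integral of `(max 1 ‖k‖ - N)⁺`, whose average on every circle is `a N`. On circles of radius
  -- below `1` the average of `z * k z` is zero, and the bounded truncation passes to the limit. One
  -- error `a N` comes from the interior and one from the boundary.
  have hbound : ∀ N, 0 < N → ‖circleAverage (fun z ↦ z * k z) 0 1‖ ≤ 2 * a N := by
    intro N hN
    set F : ℂ → ℂ := fun z ↦ z * truncate N (k z) with hF
    have hFc : ContinuousOn F (closedBall 0 1 \ {1}) :=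
      continuousOn_id.mul ((continuous_truncate hN).comp_continuousOn hk)
    have hlim : Tendsto (circleAverage F 0) (𝓝[<] 1) (𝓝 (circleAverage F 0 1)) := by
      refine tendsto_circleAverage (ρ := 0) (B := N) ?_ le_rfl zero_lt_one ?_ ?_
      · exact hFc.mono (sdiff_subset.trans hbsub)
      · intro z hz _
        rw [mem_ball_zero_iff] at hz
        rw [hF, norm_mul]
        exact (mul_le_of_le_one_left (norm_nonneg _) hz.le).trans (norm_truncate_le hN _)
      · intro z hz hz1
        exact (hFc z ⟨sphere_subset_closedBall hz, hz1⟩).mono hbsub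
    have hr : ∀ᶠ r in 𝓝[<] (1 : ℝ), ‖circleAverage F 0 r‖ ≤ a N := by
      filter_upwards [Ioo_mem_nhdsLT zero_lt_one] with r ⟨hr0, hr1⟩
      have hcb : closedBall (0 : ℂ) r ⊆ ball 0 1 := closedBall_subset_ball hr1
      have hs : sphere (0 : ℂ) |r| ⊆ ball 0 1 := by
        rw [abs_of_pos hr0]; exact sphere_subset_closedBall.trans hcb
      have hzkr : CircleIntegrable (fun z ↦ z * k z) 0 r :=
        ContinuousOn.circleIntegrable' ((continuousOn_id.mul hk).mono (hs.trans hbsub))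
      have hFr : CircleIntegrable F 0 r :=
        ContinuousOn.circleIntegrable' (hFc.mono (hs.trans hbsub))
      have h0 : circleAverage (fun z ↦ z * k z) 0 r = 0 := by
        rw [DiffContOnCl.circleAverage]
        · simp
        · rw [abs_of_pos hr0]
          apply DifferentiableOn.diffContOnCl
          exact (differentiableOn_id.mul hkd).mono (closure_ball_subset_closedBall.trans hcb)
      obtain ⟨hav, havI⟩ := circleAverage_circleAverage_poissonKernel (hvN N hN) hr0.le hr1
      have h0' : ‖circleAverage F 0 r‖ = ‖circleAverage (fun z ↦ z * k z - F z) 0 r‖ := by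
        rw [circleAverage_fun_sub hzkr hFr, h0, zero_sub, norm_neg]
      rw [h0']
      refine (norm_circleAverage_le _ _ _).trans ?_
      rw [show a N = _ from hav.symm]
      apply circleAverage_mono _ havI
      · intro z hz
        have hz' := hs hz
        have hz1 : ‖z‖ ≤ 1 := by
          rw [mem_ball_zero_iff] at hz'
          exact hz'.le
        simp only [hF]
        rw [← mul_sub, norm_mul, norm_sub_truncate hN]
        refine (mul_le_of_le_one_left (le_max_right _ _) hz1).trans ?_
        apply max_le
        · have h1 : CircleIntegrable (fun ζ ↦ N • (poissonKernel 0 z * fun _ ↦ (1 : ℝ) : ℂ → ℝ) ζ)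
              0 1 := IntervalIntegrable.const_mul
            (circleIntegrable_poissonKernel_mul hz' (circleIntegrable_const 1 0 1)) N
          have h2 := circleIntegrable_poissonKernel_mul hz' (hvN N hN)
          have hone : circleAverage (poissonKernel 0 z * fun _ ↦ (1 : ℝ)) 0 1 = 1 := by
            rw [poissonKernel_eq_re_herglotzRieszKernel]
            exact HarmonicOnNhd.circleAverage_re_herglotzRieszKernel_smul (f := fun _ ↦ (1 : ℝ))
              (fun x _ ↦ harmonicAt_const 1) hz'
          have h3 : circleAverage (poissonKernel 0 z * fun z ↦ max 1 ‖k z‖) 0 1 ≤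
              circleAverage (fun ζ ↦ N • (poissonKernel 0 z * fun _ ↦ (1 : ℝ) : ℂ → ℝ) ζ
                + (poissonKernel 0 z * fun z ↦ max (max 1 ‖k z‖ - N) 0) ζ) 0 1 := by
            apply circleAverage_mono (circleIntegrable_poissonKernel_mul hz' hvI) (h1.add h2)
            intro ζ hζ
            rw [abs_one] at hζ
            have h4 : max 1 ‖k ζ‖ ≤ N + max (max 1 ‖k ζ‖ - N) 0 := by
              linarith [le_max_left (max 1 ‖k ζ‖ - N) 0]
            have h5 := mul_le_mul_of_nonneg_left h4 (poissonKernel_nonneg hz' hζ)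
            simp only [Pi.mul_apply, Pi.add_apply, smul_eq_mul, mul_one]
            linarith
          rw [circleAverage_fun_add h1 h2, circleAverage_fun_smul, hone] at h3
          have h4 := hP z hz'
          simp only [smul_eq_mul, mul_one] at h3
          linarith
        · apply circleAverage_nonneg_of_nonneg
          intro ζ hζ
          rw [abs_one] at hζ
          exact mul_nonneg (poissonKernel_nonneg hz' hζ) (le_max_right _ _)
      · exact IntervalIntegrable.norm (hzkr.sub hFr)
    have h1 : ‖circleAverage F 0 1‖ ≤ a N := le_of_tendsto hlim.norm hr
    have h2 : ‖circleAverage (fun z ↦ z * k z) 0 1 - circleAverage F 0 1‖ ≤ a N := by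
      rw [← circleAverage_fun_sub hzk (htI N hN)]
      refine (norm_circleAverage_le _ _ _).trans ?_
      have h3 : CircleIntegrable (fun z ↦ ‖z * k z - z * truncate N (k z)‖) 0 1 :=
        IntervalIntegrable.norm (hzk.sub (htI N hN))
      refine circleAverage_mono h3 (hvN N hN) ?_
      intro z hz
      rw [abs_one, mem_sphere_zero_iff_norm] at hz
      rw [← mul_sub, norm_mul, hz, one_mul, norm_sub_truncate hN]
      gcongr
      exact le_max_right _ _
    have h3 := norm_sub_norm_le (circleAverage (fun z ↦ z * k z) 0 1) (circleAverage F 0 1)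
    linarith
  have hlim : Tendsto a atTop (𝓝 0) := by
    have : Tendsto a atTop (𝓝 (circleAverage (fun _ ↦ (0 : ℝ)) 0 1)) := by
      apply Tendsto.const_smul
      apply intervalIntegral.tendsto_integral_filter_of_dominated_convergence
        (fun θ ↦ max 1 ‖k (circleMap 0 1 θ)‖)
      · filter_upwards [eventually_gt_atTop 0] with N hN
        exact (intervalIntegrable_iff.1 (hvN N hN)).aestronglyMeasurable
      · filter_upwards [eventually_gt_atTop 0] with N hN
        filter_upwards with θ _
        rw [norm_of_nonneg (le_max_right _ _)]
        exact max_le (by linarith) (by positivity)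
      · exact hvI
      · filter_upwards with θ _
        apply tendsto_const_nhds.congr'
        filter_upwards [eventually_ge_atTop (max 1 ‖k (circleMap 0 1 θ)‖)] with N hN
        rw [max_eq_right (by linarith)]
    rwa [circleAverage_const] at this
  have hlim2 : Tendsto (fun N ↦ 2 * a N) atTop (𝓝 0) := by simpa using hlim.const_mul 2
  have := ge_of_tendsto hlim2 ((eventually_gt_atTop 0).mono hbound)
  simpa using this

end HardyDisc

/-! ### Transfer of Cauchy's theorem to the real line. -/

namespace HardyDisc

open Filter Topology MeasureTheory Metric Set Real InnerProductSpace

/-- The parametrization of the real line by the angle on the unit circle. -/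
noncomputable def angleTan (θ : ℝ) : ℝ := tan ((θ - π) / 2)

theorem half_angle_mem {θ : ℝ} (hθ : θ ∈ Ioo 0 (2 * π)) : (θ - π) / 2 ∈ Ioo (-(π / 2)) (π / 2) :=
  ⟨by linarith [hθ.1], by linarith [hθ.2]⟩

theorem cos_half_angle_pos {θ : ℝ} (hθ : θ ∈ Ioo 0 (2 * π)) : 0 < cos ((θ - π) / 2) :=
  cos_pos_of_mem_Ioo (half_angle_mem hθ)

theorem hasDerivAt_angleTan {θ : ℝ} (hθ : θ ∈ Ioo 0 (2 * π)) :
    HasDerivAt angleTan (1 / (2 * cos ((θ - π) / 2) ^ 2)) θ := by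
  have h1 : HasDerivAt (fun θ : ℝ ↦ (θ - π) / 2) (1 / 2) θ :=
    ((hasDerivAt_id θ).sub_const π).div_const 2
  have h2 := (hasDerivAt_tan (cos_half_angle_pos hθ).ne').comp θ h1
  refine h2.congr_deriv ?_
  rw [one_div_mul_one_div, mul_comm]

theorem injOn_angleTan : InjOn angleTan (Ioo 0 (2 * π)) := by
  intro x hx y hy hxy
  have := injOn_tan (half_angle_mem hx) (half_angle_mem hy) hxy
  linarith

theorem image_angleTan : angleTan '' Ioo 0 (2 * π) = univ := by
  apply eq_univ_of_forall
  intro t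
  refine ⟨2 * arctan t + π, ⟨?_, ?_⟩, ?_⟩
  · linarith [neg_pi_div_two_lt_arctan t]
  · linarith [arctan_lt_pi_div_two t]
  · rw [angleTan, show (2 * arctan t + π - π) / 2 = arctan t by ring, tan_arctan]

/-- Writing `θ = 2 * ((θ - π) / 2) + π` turns the boundary identities into polynomial ones in the
sine and cosine of the half angle. -/
theorem circleMap_eq_neg_sq (θ : ℝ) : circleMap 0 1 θ =
    -((cos ((θ - π) / 2) : ℂ) + (sin ((θ - π) / 2) : ℂ) * Complex.I) ^ 2 := by
  have h : (θ : ℂ) * Complex.I = 2 * ((((θ - π) / 2 : ℝ) : ℂ) * Complex.I) + π * Complex.I := by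
    push_cast; ring
  rw [circleMap_zero, Complex.ofReal_one, one_mul, h, Complex.exp_add, Complex.exp_pi_mul_I,
    show (2 : ℂ) = ((2 : ℕ) : ℂ) by norm_num, Complex.exp_nat_mul, Complex.exp_mul_I,
    Complex.ofReal_cos, Complex.ofReal_sin]
  ring

theorem cos_add_sin_I_ne_zero (x : ℝ) : (cos x : ℂ) + (sin x : ℂ) * Complex.I ≠ 0 := by
  rw [Complex.ofReal_cos, Complex.ofReal_sin, ← Complex.exp_mul_I]
  exact Complex.exp_ne_zero _

theorem one_sub_circleMap (θ : ℝ) : 1 - circleMap 0 1 θ =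
    2 * (cos ((θ - π) / 2) : ℂ) *
      ((cos ((θ - π) / 2) : ℂ) + (sin ((θ - π) / 2) : ℂ) * Complex.I) := by
  rw [circleMap_eq_neg_sq]
  have h : ((cos ((θ - π) / 2) : ℝ) : ℂ) ^ 2 + ((sin ((θ - π) / 2) : ℝ) : ℂ) ^ 2 = 1 := by
    exact_mod_cast cos_sq_add_sin_sq ((θ - π) / 2)
  linear_combination (-1 : ℂ) * h + ((sin ((θ - π) / 2) : ℝ) : ℂ) ^ 2 * Complex.I_sq

theorem cayleyInv_circleMap {θ : ℝ} (hθ : θ ∈ Ioo 0 (2 * π)) :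
    cayleyInv (circleMap 0 1 θ) = angleTan θ := by
  have hc : ((cos ((θ - π) / 2) : ℝ) : ℂ) ≠ 0 := by exact_mod_cast (cos_half_angle_pos hθ).ne'
  have he := cos_add_sin_I_ne_zero ((θ - π) / 2)
  have h : ((cos ((θ - π) / 2) : ℝ) : ℂ) ^ 2 + ((sin ((θ - π) / 2) : ℝ) : ℂ) ^ 2 = 1 := by
    exact_mod_cast cos_sq_add_sin_sq ((θ - π) / 2)
  rw [cayleyInv, one_sub_circleMap, angleTan, tan_eq_sin_div_cos, Complex.ofReal_div,
    div_eq_div_iff (mul_ne_zero (mul_ne_zero two_ne_zero hc) he) hc, circleMap_eq_neg_sq]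
  set c := ((cos ((θ - π) / 2) : ℝ) : ℂ)
  set s := ((sin ((θ - π) / 2) : ℝ) : ℂ)
  linear_combination (-Complex.I * c) * h + (-2 * c ^ 2 * s - Complex.I * s ^ 2 * c) * Complex.I_sq

/-- The right side is, up to the factor `-1/2`, the Jacobian of `angleTan`. This dictates the weight
`(1 - w)⁻²` in the transfer from the line to the circle. -/
theorem circleMap_div_one_sub_sq {θ : ℝ} (hθ : θ ∈ Ioo 0 (2 * π)) :
    circleMap 0 1 θ / (1 - circleMap 0 1 θ) ^ 2 =
      (-1 / 2 : ℂ) * ((|1 / (2 * cos ((θ - π) / 2) ^ 2)| : ℝ) : ℂ) := by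
  have hc : ((cos ((θ - π) / 2) : ℝ) : ℂ) ≠ 0 := by exact_mod_cast (cos_half_angle_pos hθ).ne'
  have he := cos_add_sin_I_ne_zero ((θ - π) / 2)
  rw [abs_of_nonneg (by positivity), one_sub_circleMap, circleMap_eq_neg_sq]
  push_cast at hc he ⊢
  field_simp

theorem cayleyInv_cayley {z : ℂ} (hz : 0 < z.im) : cayleyInv (cayley z) = z := by
  have h := add_I_ne_zero hz.le
  have h2 := one_sub_ne_zero (cayley_mem_ball hz)
  rw [cayleyInv, div_eq_iff h2, one_sub_cayley hz.le, cayley]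
  field_simp
  ring

theorem continuousOn_cayleyInv : ContinuousOn cayleyInv {1}ᶜ := by
  intro w hw
  have h : 1 - w ≠ 0 := sub_ne_zero.2 (Ne.symm hw)
  unfold cayleyInv
  apply ContinuousAt.continuousWithinAt
  fun_prop (disch := assumption)

theorem differentiableOn_cayleyInv : DifferentiableOn ℂ cayleyInv (ball 0 1) := by
  intro w hw
  have h := one_sub_ne_zero hw
  unfold cayleyInv
  fun_prop (disch := assumption)

/-- If a function is analytic in the upper half-plane, continuous up to the real axis, of bounded
type and of nonpositive mean type, and its restriction to the real axis is integrable, then its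
integral over the real axis vanishes. -/
theorem integral_eq_zero_of_boundedType {g p q : ℂ → ℂ} {A B : ℝ}
    (hgc : ContinuousOn g {z | 0 ≤ z.im}) (hgd : DifferentiableOn ℂ g {z | 0 < z.im})
    (hq : DifferentiableOn ℂ q {z | 0 < z.im}) (hpA : ∀ z : ℂ, 0 < z.im → ‖p z‖ ≤ A)
    (hqB : ∀ z : ℂ, 0 < z.im → ‖q z‖ ≤ B) (hgq : ∀ z : ℂ, 0 < z.im → g z * q z = p z)
    {z₀ : ℂ} (hz₀ : 0 < z₀.im) (hqz₀ : q z₀ ≠ 0)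
    (hg : ∀ ε > 0, ∀ᶠ y : ℝ in atTop, ‖g (y * Complex.I)‖ ≤ rexp (ε * y))
    (hI : Integrable fun t : ℝ ↦ g t) : ∫ t : ℝ, g t = 0 := by
  -- With this weight, `z * k z` with respect to the angle is `-1/2` times `g` with respect to `dt`,
  -- so the mean computed by Cauchy's theorem is a multiple of the integral sought.
  set k : ℂ → ℂ := fun w ↦ g (cayleyInv w) / (1 - w) ^ 2 with hk
  have hA0 : 0 ≤ A := (norm_nonneg _).trans (hpA z₀ hz₀)
  have hB0 : 0 ≤ B := (norm_nonneg _).trans (hqB z₀ hz₀)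
  -- This normalizes numerator and denominator to modulus at most `1`: the denominator acquires `(1
  -- - w)²`, of modulus at most `4`, and the summand `1` keeps `C` positive.
  set C := A + 4 * B + 1 with hC
  have hC0 : 0 < C := by positivity
  have hCn : ‖(C : ℂ)‖ = C := by rw [Complex.norm_real, norm_of_nonneg hC0.le]
  have hmaps : MapsTo cayleyInv (ball 0 1) {z | 0 < z.im} := fun w hw ↦ im_cayleyInv_pos hw
  have hkc : ContinuousOn k (closedBall 0 1 \ {1}) := by
    apply ContinuousOn.div
    · apply hgc.comp (continuousOn_cayleyInv.mono fun w hw ↦ hw.2)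
      intro w hw
      have h1 : ‖w‖ ≤ 1 := by simpa using hw.1
      simp only [mem_ofPred_eq, im_cayleyInv]
      apply div_nonneg _ (by positivity)
      nlinarith [norm_nonneg w]
    · fun_prop
    · intro w hw
      exact pow_ne_zero _ (sub_ne_zero.2 (Ne.symm hw.2))
  have hkd : DifferentiableOn ℂ k (ball 0 1) := by
    apply DifferentiableOn.div (hgd.comp differentiableOn_cayleyInv hmaps)
    · fun_prop
    · intro w hw
      exact pow_ne_zero _ (one_sub_ne_zero hw)
  have himage := image_angleTan
  have hderiv : ∀ θ ∈ Ioo 0 (2 * π), HasDerivWithinAt angleTan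
      (1 / (2 * cos ((θ - π) / 2) ^ 2)) (Ioo 0 (2 * π)) θ :=
    fun θ hθ ↦ (hasDerivAt_angleTan hθ).hasDerivWithinAt
  have hkcm : ∀ θ ∈ Ioo 0 (2 * π), circleMap 0 1 θ * k (circleMap 0 1 θ) =
      (-1 / 2 : ℂ) * (|1 / (2 * cos ((θ - π) / 2) ^ 2)| • g (angleTan θ)) := by
    intro θ hθ
    rw [hk, Complex.real_smul, ← mul_assoc, ← circleMap_div_one_sub_sq hθ]
    simp only [cayleyInv_circleMap hθ]
    ring
  have hgI : IntegrableOn (fun θ ↦ |1 / (2 * cos ((θ - π) / 2) ^ 2)| • g (angleTan θ))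
      (Ioo 0 (2 * π)) := by
    rw [← integrableOn_image_iff_integrableOn_abs_deriv_smul measurableSet_Ioo hderiv
      injOn_angleTan (fun t : ℝ ↦ g t), himage]
    exact hI.integrableOn
  have hkI : CircleIntegrable k 0 1 := by
    rw [CircleIntegrable, intervalIntegrable_iff_integrableOn_Ioo_of_le two_pi_pos.le]
    have h1 : IntegrableOn (fun θ ↦ (circleMap 0 1 θ)⁻¹ *
        ((-1 / 2 : ℂ) * (|1 / (2 * cos ((θ - π) / 2) ^ 2)| • g (angleTan θ)))) (Ioo 0 (2 * π)) := by
      apply Integrable.bdd_mul (c := 1) (hgI.const_mul _)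
      · apply Continuous.aestronglyMeasurable
        exact (continuous_circleMap 0 1).inv₀ fun θ ↦ by simp [circleMap]
      · filter_upwards with θ
        simp
    refine h1.congr_fun ?_ measurableSet_Ioo
    intro θ hθ
    simp only
    rw [← hkcm θ hθ, inv_mul_cancel_left₀]
    simp [circleMap]
  have hnorm2 : ∀ w ∈ ball (0 : ℂ) 1, ‖(1 - w) ^ 2‖ ≤ 4 := by
    intro w hw
    have h1 : ‖w‖ < 1 := by simpa using hw
    have h2 : ‖1 - w‖ ≤ 2 := by
      have := norm_sub_le (1 : ℂ) w
      rw [norm_one] at this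
      linarith
    rw [norm_pow]
    nlinarith [norm_nonneg (1 - w)]
  obtain ⟨M, hM⟩ := exists_circleAverage_posLog_le (k := k) (p := fun w ↦ p (cayleyInv w) / C)
    (q := fun w ↦ q (cayleyInv w) * (1 - w) ^ 2 / C) (w := cayley z₀) hkd
    (by
      apply DifferentiableOn.div_const
      exact (hq.comp differentiableOn_cayleyInv hmaps).mul (by fun_prop))
    (by
      intro w hw
      rw [norm_div, hCn, div_le_one hC0]
      linarith [hpA _ (hmaps hw)])
    (by
      intro w hw
      rw [norm_div, hCn, div_le_one hC0, norm_mul]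
      have := mul_le_mul (hqB _ (hmaps hw)) (hnorm2 w hw) (norm_nonneg _) hB0
      linarith)
    (by
      intro w hw
      have h := one_sub_ne_zero hw
      rw [hk, ← hgq _ (hmaps hw)]
      field_simp)
    (cayley_mem_ball hz₀)
    (by
      rw [cayleyInv_cayley hz₀]
      exact div_ne_zero (mul_ne_zero hqz₀ (pow_ne_zero _ (one_sub_ne_zero (cayley_mem_ball hz₀))))
        (by exact_mod_cast hC0.ne'))
  -- Along the imaginary axis the weight contributes only `(y + 1)² / 4`, absorbed by half of the
  -- exponential.
  have hgrow : ∀ ε > 0, ∀ᶠ y : ℝ in atTop, ‖k (cayley (y * Complex.I))‖ ≤ rexp (ε * y) := by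
    intro ε hε
    have h1 := (isLittleO_pow_exp_pos_mul_atTop 2 (half_pos hε)).bound zero_lt_one
    filter_upwards [hg (ε / 2) (half_pos hε), h1, eventually_ge_atTop 1] with y hy1 hy2 hy3
    have him : 0 < ((y : ℂ) * Complex.I).im := by simp; linarith
    have hn : ‖(y : ℂ) * Complex.I + Complex.I‖ = y + 1 := by
      have : (y : ℂ) * Complex.I + Complex.I = ((y + 1 : ℝ) : ℂ) * Complex.I := by push_cast; ring
      rw [this, norm_mul, Complex.norm_I, mul_one, Complex.norm_real, norm_of_nonneg (by linarith)]
    rw [hk]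
    simp only
    rw [cayleyInv_cayley him, one_sub_cayley him.le, norm_div, norm_pow, norm_div, hn]
    rw [norm_pow, norm_of_nonneg (by linarith), norm_of_nonneg (exp_pos _).le, one_mul] at hy2
    simp only [Complex.norm_mul, Complex.norm_ofNat, Complex.norm_I, mul_one]
    rw [div_le_iff₀ (by positivity)]
    have h4 : (y + 1) ^ 2 / 4 ≤ rexp (ε / 2 * y) := by
      refine le_trans ?_ hy2
      nlinarith
    have h5 : rexp (ε * y) = rexp (ε / 2 * y) * rexp (ε / 2 * y) := by
      rw [← exp_add]; ring_nf
    rw [h5, mul_assoc]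
    calc _ ≤ rexp (ε / 2 * y) * 1 := by rw [mul_one]; exact hy1
      _ ≤ _ := by
        gcongr
        rw [div_pow, mul_div_assoc', le_div_iff₀ (by positivity)]
        linarith
  have hzero := circleAverage_mul_eq_zero_of_le hkc hkd hkI
    (fun w hw ↦ norm_le_circleAverage hkc hkd hkI hM hgrow hw)
  rw [circleAverage_def, smul_eq_zero, inv_eq_zero] at hzero
  have hzero' := hzero.resolve_left (by positivity)
  rw [intervalIntegral.integral_of_le two_pi_pos.le, integral_Ioc_eq_integral_Ioo,
    setIntegral_congr_fun measurableSet_Ioo hkcm, integral_const_mul,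
    ← integral_image_eq_integral_abs_deriv_smul measurableSet_Ioo hderiv injOn_angleTan
      (fun t : ℝ ↦ g t), himage, setIntegral_univ] at hzero'
  simpa using hzero'

end HardyDisc

/-! ### Quotients of entire functions whose denominators may have real zeros. -/

namespace DeBranges

open Filter Topology MeasureTheory

theorem tendsto_ofReal_nhdsNE (x : ℝ) :
    Tendsto (fun t : ℝ ↦ (t : ℂ)) (𝓝[≠] x) (𝓝[≠] (x : ℂ)) := by
  apply tendsto_nhdsWithin_of_tendsto_nhds_of_eventually_within
  · exact Complex.continuous_ofReal.continuousAt.tendsto.mono_left nhdsWithin_le_nhds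
  · filter_upwards [self_mem_nhdsWithin] with t ht
    simpa using ht

/-- A meromorphic function that is integrable along the real axis has no real pole. -/
theorem meromorphicOrderAt_nonneg_of_intervalIntegrable {h : ℂ → ℂ} {x a b : ℝ}
    (hm : MeromorphicAt h x) (hab : a ≠ b) (hx : x ∈ Set.uIcc a b)
    (hI : IntervalIntegrable (fun t : ℝ ↦ h t) volume a b) :
    0 ≤ meromorphicOrderAt h (x : ℂ) := by
  by_contra hneg
  push Not at hneg
  obtain ⟨n, hn⟩ := WithTop.ne_top_iff_exists.1 (ne_top_of_lt hneg)
  rw [← hn] at hneg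
  have hn0 : n < 0 := by exact_mod_cast hneg
  obtain ⟨g, hg, hgx, hgh⟩ := (meromorphicOrderAt_eq_int_iff hm).1 hn.symm
  -- A pole has order at most `-1`. Hence `(z - x)⁻¹` is `O(h)` near `x`, although `1 / (t - x)` is
  -- not integrable across `x`.
  obtain ⟨m, hm'⟩ : ∃ m : ℕ, n = -1 - m := ⟨(-1 - n).toNat, by omega⟩
  have hO : (fun z : ℂ ↦ (z - x)⁻¹) =O[𝓝[≠] (x : ℂ)] h := by
    have hg0 : ∀ᶠ z in 𝓝[≠] (x : ℂ), g z ≠ 0 :=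
      (hg.continuousAt.eventually_ne hgx).filter_mono nhdsWithin_le_nhds
    apply Asymptotics.isBigO_of_div_tendsto_nhds _ (((x : ℂ) - x) ^ m / g x)
    · have h1 : Tendsto (fun z ↦ (z - x) ^ m / g z) (𝓝[≠] (x : ℂ)) (𝓝 (((x : ℂ) - x) ^ m / g x)) := by
        apply Tendsto.mono_left _ nhdsWithin_le_nhds
        apply Tendsto.div _ hg.continuousAt.tendsto hgx
        apply Continuous.tendsto
        fun_prop
      apply h1.congr'
      filter_upwards [hgh, hg0, self_mem_nhdsWithin] with z hz hz0 hzx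
      have hzx' : z - x ≠ 0 := sub_ne_zero.2 hzx
      rw [Pi.div_apply, hz, smul_eq_mul, hm', zpow_sub₀ hzx', zpow_natCast, zpow_neg_one]
      field_simp
    · filter_upwards [hgh, hg0, self_mem_nhdsWithin] with z hz hz0 hzx h0
      have hzx' : z - x ≠ 0 := sub_ne_zero.2 hzx
      rw [hz] at h0
      exact absurd h0 (smul_ne_zero (zpow_ne_zero _ hzx') hz0)
  have hO' : (fun t : ℝ ↦ (t - x)⁻¹) =O[𝓝[≠] x] fun t : ℝ ↦ h t := by
    have := hO.comp_tendsto (tendsto_ofReal_nhdsNE x)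
    refine (Asymptotics.isBigO_of_le _ fun t ↦ ?_).trans this
    rw [Function.comp, norm_inv, norm_inv, ← Complex.ofReal_sub, Complex.norm_real]
  exact not_intervalIntegrable_of_sub_inv_isBigO_punctured hO' hab hx hI

theorem ae_ne_zero {D : ℂ → ℂ} (hD : Differentiable ℂ D) {z₀ : ℂ} (h₀ : D z₀ ≠ 0) :
    ∀ᵐ t : ℝ, D t ≠ 0 := by
  have hDa : AnalyticOnNhd ℂ D Set.univ := fun z _ ↦ hD.analyticAt z
  have h1 : D ⁻¹' {0}ᶜ ∈ codiscrete ℂ := hDa.preimage_zero_mem_codiscrete h₀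
  have h2 : {t : ℝ | D t ≠ 0} ∈ codiscreteWithin (Set.univ : Set ℝ) := by
    rw [mem_codiscreteWithin]
    intro x _
    rw [mem_codiscrete] at h1
    have h3 := h1 x
    rw [disjoint_principal_right, compl_compl] at h3
    rw [disjoint_principal_right]
    have := tendsto_ofReal_nhdsNE x h3
    filter_upwards [this] with t ht
    simpa using ht
  have h3 := ae_restrict_le_codiscreteWithin (μ := volume) MeasurableSet.univ h2
  rwa [Measure.restrict_univ] at h3

/-- **Cauchy's theorem** for a quotient of entire functions which is of bounded type and of
nonpositive mean type in the upper half-plane and integrable on the real axis. -/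
theorem integral_div_eq_zero {N D : ℂ → ℂ} (hN : Differentiable ℂ N) (hD : Differentiable ℂ D)
    (hD0 : ∀ z : ℂ, 0 < z.im → D z ≠ 0) (hb : BoundedType fun z ↦ N z / D z)
    (hg : ∀ ε > 0, ∀ᶠ y : ℝ in atTop,
      ‖N (y * Complex.I) / D (y * Complex.I)‖ ≤ Real.exp (ε * y))
    (hI : Integrable fun t : ℝ ↦ N t / D t) : ∫ t : ℝ, N t / D t = 0 := by
  obtain ⟨-, p, q, -, hq, ⟨A, hA⟩, ⟨B, hB⟩, ⟨z₀, hz₀, hqz₀⟩, hpq⟩ := hb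
  have hm : MeromorphicOn (fun z ↦ N z / D z) Set.univ := fun z _ ↦
    (hN.analyticAt z).meromorphicAt.div (hD.analyticAt z).meromorphicAt
  -- The normal form fills in removable singularities. Integrability excludes poles on the real
  -- axis, so `g` is analytic up to the axis while agreeing with the quotient wherever `D` is
  -- nonzero.
  set g := toMeromorphicNFOn (fun z ↦ N z / D z) Set.univ with hgdef
  have heq : ∀ z, D z ≠ 0 → g z = N z / D z := by
    intro z hz
    rw [hgdef, toMeromorphicNFOn_eq_toMeromorphicNFAt hm (Set.mem_univ z),
      toMeromorphicNFAt_eq_self.2]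
    exact ((hN.analyticAt z).div (hD.analyticAt z) hz).meromorphicNFAt
  have horder : ∀ z, 0 ≤ meromorphicOrderAt (fun z ↦ N z / D z) z → AnalyticAt ℂ g z := by
    intro z hz
    have h1 := meromorphicNFOn_toMeromorphicNFOn (f := fun z ↦ N z / D z) (U := Set.univ)
      (Set.mem_univ z)
    rw [← hgdef] at h1
    rw [← h1.meromorphicOrderAt_nonneg_iff_analyticAt, hgdef,
      meromorphicOrderAt_toMeromorphicNFOn hm (Set.mem_univ z)]
    exact hz
  have hga : ∀ z : ℂ, 0 ≤ z.im → AnalyticAt ℂ g z := by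
    intro z hz
    apply horder
    rcases eq_or_lt_of_le hz with h | h
    · have hzr : z = (z.re : ℂ) := Complex.ext rfl (by simp [← h])
      rw [hzr]
      refine meromorphicOrderAt_nonneg_of_intervalIntegrable (a := z.re - 1) (b := z.re + 1)
        (hm _ (Set.mem_univ _)) (by linarith) ?_ hI.intervalIntegrable
      rw [Set.uIcc_of_le (by linarith)]
      constructor <;> linarith
    · exact ((hN.analyticAt z).div (hD.analyticAt z) (hD0 z h)).meromorphicOrderAt_nonneg
  have hD1 := ae_ne_zero hD (hD0 Complex.I (by simp))
  have hae : (fun t : ℝ ↦ g t) =ᵐ[volume] fun t : ℝ ↦ N t / D t := by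
    filter_upwards [hD1] with t ht
    exact heq _ ht
  rw [← integral_congr_ae hae]
  refine HardyDisc.integral_eq_zero_of_boundedType (p := p) (q := q) (A := A) (B := B)
    (fun z hz ↦ (hga z hz).continuousAt.continuousWithinAt)
    (fun z hz ↦ (hga z (le_of_lt hz)).differentiableAt.differentiableWithinAt) hq hA hB ?_ hz₀ hqz₀
    ?_ (hI.congr hae.symm)
  · intro z hz
    rw [heq z (hD0 z hz)]
    exact hpq z hz
  · intro ε hε
    filter_upwards [hg ε hε, eventually_gt_atTop 0] with y hy hy0
    rwa [heq _ (hD0 _ (by simpa using hy0))]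

end DeBranges

/-! ### Bounded type, mean type and multipliers between de Branges spaces. -/

namespace DeBranges

open Filter Topology MeasureTheory

/-- `‖f (iy)‖` grows more slowly than every exponential as `y → +∞`. -/
def SubexpOnImag (f : ℂ → ℂ) : Prop :=
  ∀ ε > 0, ∀ᶠ y : ℝ in atTop, ‖f (y * Complex.I)‖ ≤ Real.exp (ε * y)

theorem log_enorm_div_le_iff {x : ℂ} {y ε : ℝ} (hy : 0 < y) :
    ENNReal.log ‖x‖ₑ / (y : EReal) ≤ ε ↔ ‖x‖ ≤ Real.exp (ε * y) := by
  rw [EReal.div_le_iff_le_mul (by exact_mod_cast hy) (EReal.coe_ne_top y), ← EReal.coe_mul,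
    ← EReal.exp_le_exp_iff, ENNReal.exp_log, EReal.exp_coe, ← ofReal_norm,
    ENNReal.ofReal_le_ofReal_iff (Real.exp_pos _).le, mul_comm]

theorem meanType_nonpos_iff {f : ℂ → ℂ} : meanType f ≤ 0 ↔ SubexpOnImag f := by
  constructor
  · intro h ε hε
    have h1 : meanType f < (ε : EReal) := h.trans_lt (by exact_mod_cast hε)
    filter_upwards [eventually_lt_of_limsup_lt h1, eventually_gt_atTop 0] with y hy hy0
    exact (log_enorm_div_le_iff hy0).1 hy.le
  · intro h
    apply le_of_forall_gt_imp_ge_of_dense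
    intro c hc
    obtain ⟨ε, hε0, hεc⟩ := EReal.lt_iff_exists_real_btwn.1 hc
    refine le_trans ?_ hεc.le
    apply limsup_le_of_le
    · isBoundedDefault
    · have hε : 0 < ε := by exact_mod_cast hε0
      filter_upwards [h ε hε, eventually_gt_atTop 0] with y hy hy0
      exact (log_enorm_div_le_iff hy0).2 hy

theorem SubexpOnImag.of_le {f g : ℂ → ℂ} {C : ℝ} (hg : SubexpOnImag g)
    (h : ∀ y : ℝ, 1 ≤ y → ‖f (y * Complex.I)‖ ≤ C * (‖g (y * Complex.I)‖ + 1)) :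
    SubexpOnImag f := by
  intro ε hε
  have h1 : Tendsto (fun y : ℝ ↦ Real.exp (ε / 2 * y)) atTop atTop :=
    Real.tendsto_exp_atTop.comp (tendsto_id.const_mul_atTop (half_pos hε))
  filter_upwards [hg (ε / 2) (half_pos hε), eventually_ge_atTop 1,
    h1.eventually_ge_atTop (2 * |C|)] with y hy hy1 hyC
  have h2 : 1 ≤ Real.exp (ε / 2 * y) := Real.one_le_exp (by positivity)
  have h3 : Real.exp (ε * y) = Real.exp (ε / 2 * y) * Real.exp (ε / 2 * y) := by
    rw [← Real.exp_add]; ring_nf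
  calc ‖f (y * Complex.I)‖ ≤ C * (‖g (y * Complex.I)‖ + 1) := h y hy1
    _ ≤ |C| * (‖g (y * Complex.I)‖ + 1) := by gcongr; exact le_abs_self C
    _ ≤ |C| * (2 * Real.exp (ε / 2 * y)) := by gcongr; linarith
    _ = 2 * |C| * Real.exp (ε / 2 * y) := by ring
    _ ≤ Real.exp (ε * y) := by rw [h3]; gcongr

theorem SubexpOnImag.mul {f g : ℂ → ℂ} (hf : SubexpOnImag f) (hg : SubexpOnImag g) :
    SubexpOnImag fun z ↦ f z * g z := by
  intro ε hε
  filter_upwards [hf (ε / 2) (half_pos hε), hg (ε / 2) (half_pos hε)] with y h1 h2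
  have h3 : Real.exp (ε * y) = Real.exp (ε / 2 * y) * Real.exp (ε / 2 * y) := by
    rw [← Real.exp_add]; ring_nf
  rw [h3, norm_mul]
  gcongr

theorem subexpOnImag_zero : SubexpOnImag fun _ ↦ 0 := by
  intro ε _
  filter_upwards with y
  simp [Real.exp_nonneg]

theorem isOpen_upperHalf : IsOpen upperHalf := isOpen_lt continuous_const Complex.continuous_im

theorem mul_I_mem_upperHalf {y : ℝ} (hy : 0 < y) : (y : ℂ) * Complex.I ∈ upperHalf := by
  simpa [upperHalf] using hy

theorem isPreconnected_upperHalf : IsPreconnected upperHalf :=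
  (convex_halfSpace_im_gt 0).isPreconnected

theorem BoundedType.congr {f g : ℂ → ℂ} (hf : BoundedType f) (h : ∀ z ∈ upperHalf, g z = f z) :
    BoundedType g := by
  obtain ⟨hd, p, q, hp, hq, hpb, hqb, hq0, hpq⟩ := hf
  exact ⟨hd.congr h, p, q, hp, hq, hpb, hqb, hq0, fun z hz ↦ by rw [h z hz, hpq z hz]⟩

theorem boundedType_of_bounded {f : ℂ → ℂ} (hf : DifferentiableOn ℂ f upperHalf) {C : ℝ}
    (hC : ∀ z ∈ upperHalf, ‖f z‖ ≤ C) : BoundedType f :=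
  ⟨hf, f, fun _ ↦ 1, hf, by fun_prop, ⟨C, hC⟩, ⟨1, fun z _ ↦ by simp⟩,
    ⟨Complex.I, by simp [upperHalf], one_ne_zero⟩, fun z _ ↦ mul_one _⟩

theorem exists_mul_ne_zero {p q : ℂ → ℂ} (hp : DifferentiableOn ℂ p upperHalf)
    (hq : DifferentiableOn ℂ q upperHalf) (hp0 : ∃ z ∈ upperHalf, p z ≠ 0)
    (hq0 : ∃ z ∈ upperHalf, q z ≠ 0) : ∃ z ∈ upperHalf, p z * q z ≠ 0 := by
  by_contra! h
  have hpa := hp.analyticOnNhd isOpen_upperHalf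
  have hqa := hq.analyticOnNhd isOpen_upperHalf
  obtain ⟨z, hz, hpz⟩ := hp0
  obtain ⟨w, hw, hqw⟩ := hq0
  have hpn : ∀ᶠ x in 𝓝 z, p x ≠ 0 := (hpa z hz).continuousAt.eventually_ne hpz
  have hqn : q =ᶠ[𝓝 z] 0 := by
    filter_upwards [hpn, isOpen_upperHalf.mem_nhds hz] with x hx hxu
    exact (mul_eq_zero.1 (h x hxu)).resolve_left hx
  exact hqw (hqa.eqOn_zero_of_preconnected_of_eventuallyEq_zero isPreconnected_upperHalf hz hqn hw)

theorem exists_bound_mul {p q : ℂ → ℂ} (hp : ∃ C : ℝ, ∀ z ∈ upperHalf, ‖p z‖ ≤ C)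
    (hq : ∃ C : ℝ, ∀ z ∈ upperHalf, ‖q z‖ ≤ C) : ∃ C : ℝ, ∀ z ∈ upperHalf, ‖p z * q z‖ ≤ C := by
  obtain ⟨C, hC⟩ := hp
  obtain ⟨D, hD⟩ := hq
  refine ⟨C * D, fun z hz ↦ ?_⟩
  rw [norm_mul]
  exact mul_le_mul (hC z hz) (hD z hz) (norm_nonneg _) ((norm_nonneg _).trans (hC z hz))

theorem BoundedType.mul {f g : ℂ → ℂ} (hf : BoundedType f) (hg : BoundedType g) :
    BoundedType fun z ↦ f z * g z := by
  obtain ⟨hd, p, q, hp, hq, hpb, hqb, hq0, hpq⟩ := hf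
  obtain ⟨hd', p', q', hp', hq', hpb', hqb', hq0', hpq'⟩ := hg
  refine ⟨hd.mul hd', fun z ↦ p z * p' z, fun z ↦ q z * q' z, hp.mul hp', hq.mul hq',
    exists_bound_mul hpb hpb', exists_bound_mul hqb hqb', exists_mul_ne_zero hq hq' hq0 hq0', ?_⟩
  intro z hz
  show f z * g z * (q z * q' z) = p z * p' z
  rw [← hpq z hz, ← hpq' z hz]
  ring

theorem BoundedType.add {f g : ℂ → ℂ} (hf : BoundedType f) (hg : BoundedType g) :
    BoundedType fun z ↦ f z + g z := by
  obtain ⟨hd, p, q, hp, hq, hpb, hqb, hq0, hpq⟩ := hf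
  obtain ⟨hd', p', q', hp', hq', hpb', hqb', hq0', hpq'⟩ := hg
  refine ⟨hd.add hd', fun z ↦ p z * q' z + p' z * q z, fun z ↦ q z * q' z,
    (hp.mul hq').add (hp'.mul hq), hq.mul hq', ?_, exists_bound_mul hqb hqb',
    exists_mul_ne_zero hq hq' hq0 hq0', ?_⟩
  · obtain ⟨C, hC⟩ := exists_bound_mul hpb hqb'
    obtain ⟨D, hD⟩ := exists_bound_mul hpb' hqb
    exact ⟨C + D, fun z hz ↦ (norm_add_le _ _).trans (add_le_add (hC z hz) (hD z hz))⟩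
  · intro z hz
    show (f z + g z) * (q z * q' z) = p z * q' z + p' z * q z
    rw [← hpq z hz, ← hpq' z hz]
    ring

theorem boundedType_const (c : ℂ) : BoundedType fun _ ↦ c :=
  boundedType_of_bounded (by fun_prop) (C := ‖c‖) fun _ _ ↦ le_rfl

theorem add_I_norm_ge {z : ℂ} (hz : z ∈ upperHalf) (x : ℝ) : 1 ≤ ‖z - x + Complex.I‖ := by
  have h1 : (z - x + Complex.I).im = z.im + 1 := by simp
  have h2 := Complex.abs_im_le_norm (z - x + Complex.I)
  rw [h1] at h2
  have h3 : 0 < z.im := hz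
  exact le_trans (by rw [abs_of_pos (by linarith)]; linarith) h2

theorem sub_ofReal_ne_zero {z : ℂ} (hz : z ∈ upperHalf) (x : ℝ) : z - x ≠ 0 := by
  intro h
  have h1 : (z - x).im = z.im := by simp
  have h3 : 0 < z.im := hz
  rw [h] at h1
  simp at h1
  linarith

theorem sub_ofReal_add_I_ne_zero {z : ℂ} (hz : z ∈ upperHalf) (x : ℝ) : z - x + Complex.I ≠ 0 :=
  norm_pos_iff.1 (zero_lt_one.trans_le (add_I_norm_ge hz x))

theorem boundedType_inv_add_I (x : ℝ) : BoundedType fun z ↦ (z - x + Complex.I)⁻¹ := by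
  apply boundedType_of_bounded (C := 1)
  · intro z hz
    have := sub_ofReal_add_I_ne_zero hz x
    fun_prop (disch := assumption)
  · intro z hz
    rw [norm_inv]
    exact inv_le_one_of_one_le₀ (add_I_norm_ge hz x)

/-- The function is unbounded near the boundary point `x`; multiplying its numerator and denominator
by `(z - x + i)⁻¹` makes both bounded. -/
theorem boundedType_inv_sub (x : ℝ) : BoundedType fun z ↦ (z - x)⁻¹ := by
  have hd : DifferentiableOn ℂ (fun z : ℂ ↦ (z - x + Complex.I)⁻¹) upperHalf := by
    intro z hz
    have := sub_ofReal_add_I_ne_zero hz x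
    fun_prop (disch := assumption)
  refine ⟨?_, fun z ↦ (z - x + Complex.I)⁻¹, fun z ↦ (z - x) * (z - x + Complex.I)⁻¹, hd,
    DifferentiableOn.mul (by fun_prop) hd, ⟨1, ?_⟩, ⟨2, ?_⟩, ⟨Complex.I, by simp [upperHalf], ?_⟩, ?_⟩
  · intro z hz
    have := sub_ofReal_ne_zero hz x
    fun_prop (disch := assumption)
  · intro z hz
    rw [norm_inv]
    exact inv_le_one_of_one_le₀ (add_I_norm_ge hz x)
  · intro z hz
    have h1 := add_I_norm_ge hz x
    rw [norm_mul, norm_inv, ← div_eq_mul_inv, div_le_iff₀ (by linarith)]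
    have h2 : z - x = (z - x + Complex.I) - Complex.I := by ring
    have h3 := norm_sub_le (z - x + Complex.I) Complex.I
    rw [← h2, Complex.norm_I] at h3
    linarith
  · have hI : Complex.I ∈ upperHalf := by simp [upperHalf]
    exact mul_ne_zero (sub_ofReal_ne_zero hI x) (inv_ne_zero (sub_ofReal_add_I_ne_zero hI x))
  · intro z hz
    rw [inv_mul_cancel_left₀ (sub_ofReal_ne_zero hz x)]

section HermiteBiehler

theorem sharp_sharp (f : ℂ → ℂ) : sharp (sharp f) = f := by
  ext z; simp [sharp]

theorem sharp_mul (f g : ℂ → ℂ) : sharp (f * g) = sharp f * sharp g := by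
  ext z; simp [sharp]

theorem sharp_ofReal (f : ℂ → ℂ) (t : ℝ) : sharp f t = conj (f t) := by
  simp [sharp]

theorem differentiable_sharp {f : ℂ → ℂ} (hf : Differentiable ℂ f) : Differentiable ℂ (sharp f) := by
  intro z
  have := (hf (conj z)).conj_conj
  rw [Complex.conj_conj] at this
  exact this

variable {E F : ℂ → ℂ}

theorem HermiteBiehler.ne_zero (hE : HermiteBiehler E) {z : ℂ} (hz : z ∈ upperHalf) : E z ≠ 0 :=
  norm_pos_iff.1 ((norm_nonneg _).trans_lt (hE.2 z hz))

theorem HermiteBiehler.norm_sharp_le (hE : HermiteBiehler E) {z : ℂ} (hz : z ∈ upperHalf) :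
    ‖sharp E z‖ ≤ ‖E z‖ := by
  rw [sharp, RCLike.norm_conj]
  exact (hE.2 z hz).le

theorem HermiteBiehler.ae_ne_zero (hE : HermiteBiehler E) : ∀ᵐ t : ℝ, E t ≠ 0 :=
  DeBranges.ae_ne_zero hE.1 (hE.ne_zero (z := Complex.I) (by simp [upperHalf]))

theorem HermiteBiehler.mul (hE : HermiteBiehler E) (hF : HermiteBiehler F) :
    HermiteBiehler (E * F) := by
  refine ⟨hE.1.mul hF.1, fun z hz ↦ ?_⟩
  rw [Pi.mul_apply, Pi.mul_apply, norm_mul, norm_mul]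
  exact mul_lt_mul'' (hE.2 z hz) (hF.2 z hz) (norm_nonneg _) (norm_nonneg _)

theorem boundedType_div {C : ℂ → ℂ} (hE : HermiteBiehler E) (hC : Differentiable ℂ C)
    (h : ∀ z ∈ upperHalf, ‖C z‖ ≤ ‖E z‖) : BoundedType fun z ↦ C z / E z := by
  apply boundedType_of_bounded (C := 1)
  · exact hC.differentiableOn.div hE.1.differentiableOn fun z hz ↦ hE.ne_zero hz
  · intro z hz
    rw [norm_div]
    exact div_le_one_of_le₀ (h z hz) (norm_nonneg _)

theorem sharp_mem_space {f : ℂ → ℂ} (hf : f ∈ space E) : sharp f ∈ space E := by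
  obtain ⟨h1, h2, h3, h4, h5, h6⟩ := hf
  refine ⟨differentiable_sharp h1, ?_, h5, h6, by rwa [sharp_sharp], by rwa [sharp_sharp]⟩
  convert h2 using 1
  apply lintegral_congr
  intro t
  rw [sharp_ofReal, ← ofReal_norm, ← ofReal_norm, norm_div, norm_div, RCLike.norm_conj]

theorem boundedType_mul_div {A B C f : ℂ → ℂ} (hB : HermiteBiehler B)
    (hC : Differentiable ℂ C) (hCB : ∀ z ∈ upperHalf, ‖C z‖ ≤ ‖B z‖)
    (hf : BoundedType fun z ↦ f z / A z) (hfg : SubexpOnImag fun z ↦ f z / A z) :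
    BoundedType (fun z ↦ (f * C) z / (A * B) z) ∧
      SubexpOnImag (fun z ↦ (f * C) z / (A * B) z) := by
  constructor
  · refine (hf.mul (boundedType_div hB hC hCB)).congr fun z _ ↦ ?_
    simp only [Pi.mul_apply]
    rw [mul_div_mul_comm]
  · apply hfg.of_le (C := 1)
    intro y hy
    have hz := mul_I_mem_upperHalf (zero_lt_one.trans_le hy)
    simp only [Pi.mul_apply]
    rw [mul_div_mul_comm, norm_mul, norm_div (C _)]
    have h1 : ‖C (y * Complex.I)‖ / ‖B (y * Complex.I)‖ ≤ 1 :=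
      div_le_one_of_le₀ (hCB _ hz) (norm_nonneg _)
    have := mul_le_of_le_one_right (norm_nonneg (f (y * Complex.I) / A (y * Complex.I))) h1
    linarith

theorem normSq_mul {A B C f : ℂ → ℂ} (hB : HermiteBiehler B) (hCB : ∀ t : ℝ, ‖C t‖ = ‖B t‖) :
    normSq (A * B) (f * C) = normSq A f := by
  apply lintegral_congr_ae
  filter_upwards [hB.ae_ne_zero] with t ht
  have h1 : ‖C t / B t‖ₑ = 1 := by
    rw [← ofReal_norm, norm_div, hCB, div_self (norm_ne_zero_iff.2 ht), ENNReal.ofReal_one]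
  simp only [Pi.mul_apply]
  rw [mul_div_mul_comm, enorm_mul, h1, mul_one]

/-- Multiplication by a function with `‖C‖ = ‖B‖` on the real axis and `‖C‖, ‖C^*‖ ≤ ‖B‖` in the
upper half-plane maps `H(A)` into `H(AB)`. -/
theorem mul_mem_space {A B C f : ℂ → ℂ} (hB : HermiteBiehler B)
    (hC : Differentiable ℂ C) (hCB : ∀ z ∈ upperHalf, ‖C z‖ ≤ ‖B z‖)
    (hCB' : ∀ z ∈ upperHalf, ‖sharp C z‖ ≤ ‖B z‖) (hCBr : ∀ t : ℝ, ‖C t‖ = ‖B t‖)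
    (hf : f ∈ space A) : f * C ∈ space (A * B) := by
  obtain ⟨h1, h2, h3, h4, h5, h6⟩ := hf
  rw [meanType_nonpos_iff] at h4 h6
  obtain ⟨a1, a2⟩ := boundedType_mul_div hB hC hCB h3 h4
  obtain ⟨b1, b2⟩ := boundedType_mul_div hB (differentiable_sharp hC) hCB' h5 h6
  rw [← sharp_mul] at b1 b2
  refine ⟨h1.mul hC, ?_, a1, meanType_nonpos_iff.2 a2, b1, meanType_nonpos_iff.2 b2⟩
  rwa [normSq_mul hB hCBr]

theorem mul_mem_space_self (hF : HermiteBiehler F) {f : ℂ → ℂ}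
    (hf : f ∈ space E) : f * F ∈ space (E * F) :=
  mul_mem_space hF hF.1 (fun _ _ ↦ le_rfl) (fun _ hz ↦ hF.norm_sharp_le hz) (fun _ ↦ rfl) hf

theorem mul_sharp_mem_space (hE : HermiteBiehler E) {g : ℂ → ℂ}
    (hg : g ∈ space F) : g * sharp E ∈ space (E * F) := by
  rw [mul_comm E F]
  refine mul_mem_space hE (differentiable_sharp hE.1) (fun _ hz ↦ hE.norm_sharp_le hz) ?_ ?_ hg
  · rw [sharp_sharp]; exact fun _ _ ↦ le_rfl
  · intro t; rw [sharp_ofReal, RCLike.norm_conj]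

theorem zero_mem_space (E : ℂ → ℂ) : (0 : ℂ → ℂ) ∈ space E := by
  have h : sharp 0 = 0 := by ext z; simp [sharp]
  have hb : BoundedType fun z ↦ (0 : ℂ → ℂ) z / E z :=
    (boundedType_const 0).congr fun z _ ↦ by simp
  have hm : meanType (fun z ↦ (0 : ℂ → ℂ) z / E z) ≤ 0 := by
    rw [meanType_nonpos_iff]
    simpa using subexpOnImag_zero
  refine ⟨differentiable_const 0, by simp [normSq], hb, hm, ?_, ?_⟩ <;> rwa [h]

end HermiteBiehler

end DeBranges

/-! ### Reproducing kernels at real points as elements of the space. -/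

namespace DeBranges

open Filter Topology MeasureTheory

variable {E : ℂ → ℂ}

theorem kernelNum_ofReal (E : ℂ → ℂ) (x : ℝ) (z : ℂ) :
    kernelNum E x z = conj (E x) * E z - E x * sharp E z := by
  rw [kernelNum, Complex.conj_ofReal]

theorem kernelNum_self (E : ℂ → ℂ) (x : ℝ) : kernelNum E x x = 0 := by
  rw [kernelNum_ofReal, sharp_ofReal]; ring

theorem differentiable_kernelNum (hE : Differentiable ℂ E) (w : ℂ) :
    Differentiable ℂ (kernelNum E w) :=
  (hE.const_mul _).sub ((differentiable_sharp hE).const_mul _)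

/-- At real `x` the numerator vanishes at `x`, so the kernel is a multiple of its divided
difference. This treats the diagonal value uniformly and shows that the kernel is entire. -/
theorem kernel_ofReal_eq_dslope (E : ℂ → ℂ) (x : ℝ) (z : ℂ) :
    kernel E x z = -(2 * Real.pi * Complex.I)⁻¹ * dslope (kernelNum E x) x z := by
  rw [kernel, Complex.conj_ofReal]
  split_ifs with h
  · rw [h, dslope_same]; ring
  · rw [dslope_of_ne _ h, slope_def_field, kernelNum_self, sub_zero, ← neg_sub z, mul_neg, div_neg,
      div_eq_mul_inv, mul_inv, div_eq_mul_inv]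
    ring

theorem sub_mul_kernel (E : ℂ → ℂ) (x : ℝ) (z : ℂ) :
    (z - x) * kernel E x z = -(2 * Real.pi * Complex.I)⁻¹ * kernelNum E x z := by
  have := sub_smul_dslope (kernelNum E x) x z
  rw [kernelNum_self, sub_zero, smul_eq_mul] at this
  rw [kernel_ofReal_eq_dslope, ← this]; ring

theorem differentiable_dslope {f : ℂ → ℂ} (hf : Differentiable ℂ f) (a : ℂ) :
    Differentiable ℂ (dslope f a) := by
  rw [← differentiableOn_univ, Complex.differentiableOn_dslope univ_mem]
  exact hf.differentiableOn

theorem differentiable_kernel (hE : Differentiable ℂ E) (x : ℝ) :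
    Differentiable ℂ (kernel E x) := by
  rw [funext (kernel_ofReal_eq_dslope E x)]
  exact (differentiable_dslope (differentiable_kernelNum hE x) x).const_mul _

theorem sharp_kernelNum_ofReal (E : ℂ → ℂ) (x : ℝ) (z : ℂ) :
    conj (kernelNum E x (conj z)) = -kernelNum E x z := by
  rw [kernelNum_ofReal, kernelNum_ofReal]
  simp [sharp]

theorem eq_of_sub_mul_eq {f g : ℂ → ℂ} (hf : Differentiable ℂ f) (hg : Differentiable ℂ g) {a : ℂ}
    (h : ∀ z, (z - a) * f z = (z - a) * g z) : f = g :=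
  Continuous.ext_on (dense_compl_singleton a) hf.continuous hg.continuous fun z hz ↦
    mul_left_cancel₀ (sub_ne_zero.2 hz) (h z)

theorem sharp_kernel_ofReal (hE : Differentiable ℂ E) (x : ℝ) :
    sharp (kernel E x) = kernel E x := by
  apply eq_of_sub_mul_eq (a := x) (differentiable_sharp (differentiable_kernel hE x))
    (differentiable_kernel hE x)
  intro z
  have h := congrArg conj (sub_mul_kernel E x (conj z))
  rw [map_mul, map_mul, sharp_kernelNum_ofReal] at h
  rw [sub_mul_kernel, sharp]
  simpa [Complex.conj_ofNat] using h

/-- One estimate for two uses: in the upper half-plane it controls bounded type and mean type, and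
on the real line, where `‖E^*‖ = ‖E‖`, it gives square integrable decay. -/
theorem norm_sub_mul_kernel_le {x : ℝ} {z : ℂ} (h : ‖sharp E z‖ ≤ ‖E z‖) :
    ‖z - x‖ * ‖kernel E x z‖ ≤ ‖E x‖ * ‖E z‖ := by
  rw [← norm_mul, sub_mul_kernel, norm_mul, norm_neg, norm_inv]
  have h1 : ‖(2 * Real.pi * Complex.I : ℂ)‖ = 2 * Real.pi := by
    simp [abs_of_pos Real.pi_pos]
  have h2 : ‖kernelNum E x z‖ ≤ 2 * (‖E x‖ * ‖E z‖) := by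
    rw [kernelNum_ofReal]
    refine (norm_sub_le _ _).trans ?_
    rw [norm_mul, norm_mul, RCLike.norm_conj]
    have := mul_le_mul_of_nonneg_left h (norm_nonneg (E x))
    linarith
  have h3 : (2 * Real.pi)⁻¹ ≤ 2⁻¹ := by
    gcongr
    linarith [Real.pi_gt_three]
  rw [h1]
  calc (2 * Real.pi)⁻¹ * ‖kernelNum E x z‖ ≤ 2⁻¹ * (2 * (‖E x‖ * ‖E z‖)) := by gcongr
    _ = _ := by ring

/-- Real zeros of `E` are allowed. There both the kernel and all elements of the space vanish, so
the reproducing property survives. -/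
theorem kernel_eq_zero (hE : Differentiable ℂ E) {x : ℝ} (hx : E x = 0) : kernel E x = 0 := by
  apply eq_of_sub_mul_eq (a := x) (differentiable_kernel hE x) (differentiable_const 0)
  intro z
  rw [sub_mul_kernel, kernelNum_ofReal, hx]
  simp

theorem boundedType_kernel_div (hE : HermiteBiehler E) (x : ℝ) :
    BoundedType fun z ↦ kernel E x z / E z := by
  have h : BoundedType fun z ↦ (-(2 * Real.pi * Complex.I)⁻¹ * kernelNum E x z) / E z := by
    apply boundedType_of_bounded (C := ‖E x‖ * 1)
    · exact ((differentiable_kernelNum hE.1 x).const_mul _).differentiableOn.div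
        hE.1.differentiableOn fun z hz ↦ hE.ne_zero hz
    · intro z hz
      rw [norm_div, ← sub_mul_kernel, norm_mul, mul_one,
        div_le_iff₀ (norm_pos_iff.2 (hE.ne_zero hz))]
      exact norm_sub_mul_kernel_le (hE.norm_sharp_le hz)
  refine (h.mul (boundedType_inv_sub x)).congr fun z hz ↦ ?_
  rw [← sub_mul_kernel]
  have := sub_ofReal_ne_zero hz x
  field_simp

theorem norm_sub_ofReal_ge {y : ℝ} (hy : 1 ≤ y) (x : ℝ) : 1 ≤ ‖(y : ℂ) * Complex.I - x‖ := by
  have h2 := Complex.abs_im_le_norm ((y : ℂ) * Complex.I - x)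
  have h1 : ((y : ℂ) * Complex.I - x).im = y := by simp
  rw [h1] at h2
  exact hy.trans ((le_abs_self y).trans h2)

theorem subexpOnImag_kernel_div (hE : HermiteBiehler E) (x : ℝ) :
    SubexpOnImag fun z ↦ kernel E x z / E z := by
  apply subexpOnImag_zero.of_le (C := ‖E x‖)
  intro y hy
  have hz := mul_I_mem_upperHalf (zero_lt_one.trans_le hy)
  have h1 := norm_sub_mul_kernel_le (x := x) (hE.norm_sharp_le hz)
  have h2 := norm_sub_ofReal_ge hy x
  rw [norm_zero, zero_add, mul_one, norm_div, div_le_iff₀ (norm_pos_iff.2 (hE.ne_zero hz))]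
  exact (le_mul_of_one_le_left (norm_nonneg _) h2).trans h1

/-- A function that is continuous at `x` and `O(1/|t - x|)` is `O((1 + (t - x) ^ 2)^{-1/2})`. -/
theorem exists_norm_sq_le_of_continuousAt {f : ℝ → ℂ} {x C : ℝ} (hf : ContinuousAt f x)
    (hC : ∀ t, |t - x| * ‖f t‖ ≤ C) : ∃ B : ℝ, ∀ t, ‖f t‖ ^ 2 ≤ B * (1 + (t - x) ^ 2)⁻¹ := by
  obtain ⟨δ, hδ, h⟩ := Metric.continuousAt_iff.1 hf 1 one_pos
  set M := ‖f x‖ + 1 with hM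
  have hM0 : 0 < M := by positivity
  refine ⟨C ^ 2 * (1 + (δ ^ 2)⁻¹) + M ^ 2 * (1 + δ ^ 2), fun t ↦ ?_⟩
  rw [← div_eq_mul_inv, le_div_iff₀ (by positivity)]
  rcases lt_or_ge |t - x| δ with ht | ht
  · have h1 : ‖f t‖ ≤ M := by
      have := h (Real.dist_eq t x ▸ ht)
      rw [dist_eq_norm] at this
      have h2 := norm_le_norm_add_norm_sub' (f t) (f x)
      linarith
    have h3 : (t - x) ^ 2 ≤ δ ^ 2 := sq_le_sq' (by linarith [(abs_lt.1 ht).1]) (abs_lt.1 ht).2.le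
    have h4 : 0 ≤ C ^ 2 * (1 + (δ ^ 2)⁻¹) := by positivity
    have h5 : ‖f t‖ ^ 2 * (1 + (t - x) ^ 2) ≤ M ^ 2 * (1 + δ ^ 2) := by gcongr
    linarith
  · have h1 : (|t - x| * ‖f t‖) ^ 2 ≤ C ^ 2 := by
      gcongr
      exact hC t
    rw [mul_pow, sq_abs] at h1
    have h2 : δ ^ 2 ≤ (t - x) ^ 2 := by
      rw [← sq_abs (t - x)]
      gcongr
    have h3 : 1 + (t - x) ^ 2 ≤ (1 + (δ ^ 2)⁻¹) * (t - x) ^ 2 := by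
      have : 1 ≤ (δ ^ 2)⁻¹ * (t - x) ^ 2 := by
        rw [inv_mul_eq_div, le_div_iff₀ (by positivity)]
        linarith
      linarith
    calc ‖f t‖ ^ 2 * (1 + (t - x) ^ 2) ≤ ‖f t‖ ^ 2 * ((1 + (δ ^ 2)⁻¹) * (t - x) ^ 2) := by gcongr
      _ = ((t - x) ^ 2 * ‖f t‖ ^ 2) * (1 + (δ ^ 2)⁻¹) := by ring
      _ ≤ C ^ 2 * (1 + (δ ^ 2)⁻¹) := by gcongr
      _ ≤ _ := le_add_of_nonneg_right (by positivity)

theorem integrable_inv_one_add_sub_sq (x : ℝ) : Integrable fun t : ℝ ↦ (1 + (t - x) ^ 2)⁻¹ :=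
  integrable_inv_one_add_sq.comp_sub_right x

theorem measurable_div_ofReal {f : ℂ → ℂ} (hf : Continuous f) (hE : Continuous E) :
    Measurable fun t : ℝ ↦ f t / E t :=
  (hf.measurable.comp Complex.measurable_ofReal).div (hE.measurable.comp Complex.measurable_ofReal)

theorem normSq_lt_top_iff {f : ℂ → ℂ} (hf : Continuous f) (hE : Continuous E) :
    normSq E f < ⊤ ↔ MemLp (fun t : ℝ ↦ f t / E t) 2 := by
  rw [memLp_two_iff_integrable_sq_norm (measurable_div_ofReal hf hE).aestronglyMeasurable,
    Integrable, hasFiniteIntegral_iff_enorm]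
  have h : ∀ t : ℝ, ‖‖f t / E t‖ ^ 2‖ₑ = ‖f t / E t‖ₑ ^ 2 := fun t ↦ by
    rw [enorm_pow, enorm_norm]
  simp_rw [h]
  rw [and_iff_right]
  · rfl
  · exact ((measurable_div_ofReal hf hE).norm.pow_const 2).aestronglyMeasurable

theorem continuousAt_div_ofReal {f : ℂ → ℂ} (hf : Continuous f) (hE : Continuous E) {x : ℝ}
    (hx : E x ≠ 0) : ContinuousAt (fun t : ℝ ↦ f t / E t) x :=
  (hf.comp Complex.continuous_ofReal).continuousAt.div
    (hE.comp Complex.continuous_ofReal).continuousAt hx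

theorem memLp_kernel_div (hE : HermiteBiehler E) (x : ℝ) :
    MemLp (fun t : ℝ ↦ kernel E x t / E t) 2 := by
  by_cases hx : E x = 0
  · simp [kernel_eq_zero hE.1 hx]
  have hK := (differentiable_kernel hE.1 x).continuous
  rw [memLp_two_iff_integrable_sq_norm (measurable_div_ofReal hK hE.1.continuous).aestronglyMeasurable]
  -- Where `E t = 0` the quotient is `0` by convention, so the bound holds at every real `t`.
  have hC : ∀ t : ℝ, |t - x| * ‖kernel E x t / E t‖ ≤ ‖E x‖ := fun t ↦ by
    rw [norm_div, ← mul_div_assoc]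
    apply div_le_of_le_mul₀ (norm_nonneg _) (norm_nonneg _)
    have := norm_sub_mul_kernel_le (E := E) (x := x) (z := t)
      (by rw [sharp_ofReal, RCLike.norm_conj])
    rwa [← Complex.ofReal_sub, Complex.norm_real, Real.norm_eq_abs] at this
  obtain ⟨B, hB⟩ := exists_norm_sq_le_of_continuousAt
    (continuousAt_div_ofReal hK hE.1.continuous hx) hC
  apply ((integrable_inv_one_add_sub_sq x).const_mul B).mono'
  · exact ((measurable_div_ofReal hK hE.1.continuous).norm.pow_const 2).aestronglyMeasurable
  · filter_upwards with t
    rw [Real.norm_of_nonneg (by positivity)]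
    exact hB t

theorem kernel_mem_space (hE : HermiteBiehler E) (x : ℝ) : kernel E x ∈ space E := by
  have hd := differentiable_kernel hE.1 x
  have hb := boundedType_kernel_div hE x
  have hm := meanType_nonpos_iff.2 (subexpOnImag_kernel_div hE x)
  refine ⟨hd, ?_, hb, hm, ?_, ?_⟩
  · exact (normSq_lt_top_iff hd.continuous hE.1.continuous).2 (memLp_kernel_div hE x)
  · rwa [sharp_kernel_ofReal hE.1]
  · rwa [sharp_kernel_ofReal hE.1]

theorem memLp_of_mem_space (hE : Continuous E) {f : ℂ → ℂ} (hf : f ∈ space E) :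
    MemLp (fun t : ℝ ↦ f t / E t) 2 :=
  (normSq_lt_top_iff hf.1.continuous hE).1 hf.2.1

theorem boundedType_smul_div {f : ℂ → ℂ} (c : ℂ) (h : BoundedType fun z ↦ f z / E z) :
    BoundedType fun z ↦ (c • f) z / E z :=
  ((boundedType_const c).mul h).congr fun z _ ↦ by simp [mul_div_assoc]

theorem subexpOnImag_smul_div {f : ℂ → ℂ} (c : ℂ) (h : SubexpOnImag fun z ↦ f z / E z) :
    SubexpOnImag fun z ↦ (c • f) z / E z := by
  apply h.of_le (C := ‖c‖)
  intro y _
  rw [Pi.smul_apply, smul_eq_mul, mul_div_assoc, norm_mul]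
  gcongr
  linarith

theorem smul_mem_space (hE : Continuous E) {f : ℂ → ℂ} (c : ℂ) (hf : f ∈ space E) :
    c • f ∈ space E := by
  have hL := (memLp_of_mem_space hE hf).const_mul c
  obtain ⟨h1, h2, h3, h4, h5, h6⟩ := hf
  have hs : sharp (c • f) = conj c • sharp f := by ext z; simp [sharp]
  rw [meanType_nonpos_iff] at h4 h6
  have hd : Differentiable ℂ (c • f) := h1.const_smul c
  refine ⟨hd, ?_, boundedType_smul_div c h3, meanType_nonpos_iff.2 (subexpOnImag_smul_div c h4),
    ?_, ?_⟩
  · rw [normSq_lt_top_iff hd.continuous hE]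
    convert hL using 2
    simp [mul_div_assoc]
  · rw [hs]; exact boundedType_smul_div _ h5
  · rw [hs]; exact meanType_nonpos_iff.2 (subexpOnImag_smul_div _ h6)

end DeBranges

/-! ### The reproducing property at real points. -/

namespace DeBranges

open Filter Topology MeasureTheory

variable {E f : ℂ → ℂ}

theorem HermiteBiehler.eventually_ne_zero (hE : HermiteBiehler E) (z : ℂ) :
    ∀ᶠ w in 𝓝[≠] z, E w ≠ 0 := by
  refine ((hE.1.analyticAt z).eventually_eq_zero_or_eventually_ne_zero).resolve_left fun h ↦ ?_
  have hEa : AnalyticOnNhd ℂ E Set.univ := fun w _ ↦ hE.1.analyticAt w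
  have := hEa.eqOn_zero_of_preconnected_of_eventuallyEq_zero isPreconnected_univ (Set.mem_univ z) h
  exact hE.ne_zero (z := Complex.I) (by simp [upperHalf]) (this (Set.mem_univ _))

/-- Elements of `H(E)` vanish at the real zeros of `E`. -/
theorem eq_zero_of_mem_space (hE : HermiteBiehler E) (hf : f ∈ space E) {x : ℝ} (hx : E x = 0) :
    f x = 0 := by
  have hm : MeromorphicAt (fun z ↦ f z / E z) x :=
    (hf.1.analyticAt x).meromorphicAt.div (hE.1.analyticAt x).meromorphicAt
  have hI : IntervalIntegrable (fun t : ℝ ↦ f t / E t) volume (x - 1) (x + 1) := by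
    rw [intervalIntegrable_iff, Set.uIoc_of_le (by linarith)]
    exact ((memLp_of_mem_space hE.1.continuous hf).mono_measure Measure.restrict_le_self).integrable
      one_le_two
  -- Without a pole, `f / E` has a finite limit at `x`; multiplying by `E`, which tends to `0`,
  -- forces `f x = 0`.
  have ho := meromorphicOrderAt_nonneg_of_intervalIntegrable hm (a := x - 1) (b := x + 1)
    (by linarith) (by rw [Set.uIcc_of_le (by linarith)]; constructor <;> linarith) hI
  obtain ⟨c, hc⟩ := tendsto_nhds_of_meromorphicOrderAt_nonneg hm ho
  have h1 : Tendsto (fun z ↦ f z / E z * E z) (𝓝[≠] (x : ℂ)) (𝓝 (c * E x)) :=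
    hc.mul (hE.1.continuous.continuousAt.tendsto.mono_left nhdsWithin_le_nhds)
  rw [hx, mul_zero] at h1
  have h2 : Tendsto f (𝓝[≠] (x : ℂ)) (𝓝 0) := by
    refine h1.congr' ?_
    filter_upwards [hE.eventually_ne_zero x] with z hz
    exact div_mul_cancel₀ _ hz
  exact tendsto_nhds_unique (hf.1.continuous.continuousAt.tendsto.mono_left nhdsWithin_le_nhds) h2

/-- Near `x` continuity bounds `u`; away from `x`, `k t / |t - x|` is bounded by `k t ^ 2 + 1 / (t -
x) ^ 2`. For square integrable `k` the majorant is integrable. -/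
theorem exists_norm_le_of_continuousAt {u : ℝ → ℂ} {k : ℝ → ℝ} {x C : ℝ} (hu : ContinuousAt u x)
    (hC : ∀ t, |t - x| * ‖u t‖ ≤ C * k t) :
    ∃ B : ℝ, ∀ t, ‖u t‖ ≤ B * (k t ^ 2 + (1 + (t - x) ^ 2)⁻¹) := by
  obtain ⟨δ, hδ, h⟩ := Metric.continuousAt_iff.1 hu 1 one_pos
  set M := ‖u x‖ + 1 with hM
  have hM0 : 0 < M := by positivity
  set A := 1 + (δ ^ 2)⁻¹ with hA
  have hA1 : 1 ≤ A := le_add_of_nonneg_right (by positivity)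
  refine ⟨M * (1 + δ ^ 2) + |C| * A, fun t ↦ ?_⟩
  rcases lt_or_ge |t - x| δ with ht | ht
  · have h1 : ‖u t‖ ≤ M := by
      have := h (Real.dist_eq t x ▸ ht)
      rw [dist_eq_norm] at this
      have h2 := norm_le_norm_add_norm_sub' (u t) (u x)
      linarith
    have h3 : (t - x) ^ 2 ≤ δ ^ 2 := sq_le_sq' (by linarith [(abs_lt.1 ht).1]) (abs_lt.1 ht).2.le
    calc ‖u t‖ ≤ M * 1 := by rwa [mul_one]
      _ ≤ M * ((1 + δ ^ 2) * (1 + (t - x) ^ 2)⁻¹) := by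
        gcongr
        rw [← div_eq_mul_inv, one_le_div (by positivity)]
        linarith
      _ = M * (1 + δ ^ 2) * (1 + (t - x) ^ 2)⁻¹ := by ring
      _ ≤ (M * (1 + δ ^ 2) + |C| * A) * (k t ^ 2 + (1 + (t - x) ^ 2)⁻¹) := by
        gcongr
        · exact le_add_of_nonneg_right (by positivity)
        · exact le_add_of_nonneg_left (by positivity)
  · have hs : 0 < |t - x| := hδ.trans_le ht
    have h2 : δ ^ 2 ≤ (t - x) ^ 2 := by
      rw [← sq_abs (t - x)]
      gcongr
    have h3 : (|t - x|⁻¹) ^ 2 ≤ A * (1 + (t - x) ^ 2)⁻¹ := by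
      have hp : 0 < (t - x) ^ 2 := lt_of_lt_of_le (by positivity) h2
      rw [inv_pow, sq_abs, ← div_eq_mul_inv, le_div_iff₀ (by positivity), mul_add, mul_one,
        inv_mul_cancel₀ hp.ne', add_comm, hA]
      gcongr
    have h4 : ‖u t‖ ≤ |C| * (|k t| * |t - x|⁻¹) := by
      rw [← mul_assoc, ← div_eq_mul_inv, le_div_iff₀ hs, mul_comm, ← abs_mul]
      exact (hC t).trans (le_abs_self _)
    have h5 : |k t| * |t - x|⁻¹ ≤ k t ^ 2 + (|t - x|⁻¹) ^ 2 := by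
      have := two_mul_le_add_sq |k t| |t - x|⁻¹
      rw [sq_abs] at this
      have : 0 ≤ |k t| * |t - x|⁻¹ := by positivity
      linarith
    have h6 : k t ^ 2 + (|t - x|⁻¹) ^ 2 ≤ A * (k t ^ 2 + (1 + (t - x) ^ 2)⁻¹) := by
      have : k t ^ 2 ≤ A * k t ^ 2 := le_mul_of_one_le_left (sq_nonneg _) hA1
      linarith
    calc ‖u t‖ ≤ |C| * (A * (k t ^ 2 + (1 + (t - x) ^ 2)⁻¹)) :=
          h4.trans (mul_le_mul_of_nonneg_left (h5.trans h6) (abs_nonneg C))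
      _ = |C| * A * (k t ^ 2 + (1 + (t - x) ^ 2)⁻¹) := by ring
      _ ≤ _ := by
        gcongr
        exact le_add_of_nonneg_left (by positivity)

theorem norm_ofReal_sub_add_I_sq (x t : ℝ) : ‖((t : ℂ) - x + Complex.I)‖ ^ 2 = 1 + (t - x) ^ 2 := by
  rw [Complex.sq_norm, Complex.normSq_apply]
  simp
  ring

theorem ofReal_sub_add_I_ne_zero (x t : ℝ) : (t : ℂ) - x + Complex.I ≠ 0 := by
  intro h
  have := norm_ofReal_sub_add_I_sq x t
  rw [h, norm_zero] at this
  nlinarith [sq_nonneg (t - x)]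

/-- The numerator of `(E(x) f(z) / E(z) - f(x) i / (z - x + i)) / (z - x)`. -/
noncomputable def cauchyNum (E f : ℂ → ℂ) (x : ℝ) : ℂ → ℂ :=
  dslope (fun z ↦ E x * f z * (z - x + Complex.I) - Complex.I * f x * E z) x

theorem sub_mul_cauchyNum (E f : ℂ → ℂ) (x : ℝ) (z : ℂ) : (z - x) * cauchyNum E f x z =
    E x * f z * (z - x + Complex.I) - Complex.I * f x * E z := by
  have := sub_smul_dslope
    (fun z ↦ E x * f z * (z - x + Complex.I) - Complex.I * f x * E z) (x : ℂ) z
  rw [smul_eq_mul] at this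
  rw [cauchyNum, this]
  ring

theorem differentiable_cauchyNum (hE : Differentiable ℂ E) (hf : Differentiable ℂ f) (x : ℝ) :
    Differentiable ℂ (cauchyNum E f x) :=
  differentiable_dslope (by fun_prop) _

theorem sub_mul_cauchyNum_div {x : ℝ} {z : ℂ} (hz : E z ≠ 0) (hzx : z - x + Complex.I ≠ 0) :
    (z - x) * (cauchyNum E f x z / (E z * (z - x + Complex.I))) =
      E x * (f z / E z) - f x * Complex.I * (z - x + Complex.I)⁻¹ := by
  rw [← mul_div_assoc, sub_mul_cauchyNum]
  field_simp

theorem cauchyNum_div {x : ℝ} {z : ℂ} (hz : E z ≠ 0) (hzx : z - x + Complex.I ≠ 0)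
    (hx : z - x ≠ 0) : cauchyNum E f x z / (E z * (z - x + Complex.I)) =
      (E x * (f z / E z) - f x * Complex.I * (z - x + Complex.I)⁻¹) * (z - x)⁻¹ := by
  rw [← sub_mul_cauchyNum_div hz hzx]
  field_simp

theorem boundedType_cauchyNum_div (hE : HermiteBiehler E) (hf : f ∈ space E) (x : ℝ) :
    BoundedType fun z ↦ cauchyNum E f x z / (E z * (z - x + Complex.I)) := by
  have h := (((boundedType_const (E x)).mul hf.2.2.1).add
    ((boundedType_const (-(f x * Complex.I))).mul (boundedType_inv_add_I x))).mul
    (boundedType_inv_sub x)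
  refine h.congr fun z hz ↦ ?_
  rw [cauchyNum_div (hE.ne_zero hz) (sub_ofReal_add_I_ne_zero hz x) (sub_ofReal_ne_zero hz x)]
  ring

theorem subexpOnImag_cauchyNum_div (hE : HermiteBiehler E) (hf : f ∈ space E) (x : ℝ) :
    SubexpOnImag fun z ↦ cauchyNum E f x z / (E z * (z - x + Complex.I)) := by
  apply (meanType_nonpos_iff.1 hf.2.2.2.1).of_le (C := ‖E x‖ + ‖f x‖)
  intro y hy
  have hz := mul_I_mem_upperHalf (zero_lt_one.trans_le hy)
  rw [cauchyNum_div (hE.ne_zero hz) (sub_ofReal_add_I_ne_zero hz x) (sub_ofReal_ne_zero hz x),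
    norm_mul, norm_inv]
  have h1 : ‖(y : ℂ) * Complex.I - x‖⁻¹ ≤ 1 := inv_le_one_of_one_le₀ (norm_sub_ofReal_ge hy x)
  have h2 : ‖(y : ℂ) * Complex.I - x + Complex.I‖⁻¹ ≤ 1 := inv_le_one_of_one_le₀ (add_I_norm_ge hz x)
  have h3 : ‖E x * (f (y * Complex.I) / E (y * Complex.I)) -
      f x * Complex.I * ((y : ℂ) * Complex.I - x + Complex.I)⁻¹‖ ≤
      ‖E x‖ * ‖f (y * Complex.I) / E (y * Complex.I)‖ + ‖f x‖ := by
    refine (norm_sub_le _ _).trans ?_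
    rw [norm_mul, norm_mul, norm_mul, Complex.norm_I, mul_one, norm_inv]
    gcongr
    exact mul_le_of_le_one_right (norm_nonneg _) h2
  refine (mul_le_of_le_one_right (norm_nonneg _) h1).trans (h3.trans ?_)
  have h4 := norm_nonneg (f x)
  have h5 := norm_nonneg (E x)
  have h6 := norm_nonneg (f (y * Complex.I) / E (y * Complex.I))
  nlinarith

theorem integrable_cauchyNum_div (hE : HermiteBiehler E) (hf : f ∈ space E) {x : ℝ}
    (hx : E x ≠ 0) :
    Integrable fun t : ℝ ↦ cauchyNum E f x t / (E t * (t - x + Complex.I)) := by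
  have hd := differentiable_cauchyNum hE.1 hf.1 x
  have hc : Continuous fun z : ℂ ↦ E z * (z - x + Complex.I) := by
    have := hE.1.continuous
    fun_prop
  have hL := memLp_of_mem_space hE.1.continuous hf
  set k : ℝ → ℝ := fun t ↦ ‖f t / E t‖ + ‖((t : ℂ) - x + Complex.I)⁻¹‖ with hk
  have hC : ∀ t : ℝ, |t - x| * ‖cauchyNum E f x t / (E t * (t - x + Complex.I))‖ ≤
      (‖E x‖ + ‖f x‖) * k t := by
    intro t
    by_cases ht : E t = 0
    · rw [ht, zero_mul, div_zero, norm_zero, mul_zero]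
      positivity
    rw [← Real.norm_eq_abs, ← Complex.norm_real, ← norm_mul, Complex.ofReal_sub,
      sub_mul_cauchyNum_div ht (ofReal_sub_add_I_ne_zero x t)]
    refine (norm_sub_le _ _).trans ?_
    rw [norm_mul, norm_mul, norm_mul, Complex.norm_I, mul_one, hk]
    have h4 := norm_nonneg (f x)
    have h5 := norm_nonneg (E x)
    have h6 := norm_nonneg (f t / E t)
    have h7 := norm_nonneg ((t : ℂ) - x + Complex.I)⁻¹
    nlinarith [mul_nonneg h5 h7, mul_nonneg h4 h6]
  obtain ⟨B, hB⟩ := exists_norm_le_of_continuousAt (continuousAt_div_ofReal hd.continuous hc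
    (mul_ne_zero hx (ofReal_sub_add_I_ne_zero x x))) hC
  have hk2 : Integrable fun t : ℝ ↦ 2 * (‖f t / E t‖ ^ 2 + (1 + (t - x) ^ 2)⁻¹) +
      (1 + (t - x) ^ 2)⁻¹ :=
    (((memLp_two_iff_integrable_sq_norm hL.1).1 hL |>.add
      (integrable_inv_one_add_sub_sq x)).const_mul 2).add (integrable_inv_one_add_sub_sq x)
  apply (hk2.const_mul |B|).mono' (measurable_div_ofReal hd.continuous hc).aestronglyMeasurable
  filter_upwards with t
  refine (hB t).trans ?_
  have h1 : k t ^ 2 ≤ 2 * (‖f t / E t‖ ^ 2 + (1 + (t - x) ^ 2)⁻¹) := by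
    refine (add_sq_le).trans_eq ?_
    rw [norm_inv, inv_pow, norm_ofReal_sub_add_I_sq]
  gcongr
  exact le_abs_self B

/-- The subtracted term `i / (z - x + i)` equals `1` at `x`, which cancels the singularity of the
Cauchy quotient there. Its only pole, `x - i`, lies in the lower half-plane, and its decay makes the
quotient integrable. -/
theorem integral_cauchyNum_div (hE : HermiteBiehler E) (hf : f ∈ space E) {x : ℝ}
    (hx : E x ≠ 0) : ∫ t : ℝ, cauchyNum E f x t / (E t * (t - x + Complex.I)) = 0 := by
  have hE1 := hE.1
  exact integral_div_eq_zero (N := cauchyNum E f x) (D := fun z ↦ E z * (z - x + Complex.I))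
    (differentiable_cauchyNum hE.1 hf.1 x) (by fun_prop)
    (fun z hz ↦ mul_ne_zero (hE.ne_zero hz) (sub_ofReal_add_I_ne_zero hz x))
    (boundedType_cauchyNum_div hE hf x) (subexpOnImag_cauchyNum_div hE hf x)
    (integrable_cauchyNum_div hE hf hx)

theorem integral_inv_one_add_sub_sq (x : ℝ) : ∫ t : ℝ, (1 + (t - x) ^ 2)⁻¹ = Real.pi := by
  rw [integral_sub_right_eq_self (fun t : ℝ ↦ (1 + t ^ 2)⁻¹) x, integral_univ_inv_one_add_sq]

/-- The two terms of the kernel give one Cauchy quotient for `f` and the conjugate of one for `f^*`.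
The compensating terms combine, since `i / (s + i) + i / (s - i) = 2 i s / (1 + s²)` with `s = t -
x`, and leave a Poisson kernel. Only the latter survives integration. -/
theorem mul_conj_kernel_div (f : ℂ → ℂ) {x t : ℝ} (ht : E t ≠ 0)
    (htx : t ≠ x) : f t * conj (kernel E x t) / ((‖E t‖ ^ 2 : ℝ) : ℂ) =
      (2 * Real.pi * Complex.I)⁻¹ * (cauchyNum E f x t / (E t * (t - x + Complex.I)) -
        conj (cauchyNum E (sharp f) x t / (E t * (t - x + Complex.I))) +
        2 * Complex.I * f x * ((1 + (t - x) ^ 2)⁻¹ : ℝ)) := by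
  have hs : (t : ℂ) - x ≠ 0 := by
    rw [← Complex.ofReal_sub]
    exact_mod_cast sub_ne_zero.2 htx
  have h1 := ofReal_sub_add_I_ne_zero x t
  have h1' : (t : ℂ) - x - Complex.I ≠ 0 := by
    have := (map_ne_zero conj).2 h1
    simpa [← sub_eq_add_neg] using this
  have hK : kernel E x t = -(2 * Real.pi * Complex.I)⁻¹ *
      (conj (E x) * E t - E x * conj (E t)) * ((t : ℂ) - x)⁻¹ := by
    have := sub_mul_kernel E x t
    rw [kernelNum_ofReal, sharp_ofReal] at this
    rw [← this]
    field_simp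
  have hct : conj (E t) ≠ 0 := (map_ne_zero conj).2 ht
  have hn : ((‖E t‖ ^ 2 : ℝ) : ℂ) = E t * conj (E t) := by
    rw [Complex.mul_conj, Complex.normSq_eq_norm_sq]
  have hq : (((1 + (t - x) ^ 2)⁻¹ : ℝ) : ℂ) =
      ((t - x + Complex.I) * ((t : ℂ) - x - Complex.I))⁻¹ := by
    push_cast
    congr 1
    linear_combination Complex.I_sq
  have hpi : (Real.pi : ℂ) ≠ 0 := by exact_mod_cast Real.pi_ne_zero
  have hI := Complex.I_ne_zero
  rw [cauchyNum_div ht h1 hs, cauchyNum_div ht h1 hs, hK, hn, hq, sharp_ofReal, sharp_ofReal]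
  simp only [map_mul, map_sub, map_add, map_neg, map_inv₀, map_div₀, Complex.conj_conj,
    Complex.conj_ofReal, Complex.conj_I, Complex.conj_ofNat, ← sub_eq_add_neg]
  field_simp
  ring_nf

/-- The reproducing property of the kernel at real points. -/
theorem inner_kernel (hE : HermiteBiehler E) (hf : f ∈ space E) (x : ℝ) :
    inner E f (kernel E x) = f x := by
  by_cases hx : E x = 0
  · rw [kernel_eq_zero hE.1 hx, eq_zero_of_mem_space hE hf hx]
    simp [inner]
  have hf' := sharp_mem_space hf
  have hi := integrable_cauchyNum_div hE hf hx
  have hi' := integrable_cauchyNum_div hE hf' hx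
  have h0 := integral_cauchyNum_div hE hf hx
  have h0' := integral_cauchyNum_div hE hf' hx
  have hic : Integrable fun t : ℝ ↦ conj (cauchyNum E (sharp f) x t / (E t * (t - x + Complex.I))) :=
    (LinearIsometryEquiv.integrable_comp_iff (Complex.conjLIE)).2 hi'
  have h3 : Integrable fun t : ℝ ↦ 2 * Complex.I * f x * (((1 + (t - x) ^ 2)⁻¹ : ℝ) : ℂ) :=
    ((integrable_inv_one_add_sub_sq x).ofReal (𝕜 := ℂ)).const_mul (2 * Complex.I * f x)
  have hpi : (Real.pi : ℂ) ≠ 0 := by exact_mod_cast Real.pi_ne_zero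
  have hae : ∀ᵐ t : ℝ, t ≠ x := by
    simp [ae_iff]
  rw [inner]
  calc _ = ∫ t : ℝ, (2 * Real.pi * Complex.I)⁻¹ *
        (cauchyNum E f x t / (E t * (t - x + Complex.I)) -
        conj (cauchyNum E (sharp f) x t / (E t * (t - x + Complex.I))) +
        2 * Complex.I * f x * ((1 + (t - x) ^ 2)⁻¹ : ℝ)) := by
        apply integral_congr_ae
        filter_upwards [hE.ae_ne_zero, hae] with t ht htx
        exact mul_conj_kernel_div f ht htx
    _ = (2 * Real.pi * Complex.I)⁻¹ * (2 * Complex.I * f x * Real.pi) := by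
        rw [integral_const_mul, integral_add (by exact hi.sub hic) h3, integral_sub hi hic, h0,
          integral_conj, h0', integral_const_mul]
        have h4 : ∫ t : ℝ, (((1 + (t - x) ^ 2)⁻¹ : ℝ) : ℂ) = Real.pi := by
          rw [integral_complex_ofReal, integral_inv_one_add_sub_sq]
        rw [h4]
        simp
    _ = f x := by
        field_simp

end DeBranges

/-! ### Orthogonality from Cauchy's theorem and from the phase condition. -/

namespace DeBranges

open Filter Topology MeasureTheory

variable {E F f g : ℂ → ℂ}

/-- Each of `f^*/E` and `g/F` is of bounded type, of nonpositive mean type and square integrable, so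
their product meets the hypotheses of Cauchy's theorem. -/
theorem integral_sharp_mul_div (hE : HermiteBiehler E) (hF : HermiteBiehler F) (hf : f ∈ space E)
    (hg : g ∈ space F) : ∫ t : ℝ, (sharp f * g) t / (E * F) t = 0 := by
  have hs := sharp_mem_space hf
  have h : ∀ z, (sharp f * g) z / (E * F) z = sharp f z / E z * (g z / F z) := fun z ↦ by
    rw [Pi.mul_apply, Pi.mul_apply, mul_div_mul_comm]
  apply integral_div_eq_zero (hs.1.mul hg.1) (hE.1.mul hF.1)
  · exact fun z hz ↦ mul_ne_zero (hE.ne_zero hz) (hF.ne_zero hz)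
  · simp_rw [h]
    exact hs.2.2.1.mul hg.2.2.1
  · simp_rw [h]
    exact (meanType_nonpos_iff.1 hs.2.2.2.1).mul (meanType_nonpos_iff.1 hg.2.2.2.1)
  · simp_rw [h]
    exact (memLp_of_mem_space hE.1.continuous hs).integrable_mul
      (memLp_of_mem_space hF.1.continuous hg)

/-- Reality of `G e^{iφ}` gives `conj G = G e^{2iφ}`, and at the sampling points the factor
`e^{2iφ}` does not depend on `n`. Hence the kernel numerator vanishes at two distinct sampling
points. -/
theorem conj_eq_of_isPhaseFunction {G : ℂ → ℂ} {φ : ℝ → ℝ} (hφ : IsPhaseFunction G φ) {α x : ℝ}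
    {n : ℤ} (hx : φ x = n * Real.pi + α) :
    conj (G x) = G x * Complex.exp (2 * Complex.I * α) := by
  have h1 := hφ.2.2 x
  rw [← Complex.conj_eq_iff_im, map_mul, ← Complex.exp_conj, map_mul, Complex.conj_I,
    Complex.conj_ofReal, hx] at h1
  have h2 : Complex.exp (2 * Complex.I * α) =
      Complex.exp (Complex.I * ((n * Real.pi + α : ℝ) : ℂ)) *
        Complex.exp (Complex.I * ((n * Real.pi + α : ℝ) : ℂ)) := by
    rw [← Complex.exp_add, Complex.exp_eq_exp_iff_exists_int]
    refine ⟨-n, ?_⟩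
    push_cast
    ring
  rw [h2, ← mul_assoc, ← h1, mul_assoc, ← Complex.exp_add, neg_mul, neg_add_cancel,
    Complex.exp_zero, mul_one]

theorem kernel_eq_zero_of_isPhaseFunction {G : ℂ → ℂ} {φ : ℝ → ℝ} (hφ : IsPhaseFunction G φ)
    {α x y : ℝ} {m n : ℤ} (hx : φ x = n * Real.pi + α) (hy : φ y = m * Real.pi + α) (hmn : n ≠ m) :
    kernel G x y = 0 := by
  have hxy : (y : ℂ) - x ≠ 0 := by
    rw [← Complex.ofReal_sub]
    refine Complex.ofReal_ne_zero.2 (sub_ne_zero.2 fun h ↦ hmn ?_)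
    rw [h, hx] at hy
    have := mul_right_cancel₀ Real.pi_ne_zero (add_right_cancel hy)
    exact_mod_cast this
  have h := sub_mul_kernel G x y
  rw [kernelNum_ofReal, sharp_ofReal, conj_eq_of_isPhaseFunction hφ hx,
    conj_eq_of_isPhaseFunction hφ hy] at h
  apply (mul_eq_zero.1 (h.trans ?_)).resolve_left hxy
  ring

end DeBranges

/-! ### Expansions and projections in an abstract Hilbert space. -/

section HilbertSpace

open scoped InnerProductSpace

variable {H ι : Type*} [NormedAddCommGroup H] [InnerProductSpace ℂ H]

theorem inner_eq_zero_of_mem_closure_span {S : Set H} {x y : H} (hx : ∀ w ∈ S, ⟪w, x⟫_ℂ = 0)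
    (hy : y ∈ (Submodule.span ℂ S).topologicalClosure) : ⟪y, x⟫_ℂ = 0 := by
  have h : (Submodule.span ℂ S).topologicalClosure ≤ (ℂ ∙ x)ᗮ := by
    apply Submodule.topologicalClosure_minimal _ _ (Submodule.isClosed_orthogonal _)
    rw [Submodule.span_le]
    exact fun w hw ↦ Submodule.mem_orthogonal_singleton_iff_inner_left.2 (hx w hw)
  exact Submodule.mem_orthogonal_singleton_iff_inner_left.1 (h hy)

/-- Expansion of an element of the closed span of a family of mutually orthogonal vectors, each of
norm one or zero. -/
theorem hasSum_inner_smul_of_mem_closure_span [CompleteSpace H] {e : ι → H}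
    (horth : Pairwise fun i j ↦ ⟪e i, e j⟫_ℂ = 0) (hnorm : ∀ i, e i ≠ 0 → ‖e i‖ = 1) {x : H}
    (hx : x ∈ (Submodule.span ℂ (Set.range e)).topologicalClosure) :
    HasSum (fun i ↦ ⟪e i, x⟫_ℂ • e i) x := by
  -- Vectors that are zero, such as kernels at real zeros, are discarded. The rest is extended to a
  -- Hilbert basis of the whole space; the added vectors are orthogonal to the closed span and so
  -- contribute nothing to the expansion of `x`.
  set s : Set ι := {i | e i ≠ 0}
  have hv : Orthonormal ℂ (fun i : s ↦ e i) :=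
    ⟨fun i ↦ hnorm i i.2, fun i j hij ↦ horth fun h ↦ hij (Subtype.ext h)⟩
  obtain ⟨w, b, hw, hb⟩ := hv.toSubtypeRange.exists_hilbertBasis_extension
  have hsum := b.hasSum_repr x
  simp_rw [b.repr_apply_apply, hb] at hsum
  let g : s → w := fun i ↦ ⟨e i, hw ⟨i, rfl⟩⟩
  have hg : Function.Injective g := fun i j hij ↦ hv.linearIndependent.injective (congrArg Subtype.val hij)
  have hzero : ∀ i ∉ Set.range g, ⟪(i : H), x⟫_ℂ • (i : H) = 0 := by
    intro i hi
    rw [← inner_conj_symm, inner_eq_zero_of_mem_closure_span _ hx, map_zero, zero_smul]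
    rintro _ ⟨j, rfl⟩
    by_cases hj : e j = 0
    · rw [hj, inner_zero_left]
    · have hne : g ⟨j, hj⟩ ≠ i := fun h ↦ hi ⟨_, h⟩
      have := b.orthonormal.2 hne
      rwa [hb] at this
  rw [← hg.hasSum_iff hzero] at hsum
  refine (hasSum_subtype_iff_of_support_subset (s := s) ?_).1 hsum
  intro i hi h0
  exact hi (by simp [h0])

theorem hasSum_norm_inner_sq {e : ι → H} {x : H} (h : HasSum (fun i ↦ ⟪e i, x⟫_ℂ • e i) x) :
    HasSum (fun i ↦ ‖⟪e i, x⟫_ℂ‖ ^ 2) (‖x‖ ^ 2) := by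
  have h1 := Complex.hasSum_re ((innerSL ℂ x).hasSum h)
  convert h1 using 1
  · ext i
    rw [innerSL_apply_apply, inner_smul_right, ← inner_conj_symm x, Complex.mul_conj,
      Complex.normSq_eq_norm_sq, Complex.ofReal_re]
  · rw [innerSL_apply_apply, inner_self_eq_norm_sq_to_K]
    norm_cast

/-- If `v i` is the orthogonal projection of `e i` to the closed span of `S`, and `x` is orthogonal
to `S`, then the expansion of `x` in the system `e` projects to zero. -/
theorem hasSum_inner_smul_zero [CompleteSpace H] {S : Set H} {e v : ι → H} {x : H}
    (hx : HasSum (fun i ↦ ⟪e i, x⟫_ℂ • e i) x) (hv : ∀ i, v i ∈ S)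
    (hev : ∀ i, ∀ w ∈ S, ⟪v i, w⟫_ℂ = ⟪e i, w⟫_ℂ) (hxS : ∀ w ∈ S, ⟪w, x⟫_ℂ = 0) :
    HasSum (fun i ↦ ⟪e i, x⟫_ℂ • v i) 0 := by
  set W := (Submodule.span ℂ S).topologicalClosure with hW
  have : CompleteSpace W := (Submodule.isClosed_topologicalClosure _).completeSpace_coe
  have hSW : S ⊆ W := Submodule.subset_span.trans (Submodule.le_topologicalClosure _)
  have hP : ∀ i, W.starProjection (e i) = v i := by
    intro i
    apply (Submodule.eq_starProjection_of_mem_of_inner_eq_zero (hSW (hv i)) _)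
    intro w hw
    rw [← inner_conj_symm, inner_eq_zero_of_mem_closure_span _ hw, map_zero]
    intro w hw
    rw [← inner_conj_symm, inner_sub_left, hev i w hw, sub_self, map_zero]
  have hPx : W.starProjection x = 0 := by
    apply Submodule.eq_starProjection_of_mem_of_inner_eq_zero (Submodule.zero_mem _)
    intro w hw
    rw [sub_zero, ← inner_conj_symm, inner_eq_zero_of_mem_closure_span hxS hw, map_zero]
  have := W.starProjection.hasSum hx
  simpa only [map_smul, hP, hPx] using this

end HilbertSpace

/-! ### Embedding into `L²` and the frames attached to isometric multipliers. -/

namespace DeBranges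

open Filter Topology MeasureTheory
open scoped InnerProductSpace

variable {E F G f g : ℂ → ℂ}

/-- The condition that the norm of `f` relative to `E` is finite. -/
abbrev FiniteNorm (E f : ℂ → ℂ) : Prop := MemLp (fun t : ℝ ↦ f t / E t) 2

open Classical in
/-- The class of `f / E` in `L²(ℝ)`. -/
noncomputable def toL2 (E f : ℂ → ℂ) : Lp ℂ 2 (volume : Measure ℝ) :=
  if h : FiniteNorm E f then MemLp.toLp _ h else 0

theorem toL2_eq (h : FiniteNorm E f) : toL2 E f = MemLp.toLp _ h := dif_pos h

theorem coeFn_toL2 (h : FiniteNorm E f) : toL2 E f =ᵐ[volume] fun t : ℝ ↦ f t / E t := by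
  rw [toL2_eq h]
  exact h.coeFn_toLp

theorem enorm_toL2_sq (h : FiniteNorm E f) : ‖toL2 E f‖ₑ ^ 2 = normSq E f := by
  rw [toL2_eq h, Lp.enorm_toLp,
    eLpNorm_eq_lintegral_rpow_enorm_toReal two_ne_zero ENNReal.ofNat_ne_top, ← ENNReal.rpow_natCast,
    ← ENNReal.rpow_mul]
  simp [normSq]

theorem inner_eq_inner_toL2 (hf : FiniteNorm E f) (hg : FiniteNorm E g) :
    inner E f g = ⟪toL2 E g, toL2 E f⟫_ℂ := by
  rw [L2.inner_def, inner]
  apply integral_congr_ae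
  filter_upwards [coeFn_toL2 hf, coeFn_toL2 hg] with t h1 h2
  rw [h1, h2, RCLike.inner_apply, map_div₀, div_mul_div_comm, Complex.mul_conj,
    Complex.normSq_eq_norm_sq]

theorem finiteNorm_zero (E : ℂ → ℂ) : FiniteNorm E 0 := by
  simp [FiniteNorm]

theorem FiniteNorm.add (hf : FiniteNorm E f) (hg : FiniteNorm E g) : FiniteNorm E (f + g) := by
  convert MemLp.add hf hg using 1
  ext t
  simp [add_div]

theorem FiniteNorm.smul (c : ℂ) (hf : FiniteNorm E f) : FiniteNorm E (c • f) := by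
  simpa only [FiniteNorm, Pi.smul_apply, smul_eq_mul, mul_div_assoc] using MemLp.const_mul hf c

theorem FiniteNorm.sub (hf : FiniteNorm E f) (hg : FiniteNorm E g) : FiniteNorm E (f - g) := by
  convert MemLp.sub hf hg using 1
  ext t
  simp [sub_div]

theorem toL2_add (hf : FiniteNorm E f) (hg : FiniteNorm E g) :
    toL2 E (f + g) = toL2 E f + toL2 E g := by
  apply Lp.ext
  filter_upwards [coeFn_toL2 hf, coeFn_toL2 hg, coeFn_toL2 (hf.add hg),
    Lp.coeFn_add (toL2 E f) (toL2 E g)] with t h1 h2 h3 h4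
  rw [h3, h4, Pi.add_apply, Pi.add_apply, h1, h2, add_div]

theorem toL2_sub (hf : FiniteNorm E f) (hg : FiniteNorm E g) :
    toL2 E (f - g) = toL2 E f - toL2 E g := by
  apply Lp.ext
  filter_upwards [coeFn_toL2 hf, coeFn_toL2 hg, coeFn_toL2 (hf.sub hg),
    Lp.coeFn_sub (toL2 E f) (toL2 E g)] with t h1 h2 h3 h4
  rw [h3, h4, Pi.sub_apply, Pi.sub_apply, h1, h2, sub_div]

theorem toL2_smul (c : ℂ) (hf : FiniteNorm E f) : toL2 E (c • f) = c • toL2 E f := by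
  apply Lp.ext
  filter_upwards [coeFn_toL2 hf, coeFn_toL2 (hf.smul c),
    Lp.coeFn_smul c (toL2 E f)] with t h1 h3 h4
  rw [h3, h4, Pi.smul_apply, Pi.smul_apply, h1, smul_eq_mul, smul_eq_mul, mul_div_assoc]

theorem toL2_zero (E : ℂ → ℂ) : toL2 E 0 = 0 := by
  simpa using toL2_smul 0 (finiteNorm_zero E)

theorem finiteNorm_sum {ι : Type*} {u : ι → ℂ → ℂ} (hu : ∀ i, FiniteNorm E (u i)) (T : Finset ι) :
    FiniteNorm E (∑ i ∈ T, u i) :=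
  Finset.sum_induction _ (FiniteNorm E) (fun _ _ ↦ FiniteNorm.add) (finiteNorm_zero E) fun i _ ↦ hu i

theorem toL2_sum {ι : Type*} {u : ι → ℂ → ℂ} (hu : ∀ i, FiniteNorm E (u i)) (T : Finset ι) :
    toL2 E (∑ i ∈ T, u i) = ∑ i ∈ T, toL2 E (u i) := by
  classical
  induction T using Finset.induction_on with
  | empty => simp [toL2_zero]
  | insert i T hi ih =>
    rw [Finset.sum_insert hi, Finset.sum_insert hi, toL2_add (hu i) (finiteNorm_sum hu T), ih]

theorem HermiteBiehler.finiteNorm (hE : HermiteBiehler E) (hf : f ∈ space E) : FiniteNorm E f :=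
  memLp_of_mem_space hE.1.continuous hf

/-- The reproducing property applied to the kernel itself; it shows that the diagonal value is real
and nonnegative, so the square roots in the frames are genuine norms. -/
theorem inner_self_kernel (hG : HermiteBiehler G) (x : ℝ) :
    kernel G x x = ((‖toL2 G (kernel G x)‖ ^ 2 : ℝ) : ℂ) := by
  have h := hG.finiteNorm (kernel_mem_space hG x)
  rw [← inner_kernel hG (kernel_mem_space hG x) x, inner_eq_inner_toL2 h h,
    inner_self_eq_norm_sq_to_K]
  norm_cast

theorem sqrt_kernel_re (hG : HermiteBiehler G) (x : ℝ) :
    √(kernel G x x).re = ‖toL2 G (kernel G x)‖ := by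
  rw [inner_self_kernel hG, Complex.ofReal_re, Real.sqrt_sq (norm_nonneg _)]

/-- The normalized reproducing kernels, as elements of `L²(ℝ)`. -/
noncomputable def unitKernel (G : ℂ → ℂ) (x : ℝ) : Lp ℂ 2 (volume : Measure ℝ) :=
  ((√(kernel G x x).re : ℝ) : ℂ)⁻¹ • toL2 G (kernel G x)

theorem inner_unitKernel (hG : HermiteBiehler G) (hf : f ∈ space G) (x : ℝ) :
    ⟪unitKernel G x, toL2 G f⟫_ℂ = f x / (√(kernel G x x).re : ℝ) := by
  rw [unitKernel, inner_smul_left, ← inner_eq_inner_toL2 (hG.finiteNorm hf)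
    (hG.finiteNorm (kernel_mem_space hG x)), inner_kernel hG hf, map_inv₀, Complex.conj_ofReal,
    div_eq_inv_mul]

theorem norm_unitKernel (hG : HermiteBiehler G) {x : ℝ} (h : unitKernel G x ≠ 0) :
    ‖unitKernel G x‖ = 1 := by
  have h0 : toL2 G (kernel G x) ≠ 0 := fun h0 ↦ h (by rw [unitKernel, h0, smul_zero])
  rw [unitKernel, sqrt_kernel_re hG]
  exact norm_smul_inv_norm h0

theorem toL2_kernel (hG : HermiteBiehler G) (x : ℝ) :
    toL2 G (kernel G x) = ((√(kernel G x x).re : ℝ) : ℂ) • unitKernel G x := by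
  by_cases h0 : toL2 G (kernel G x) = 0
  · rw [unitKernel, h0, smul_zero, smul_zero]
  · rw [unitKernel, smul_inv_smul₀]
    rw [sqrt_kernel_re hG]
    exact_mod_cast norm_ne_zero_iff.2 h0

section Sampling

variable {ι : Type*} {lam : ι → ℝ}

theorem inner_unitKernel_of_ne (hG : HermiteBiehler G)
    (horth : Pairwise fun m n ↦ kernel G (lam m) (lam n) = 0) :
    Pairwise fun m n ↦ ⟪unitKernel G (lam m), unitKernel G (lam n)⟫_ℂ = 0 := by
  intro m n hmn
  change ⟪_, ((√(kernel G (lam n) (lam n)).re : ℝ) : ℂ)⁻¹ • toL2 G (kernel G (lam n))⟫_ℂ = 0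
  rw [inner_smul_right, inner_unitKernel hG (kernel_mem_space hG _), horth hmn.symm,
    zero_div, mul_zero]

theorem finiteNorm_of_mem_span_kernel (hG : HermiteBiehler G)
    (hg : g ∈ Submodule.span ℂ (Set.range fun n ↦ kernel G (lam n))) :
    FiniteNorm G g ∧ toL2 G g ∈ Submodule.span ℂ (Set.range fun n ↦ unitKernel G (lam n)) := by
  induction hg using Submodule.span_induction with
  | mem x hx =>
    obtain ⟨n, rfl⟩ := hx
    refine ⟨hG.finiteNorm (kernel_mem_space hG _), ?_⟩
    simp only
    rw [toL2_kernel hG]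
    exact Submodule.smul_mem _ _ (Submodule.subset_span ⟨n, rfl⟩)
  | zero => exact ⟨finiteNorm_zero G, by rw [toL2_zero]; exact Submodule.zero_mem _⟩
  | add x y _ _ hx hy =>
    exact ⟨hx.1.add hy.1, by rw [toL2_add hx.1 hy.1]; exact Submodule.add_mem _ hx.2 hy.2⟩
  | smul c x _ hx =>
    exact ⟨hx.1.smul c, by rw [toL2_smul c hx.1]; exact Submodule.smul_mem _ _ hx.2⟩

theorem toL2_mem_closure_span (hG : HermiteBiehler G)
    (hcomplete : IsCompleteSystem G fun n ↦ kernel G (lam n)) (hf : f ∈ space G) :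
    toL2 G f ∈ (Submodule.span ℂ (Set.range fun n ↦ unitKernel G (lam n))).topologicalClosure := by
  change toL2 G f ∈ closure _
  rw [EMetric.mem_closure_iff]
  intro ε hε
  obtain ⟨g, hg, hfg⟩ := hcomplete f hf (ε ^ 2) (by positivity)
  obtain ⟨h1, h2⟩ := finiteNorm_of_mem_span_kernel hG hg
  refine ⟨toL2 G g, h2, ?_⟩
  have h3 := hG.finiteNorm hf
  rw [← enorm_toL2_sq (h3.sub h1), toL2_sub h3 h1] at hfg
  rw [edist_eq_enorm_sub]
  exact lt_of_pow_lt_pow_left' 2 hfg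

theorem hasSum_unitKernel (hG : HermiteBiehler G)
    (horth : Pairwise fun m n ↦ kernel G (lam m) (lam n) = 0)
    (hcomplete : IsCompleteSystem G fun n ↦ kernel G (lam n)) (hf : f ∈ space G) :
    HasSum (fun n ↦ ⟪unitKernel G (lam n), toL2 G f⟫_ℂ • unitKernel G (lam n)) (toL2 G f) :=
  hasSum_inner_smul_of_mem_closure_span (inner_unitKernel_of_ne hG horth)
    (fun _ ↦ norm_unitKernel hG) (toL2_mem_closure_span hG hcomplete hf)

/-- The system `conj (C(λ_n)) K_A(λ_n, ·) / √K_G(λ_n, λ_n)`. -/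
noncomputable def samplingFrame (G A C : ℂ → ℂ) (lam : ι → ℝ) (n : ι) : ℂ → ℂ :=
  (conj (C (lam n)) / (√(kernel G (lam n) (lam n)).re : ℝ)) • kernel A (lam n)

/-- Multiplication by `C` maps `H(A)` into `H(G)` and preserves norms on the real axis. -/
structure IsIsometricMultiplier (A G C : ℂ → ℂ) : Prop where
  hA : HermiteBiehler A
  hG : HermiteBiehler G
  mem_space : ∀ f ∈ space A, f * C ∈ space G
  norm_eq : ∀ᵐ t : ℝ, ‖G t‖ = ‖A t‖ * ‖C t‖ ∧ C t ≠ 0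

variable {A A' C C' : ℂ → ℂ}

theorem samplingFrame_mem_space (hA : HermiteBiehler A) (n : ι) :
    samplingFrame G A C lam n ∈ space A :=
  smul_mem_space hA.1.continuous _ (kernel_mem_space hA _)

theorem IsIsometricMultiplier.inner_eq (h : IsIsometricMultiplier A G C) (f g : ℂ → ℂ) :
    inner G (f * C) (g * C) = inner A f g := by
  apply integral_congr_ae
  filter_upwards [h.norm_eq] with t ht
  have hc : C t * conj (C t) = ((‖C t‖ ^ 2 : ℝ) : ℂ) := by
    rw [Complex.mul_conj, Complex.normSq_eq_norm_sq]
  have hc0 : ((‖C t‖ ^ 2 : ℝ) : ℂ) ≠ 0 := by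
    exact_mod_cast pow_ne_zero 2 (norm_ne_zero_iff.2 ht.2)
  rw [ht.1, mul_pow, Complex.ofReal_mul, ← mul_div_mul_right (f t * conj (g t)) _ hc0, ← hc,
    Pi.mul_apply, Pi.mul_apply, map_mul]
  ring_nf

theorem IsIsometricMultiplier.normSq_eq (h : IsIsometricMultiplier A G C) (f : ℂ → ℂ) :
    normSq G (f * C) = normSq A f := by
  apply lintegral_congr_ae
  filter_upwards [h.norm_eq] with t ht
  rw [← ofReal_norm, ← ofReal_norm, norm_div, norm_div, ht.1, Pi.mul_apply, norm_mul,
    mul_div_mul_right _ _ (norm_ne_zero_iff.2 ht.2)]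

theorem IsIsometricMultiplier.inner_samplingFrame (h : IsIsometricMultiplier A G C)
    (hf : f ∈ space A) (n : ι) : inner A f (samplingFrame G A C lam n) =
      f (lam n) * C (lam n) / (√(kernel G (lam n) (lam n)).re : ℝ) := by
  have hK := h.hA.finiteNorm (kernel_mem_space h.hA (lam n))
  have hf' := h.hA.finiteNorm hf
  rw [samplingFrame, inner_eq_inner_toL2 hf' (hK.smul _), toL2_smul _ hK, inner_smul_left,
    ← inner_eq_inner_toL2 hf' hK, inner_kernel h.hA hf, map_div₀, Complex.conj_conj,
    Complex.conj_ofReal]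
  ring

/-- The adjoint of multiplication by `C` sends the normalized kernels of `H(G)` to the frame. Frame
coefficients of `f` are thus expansion coefficients of `f * C`. -/
theorem IsIsometricMultiplier.inner_samplingFrame_eq (h : IsIsometricMultiplier A G C)
    (hf : f ∈ space A) (n : ι) : inner A f (samplingFrame G A C lam n) =
      ⟪unitKernel G (lam n), toL2 G (f * C)⟫_ℂ := by
  rw [h.inner_samplingFrame hf, inner_unitKernel h.hG (h.mem_space f hf), Pi.mul_apply]

theorem IsIsometricMultiplier.isParsevalFrame (h : IsIsometricMultiplier A G C)
    (horth : Pairwise fun m n ↦ kernel G (lam m) (lam n) = 0)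
    (hcomplete : IsCompleteSystem G fun n ↦ kernel G (lam n)) :
    IsParsevalFrame A (samplingFrame G A C lam) := by
  refine ⟨samplingFrame_mem_space h.hA, fun f hf ↦ ?_⟩
  have hs := hasSum_norm_inner_sq (hasSum_unitKernel h.hG horth hcomplete (h.mem_space f hf))
  rw [← h.normSq_eq, ← enorm_toL2_sq (h.hG.finiteNorm (h.mem_space f hf)), ← ofReal_norm,
    ← ENNReal.ofReal_pow (norm_nonneg _), ← hs.tsum_eq,
    ENNReal.ofReal_tsum_of_nonneg (fun _ ↦ by positivity) hs.summable]
  refine tsum_congr fun n ↦ ?_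
  rw [h.inner_samplingFrame_eq hf, ENNReal.ofReal_pow (norm_nonneg _), ofReal_norm]

/-- Expand `f * C` in the normalized kernels and project onto the closed span of the image of
`H(A')`. Each kernel projects to a frame vector times `C'`, and `f * C` projects to zero by `hzero`.
The isometry carries the convergence back to `H(A')`. -/
theorem IsIsometricMultiplier.synthesisAnalysisZero (h : IsIsometricMultiplier A G C)
    (h' : IsIsometricMultiplier A' G C')
    (horth : Pairwise fun m n ↦ kernel G (lam m) (lam n) = 0)
    (hcomplete : IsCompleteSystem G fun n ↦ kernel G (lam n))
    (hzero : ∀ f ∈ space A, ∀ g ∈ space A', inner G (f * C) (g * C') = 0) :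
    SynthesisAnalysisZero A A' (samplingFrame G A C lam) (samplingFrame G A' C' lam) := by
  intro f hf
  have hu : ∀ n, samplingFrame G A' C' lam n ∈ space A' := samplingFrame_mem_space h'.hA
  have hL : ∀ g ∈ space A', FiniteNorm G (g * C') := fun g hg ↦ h'.hG.finiteNorm (h'.mem_space g hg)
  have hLf := h.hG.finiteNorm (h.mem_space f hf)
  refine ⟨fun n ↦ smul_mem_space h'.hA.1.continuous _ (hu n), zero_mem_space A', ?_⟩
  have hs : HasSum (fun n ↦ ⟪unitKernel G (lam n), toL2 G (f * C)⟫_ℂ •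
      toL2 G (samplingFrame G A' C' lam n * C')) 0 := by
    apply hasSum_inner_smul_zero (S := {x | ∃ g ∈ space A', toL2 G (g * C') = x})
      (hasSum_unitKernel h.hG horth hcomplete (h.mem_space f hf))
    · exact fun n ↦ ⟨_, hu n, rfl⟩
    · rintro n _ ⟨g, hg, rfl⟩
      rw [← inner_eq_inner_toL2 (hL g hg) (hL _ (hu n)), h'.inner_eq, h'.inner_samplingFrame_eq hg]
    · rintro _ ⟨g, hg, rfl⟩
      rw [← inner_eq_inner_toL2 hLf (hL g hg), hzero f hf g hg]
  have hs' := ENNReal.Tendsto.pow (n := 2) ((continuous_enorm.tendsto _).comp hs)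
  simp only [enorm_zero, ne_eq, OfNat.ofNat_ne_zero, not_false_eq_true, zero_pow] at hs'
  refine hs'.congr fun T ↦ ?_
  have hN : ∀ n, FiniteNorm G (inner A f (samplingFrame G A C lam n) •
      (samplingFrame G A' C' lam n * C')) := fun n ↦ (hL _ (hu n)).smul _
  rw [sub_zero, ← h'.normSq_eq, Finset.sum_mul]
  simp_rw [smul_mul_assoc]
  rw [← enorm_toL2_sq (finiteNorm_sum hN T), toL2_sum hN]
  simp_rw [toL2_smul _ (hL _ (hu _)), h.inner_samplingFrame_eq hf]
  rfl

end Sampling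

end DeBranges

/-! ### The multipliers `F` and `E^*`, and the conclusion. -/

namespace DeBranges

open Filter Topology MeasureTheory

variable {E F f g : ℂ → ℂ} {lam : ℤ → ℝ}

theorem isIsometricMultiplier_mul (hE : HermiteBiehler E) (hF : HermiteBiehler F) :
    IsIsometricMultiplier E (E * F) F where
  hA := hE
  hG := hE.mul hF
  mem_space _ hf := mul_mem_space_self hF hf
  norm_eq := by
    filter_upwards [hF.ae_ne_zero] with t ht
    exact ⟨norm_mul _ _, ht⟩

theorem isIsometricMultiplier_sharp (hE : HermiteBiehler E) (hF : HermiteBiehler F) :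
    IsIsometricMultiplier F (E * F) (sharp E) where
  hA := hF
  hG := hE.mul hF
  mem_space _ hg := mul_sharp_mem_space hE hg
  norm_eq := by
    filter_upwards [hE.ae_ne_zero] with t ht
    rw [Pi.mul_apply, norm_mul, sharp_ofReal, RCLike.norm_conj, mul_comm]
    exact ⟨rfl, (map_ne_zero conj).2 ht⟩

theorem samplingFrame_eq_frameE (E F : ℂ → ℂ) (lam : ℤ → ℝ) :
    samplingFrame (E * F) E F lam = frameE E F lam := by
  ext n z
  rw [samplingFrame, frameE, Pi.smul_apply, smul_eq_mul]
  ring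

theorem samplingFrame_eq_frameF (E F : ℂ → ℂ) (lam : ℤ → ℝ) :
    samplingFrame (E * F) F (sharp E) lam = frameF E F lam := by
  ext n z
  rw [samplingFrame, frameF, Pi.smul_apply, smul_eq_mul, sharp_ofReal, Complex.conj_conj]
  ring

/-- Almost everywhere on the line, `conj E` and `conj F` cancel against `‖EF‖²`, which turns the
integrand into the boundary value of the analytic function `f^* g / (EF)`. -/
theorem inner_mul_mul_sharp (hE : HermiteBiehler E) (hF : HermiteBiehler F) (hf : f ∈ space E)
    (hg : g ∈ space F) : inner (E * F) (g * sharp E) (f * F) = 0 := by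
  rw [← integral_sharp_mul_div hE hF hf hg]
  apply integral_congr_ae
  filter_upwards [hE.ae_ne_zero, hF.ae_ne_zero] with t h1 h2
  have hn : ((‖(E * F) t‖ ^ 2 : ℝ) : ℂ) = E t * F t * (conj (E t) * conj (F t)) := by
    rw [← map_mul, Complex.mul_conj, Complex.normSq_eq_norm_sq]
    rfl
  have h1' : conj (E t) ≠ 0 := (map_ne_zero conj).2 h1
  have h2' : conj (F t) ≠ 0 := (map_ne_zero conj).2 h2
  rw [hn]
  simp only [Pi.mul_apply, sharp_ofReal, map_mul]
  field_simp

theorem inner_symm (E f g : ℂ → ℂ) : conj (inner E f g) = inner E g f := by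
  rw [inner, inner, ← integral_conj]
  congr 1 with t
  rw [map_div₀, map_mul, Complex.conj_conj, Complex.conj_ofReal, mul_comm]

theorem inner_mul_sharp_mul (hE : HermiteBiehler E) (hF : HermiteBiehler F) (hf : f ∈ space E)
    (hg : g ∈ space F) : inner (E * F) (f * F) (g * sharp E) = 0 := by
  rw [← inner_symm, inner_mul_mul_sharp hE hF hf hg, map_zero]

theorem sqrt_kernel_re_mul_self {G : ℂ → ℂ} (hG : HermiteBiehler G) (x : ℝ) :
    ((√(kernel G x x).re : ℝ) : ℂ) * (√(kernel G x x).re : ℝ) = kernel G x x := by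
  rw [sqrt_kernel_re hG, inner_self_kernel hG]
  push_cast
  ring

end DeBranges

theorem mainTheorem6 (E F : ℂ → ℂ)
    (hE : DeBranges.HermiteBiehler E) (hF : DeBranges.HermiteBiehler F)
    (φ : ℝ → ℝ) (hφ : DeBranges.IsPhaseFunction (E * F) φ)
    (α : ℝ) (hα : α ∈ Set.Ico 0 Real.pi)
    (lam : ℤ → ℝ) (hlam : ∀ n : ℤ, φ (lam n) = n * Real.pi + α)
    (hcomplete : DeBranges.IsCompleteSystem (E * F)
      (fun n : ℤ => DeBranges.kernel (E * F) (lam n))) :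
    (∀ f ∈ DeBranges.space E,
      DeBranges.HasSumIn F
        (fun n : ℤ => fun z : ℂ =>
          f (lam n) * F (lam n) * (E (lam n) * DeBranges.kernel F (lam n) z /
            DeBranges.kernel (E * F) (lam n) (lam n))) 0) ∧
    (∀ g ∈ DeBranges.space F,
      DeBranges.HasSumIn E
        (fun n : ℤ => fun z : ℂ =>
          g (lam n) * DeBranges.sharp E (lam n) *
            (conj (F (lam n)) * DeBranges.kernel E (lam n) z /
              DeBranges.kernel (E * F) (lam n) (lam n))) 0) ∧
    DeBranges.IsParsevalFrame E (DeBranges.frameE E F lam) ∧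
    DeBranges.IsParsevalFrame F (DeBranges.frameF E F lam) ∧
    DeBranges.IsOrthogonalPair E F (DeBranges.frameE E F lam) (DeBranges.frameF E F lam) := by
  have hG := hE.mul hF
  have h1 := DeBranges.isIsometricMultiplier_mul hE hF
  have h2 := DeBranges.isIsometricMultiplier_sharp hE hF
  have horth : Pairwise fun m n ↦ DeBranges.kernel (E * F) (lam m) (lam n) = 0 := fun m n hmn ↦
    DeBranges.kernel_eq_zero_of_isPhaseFunction hφ (hlam m) (hlam n) hmn
  have h12 := h1.synthesisAnalysisZero h2 horth hcomplete
    fun f hf g hg ↦ DeBranges.inner_mul_sharp_mul hE hF hf hg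
  have h21 := h2.synthesisAnalysisZero h1 horth hcomplete
    fun g hg f hf ↦ DeBranges.inner_mul_mul_sharp hE hF hf hg
  have p1 := h1.isParsevalFrame horth hcomplete
  have p2 := h2.isParsevalFrame horth hcomplete
  have i1 := fun f hf n ↦ h1.inner_samplingFrame (lam := lam) (f := f) hf n
  have i2 := fun g hg n ↦ h2.inner_samplingFrame (lam := lam) (f := g) hg n
  rw [DeBranges.samplingFrame_eq_frameE, DeBranges.samplingFrame_eq_frameF] at h12 h21
  rw [DeBranges.samplingFrame_eq_frameE] at p1 i1
  rw [DeBranges.samplingFrame_eq_frameF] at p2 i2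
  refine ⟨fun f hf ↦ ?_, fun g hg ↦ ?_, p1, p2, h12, h21⟩
  -- The analysis coefficient and the frame vector each carry one square root of `K_{EF}(λ_n, λ_n)`;
  -- together they form the denominator of the sampling series.
  · convert h12 f hf using 1
    ext n z
    rw [Pi.smul_apply, smul_eq_mul, i1 f hf, DeBranges.frameF, div_mul_div_comm,
      DeBranges.sqrt_kernel_re_mul_self hG, ← mul_div_assoc]
  · convert h21 g hg using 1
    ext n z
    rw [Pi.smul_apply, smul_eq_mul, i2 g hg, DeBranges.frameE, div_mul_div_comm,
      DeBranges.sqrt_kernel_re_mul_self hG, ← mul_div_assoc]
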